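/- Notation. Let $\mathbb R^+=(0,\infty)$. For $a\in\mathbb R$ let $\omega^a(x)=x^a$, and let $L^2_{\omega^a}$ be the space of complex-valued measurable functions on $\mathbb R^+$ with $\|f\|_{\omega^a}^2=\int_0^\infty |f|^2x^a\,dx<\infty$, with inner product $(f,g)_{\omega^a}=\int_0^\infty f\bar g\,x^a\,dx$. For $\lambda>0$ and $\mu\in[j-1,j)$ with $j\in\mathbb N$, the left tempered fractional derivative on the half line is $${}_0D_x^{\mu,\lambda}u(x)=e^{-\lambda x}\frac{d^j}{dx^j}\,\frac1{\Gamma(j-\mu)}\int_0^x (x-y)^{j-\mu-1}e^{\lambda y}u(y)\,dy,$$ with $d^j/dx^j$ in the sense of distributions on $\mathbb R^+$. For $\nu>0$ and $m\in\mathbb N_0$ let $$A^m_{\nu,\lambda}(\mathbb R^+)=\{u\in L^2_{\omega^{-\nu}}:\ {}_0D_x^{\nu+k,\lambda}u\in L^2_{\omega^k},\ k=0,\dots,m\}.$$ Let $\mathcal P_N$ be the set of polynomials of degree at most $N$, let $\mathcal F_N^{\nu,\lambda}=\{x^\nu e^{-\lambda x}p(x):p\in\mathcal P_N\}$, and let $\pi_N^{-\nu,\lambda}u\in\mathcal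 F_N^{\nu,\lambda}$ be the orthogonal projection of $u\in L^2_{\omega^{-\nu}}$, that is, $(\pi_N^{-\nu,\lambda}u-u,\phi)_{\omega^{-\nu}}=0$ for all $\phi\in\mathcal F_N^{\nu,\lambda}$. Theorem. Let $\nu>0$ and $m\in\mathbb N_0$. There are constants $c=c(N)$, depending only on $\nu$, $m$ and $N$, with $c(N)\to1$ as $N\to\infty$, such that the following holds for all $\lambda>0$, all integers $N\ge1$ with $m\le N+1$, and all $u\in A^m_{\nu,\lambda}(\mathbb R^+)$ that satisfy the homogeneous initial conditions $$\lim_{x\to0+}{}_0D_x^{\nu-i,\lambda}u(x)=0\quad\text{for all integers } i \text{ with } 1\le i<\nu$$ (existence of these derivatives being part of the condition; there is no condition when $\nu\le1$). The projection $\pi_N^{-\nu,\lambda}u$ exists and is unique, $\pi_N^{-\nu,\lambda}u-u\in A^m_{\nu,\lambda}(\mathbb R^+)$, $$\|\pi_N^{-\nu,\lambda}u-u\|_{\omega^{-\nu}}\le c\,(2\lambda N)^{-\frac{\nu+m}2}\,\|{}_0D_x^{\nu+m,\lambda}u\|_{\omega^m},$$ and for every integer $k$ with $0\le k\le m$, $$\|{}_0D_x^{\nu+k,\lambda}(\pi_N^{-\nu,\lambda}u-u)\|_{\omega^k}\le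 c\,(2\lambda N)^{\frac{k-m}2}\,\|{}_0D_x^{\nu+m,\lambda}u\|_{\omega^m}.$$ -/

import Mathlib

open MeasureTheory Set Filter
open scoped Topology ContDiff ENNReal

namespace TemperedLaguerre

noncomputable section

/-- The measure `x ^ a dx` on the half line `(0, ∞)`. -/
def weightMeasure (a : ℝ) : Measure ℝ :=
  (volume.restrict (Ioi (0 : ℝ))).withDensity fun x => ENNReal.ofReal (x ^ a)

/-- `u` belongs to the weighted space `L²` of `(0, ∞)` with weight `x ^ a`. -/
def MemWeightedL2 (a : ℝ) (u : ℝ → ℂ) : Prop :=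
  MemLp u 2 (weightMeasure a)

/-- The weighted norm, `‖u‖² = ∫_0^∞ |u(x)|² x ^ a dx`. -/
def weightedNorm (a : ℝ) (u : ℝ → ℂ) : ℝ :=
  (eLpNorm u 2 (weightMeasure a)).toReal

/-- The weighted inner product `∫_0^∞ f(x) conj(g(x)) x ^ a dx`. -/
def weightedInner (a : ℝ) (f g : ℝ → ℂ) : ℂ :=
  ∫ x, f x * (starRingEnd ℂ) (g x) ∂(weightMeasure a)

/-- The left Riemann-Liouville fractional integral of order `μ > 0` with base point `0`. -/
def rlIntegral (μ : ℝ) (u : ℝ → ℂ) (x : ℝ) : ℂ :=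
  (Real.Gamma μ)⁻¹ • ∫ y in Ioo 0 x, ((x - y) ^ (μ - 1)) • u y

/-- `g` is the `k`-th derivative of `f` on `(0, ∞)` in the sense of distributions. -/
def HasWeakDeriv (k : ℕ) (f g : ℝ → ℂ) : Prop :=
  LocallyIntegrableOn f (Ioi 0) ∧ LocallyIntegrableOn g (Ioi 0) ∧
    ∀ φ : ℝ → ℝ, ContDiff ℝ ∞ φ → HasCompactSupport φ → tsupport φ ⊆ Ioi 0 →
      ∫ x in Ioi 0, (iteratedDeriv k φ x) • f x = (-1) ^ k * ∫ x in Ioi 0, (φ x) • g x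

/-- `g` is the left tempered fractional derivative of order `μ ≥ 0` of `u` on the half line:
`g(x) = e^{-lam x} (d/dx)^k I^{k - μ} {e^{lam y} u(y)}(x)`, where `k` is the integer with
`k - 1 ≤ μ < k`. -/
def HasTemperedDeriv (μ lam : ℝ) (u g : ℝ → ℂ) : Prop :=
  (∀ R : ℝ, IntegrableOn u (Ioc 0 R)) ∧
    HasWeakDeriv (⌊μ⌋₊ + 1)
      (rlIntegral (((⌊μ⌋₊ + 1 : ℕ) : ℝ) - μ) fun y => Real.exp (lam * y) • u y)
      (fun x => Real.exp (lam * x) • g x)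

open Classical in
/-- The left tempered fractional derivative of order `μ` of `u`, determined up to equality almost
everywhere on `(0, ∞)`, and zero if it does not exist. -/
def temperedDeriv (μ lam : ℝ) (u : ℝ → ℂ) : ℝ → ℂ :=
  if h : ∃ g, HasTemperedDeriv μ lam u g then h.choose else 0

/-- The non-uniformly weighted Sobolev space `A^m` with parameters `ν`, `lam`. -/
def MemA (ν lam : ℝ) (m : ℕ) (u : ℝ → ℂ) : Prop :=
  MemWeightedL2 (-ν) u ∧
    ∀ k ≤ m, ∃ g, HasTemperedDeriv (ν + k) lam u g ∧ MemWeightedL2 k g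

/-- Homogeneous initial conditions for the derivative of order `ν`: for every integer `i` with
`1 ≤ i < ν`, the tempered derivative of order `ν - i` of `u` (that is, some representative of it)
tends to `0` at `0+`. There is no condition if `ν ≤ 1`. -/
def HomogeneousInitial (ν lam : ℝ) (u : ℝ → ℂ) : Prop :=
  ∀ i : ℕ, 1 ≤ i → (i : ℝ) < ν →
    ∃ h, HasTemperedDeriv (ν - i) lam u h ∧ Tendsto h (𝓝[>] 0) (𝓝 0)

/-- The finite dimensional space of the functions `x ^ ν e^{-lam x} p(x)`, with `p` a polynomial of
degree at most `N`. -/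
def glfSpace (ν lam : ℝ) (N : ℕ) : Set (ℝ → ℂ) :=
  {f | ∃ p : Polynomial ℂ, p.natDegree ≤ N ∧
    f = fun x : ℝ => ((x ^ ν * Real.exp (-lam * x) : ℝ) : ℂ) * p.eval (x : ℂ)}

/-- `w` is the orthogonal projection of `u` onto `glfSpace ν lam N` with respect to the inner
product with weight `x ^ (-ν)`. -/
def IsProjection (ν lam : ℝ) (N : ℕ) (u w : ℝ → ℂ) : Prop :=
  w ∈ glfSpace ν lam N ∧
    ∀ φ ∈ glfSpace ν lam N, weightedInner (-ν) (fun x => w x - u x) φ = 0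

end

end TemperedLaguerre

/-! ### Laguerre polynomials with a real parameter, and their integrals against Gamma weights. -/

namespace TemperedLaguerre

open Polynomial

/-! The problem is diagonal in Laguerre functions. Put b = 2 lam and let c_n(u) be the integral of u
against e^{-lam x} L_n^(ν)(bx). Up to normalization these are the coefficients of u in the
orthogonal basis x^ν e^{-lam x} L_n^(ν)(bx) for the weight x^{-ν}, and the first N + 1 basis
functions span the projection space. The tempered derivative of order ν + k maps this basis to
Laguerre functions orthogonal for the weight x^k: its coefficient against L_j^(k) is (-1)^k
(j+k)!/j! b^ν c_{j+k}(u) (`MemA.polyCoeff_temperedDeriv`). With W_n = b^{2ν+1} n! |c_n(u)|^2,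
Parseval (`hasSum_sq_polyCoeff_lag`) gives ‖u‖^2 = b^{-ν} Σ_n W_n / Γ(ν+n+1) and ‖D^{ν+k} u‖^2 = b^k
Σ_j W_{j+k} / j!. The projection error has W_n = 0 for n ≤ N and the W_n of u for n > N. So the
estimates compare two series term by term: the ratios (n-m)!/Γ(ν+n+1) and (n-m)!/(n-k)! do not
increase with n, and their values at n = N + 1 give the constants, which tend to 1 after scaling by
powers of N.

The coefficient relation rests on integration by parts. From order ν + k to ν + k + 1 it is
Rodrigues' formula, whose factor x^{k+1} removes the boundary term (`polyCoeff_lag_succ`). For order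
ν (`polyCoeff_lag_tempered`) let M = ⌊ν⌋ + 1: moving M derivatives onto e^{-bx} L_n^(0)(bx) raises
the parameter from 0 to M, and the adjoint of the fractional integral of order M - ν, a Weyl
integral, lowers it from M to ν (`gammaInt_lag_comp`). The boundary terms at 0 only have to vanish
in the mean over (0, ε). For the intermediate derivatives this is the homogeneous initial condition;
for the fractional integral itself, and for e^{lam x} u when ν is an integer, it follows from u
being square integrable against x^{-ν}.

Completeness comes from the uniqueness of moments under exponential decay
(`ae_eq_zero_of_moments_eq_zero`). Since the relation is also applied to the error, the elements of
the projection space must satisfy the hypotheses on u (`memA_glf`, `homogeneousInitial_glf`). -/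

/-- The scaled Laguerre polynomial `L_n^{(a)}(b x)`, defined through the Rodrigues recursion. -/
noncomputable def lag (b : ℝ) : ℕ → ℝ → ℝ[X]
  | 0, _ => 1
  | n + 1, a => C (1 / ((n : ℝ) + 1)) *
      ((C (a + 1) - C b * X) * lag b n (a + 1) + X * derivative (lag b n (a + 1)))

lemma lag_zero (b a : ℝ) : lag b 0 a = 1 := rfl

lemma lag_succ (b a : ℝ) (n : ℕ) :
    C ((n : ℝ) + 1) * lag b (n + 1) a =
      (C (a + 1) - C b * X) * lag b n (a + 1) + X * derivative (lag b n (a + 1)) := by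
  rw [lag, ← mul_assoc, ← C_mul, mul_one_div_cancel (by positivity), C_1, one_mul]

lemma C_natCast_add_one_mul_cancel {n : ℕ} {p q : ℝ[X]}
    (h : C ((n : ℝ) + 1) * p = C ((n : ℝ) + 1) * q) : p = q :=
  mul_left_cancel₀ (C_ne_zero.2 (by positivity)) h

/-- Induction along the Rodrigues recursion, with the parameter free because the recursion raises
it. This form keeps the degree fixed, which is what differentiating e^{-bx} L_n^(a)(bx) requires. -/
lemma derivative_lag_eq_sub (b : ℝ) (n : ℕ) (a : ℝ) :
    derivative (lag b n a) = C b * (lag b n a - lag b n (a + 1)) := by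
  induction n generalizing a with
  | zero => simp [lag_zero]
  | succ n ih =>
    apply C_natCast_add_one_mul_cancel (n := n)
    have h1 := congrArg derivative (lag_succ b a n)
    have h2 := lag_succ b (a + 1) n
    have h0 := lag_succ b a n
    have h3 := ih (a + 1)
    have h4 := congrArg derivative h3
    simp only [derivative_mul, derivative_add, derivative_sub, derivative_C, derivative_X, zero_mul,
      derivative_one, zero_add, one_mul, mul_one, C_add, C_1] at h0 h1 h2 h3 h4 ⊢
    rw [h1]
    linear_combination (C b) * h2 - (C b) * h0 + (C a + 1 + 1 - C b * X) * h3 + X * h4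

lemma derivative_lag_succ (b : ℝ) (n : ℕ) (a : ℝ) :
    derivative (lag b (n + 1) a) = - C b * lag b n (a + 1) := by
  induction n generalizing a with
  | zero =>
    apply C_natCast_add_one_mul_cancel (n := 0)
    have h1 := congrArg derivative (lag_succ b a 0)
    simp only [derivative_mul, derivative_C, zero_mul, zero_add] at h1
    rw [h1]
    simp [lag_zero]
  | succ n ih =>
    apply C_natCast_add_one_mul_cancel (n := n + 1)
    have h1 := congrArg derivative (lag_succ b a (n + 1))
    have h2 := lag_succ b (a + 1) n
    have h3 := ih (a + 1)
    have h4 := congrArg derivative h3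
    simp only [derivative_mul, derivative_add, derivative_sub, derivative_neg, derivative_C,
      derivative_X, zero_mul, neg_zero,
      derivative_one, zero_add, one_mul, mul_one, C_add, C_1] at h1 h2 h3 h4 ⊢
    push_cast at h1 ⊢
    simp only [C_add, C_1] at h1 ⊢
    linear_combination h1 + C b * h2 + (C a + 1 + 1 - C b * X) * h3 + X * h4

lemma natDegree_lag_le (b : ℝ) (n : ℕ) (a : ℝ) : (lag b n a).natDegree ≤ n := by
  induction n generalizing a with
  | zero => simp [lag_zero]
  | succ n ih =>
    rw [lag]
    refine (natDegree_C_mul_le _ _).trans (natDegree_add_le_of_degree_le ?_ ?_)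
    · refine natDegree_mul_le.trans ?_
      have : (C (a + 1) - C b * X : ℝ[X]).natDegree ≤ 1 :=
        natDegree_sub_le_of_le ((natDegree_C _).trans_le zero_le_one) ((natDegree_C_mul_le b X).trans natDegree_X_le)
      have := ih (a + 1)
      omega
    · refine natDegree_mul_le.trans ?_
      have h2 := natDegree_derivative_le (lag b n (a + 1))
      have := ih (a + 1)
      have h3 := natDegree_X_le (R := ℝ)
      omega

/-- Each recursion step multiplies the leading coefficient by -b/(n+1); the derivative term does not
reach the top degree. -/
lemma coeff_lag_self_ne_zero {b : ℝ} (hb : b ≠ 0) (n : ℕ) (a : ℝ) :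
    (lag b n a).coeff n ≠ 0 := by
  induction n generalizing a with
  | zero => simp [lag_zero]
  | succ n ih =>
    have h0 : (lag b n (a + 1)).coeff (n + 1) = 0 :=
      coeff_eq_zero_of_natDegree_lt (by have := natDegree_lag_le b n (a + 1); omega)
    rw [lag, coeff_C_mul, coeff_add, sub_mul, coeff_sub, coeff_C_mul, mul_assoc, coeff_C_mul,
      coeff_X_mul, coeff_X_mul, h0, coeff_derivative, h0]
    have := ih (a + 1)
    have h1 : (n : ℝ) + 1 ≠ 0 := by positivity
    simp [hb, this, h1]

/-- A sequence annihilated by the Laguerre polynomials of degree at most `N` vanishes up to `N`. -/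
lemma eq_zero_of_lag_sum_eq_zero {b : ℝ} (hb : b ≠ 0) (a : ℝ) (M : ℕ → ℂ) (N : ℕ)
    (h : ∀ n ≤ N, ∑ j ∈ Finset.range (n + 1), (((lag b n a).coeff j : ℝ) : ℂ) * M j = 0) :
    ∀ j ≤ N, M j = 0 := by
  intro j
  induction j using Nat.strong_induction_on with
  | _ j ih =>
    intro hj
    have h1 := h j hj
    rw [Finset.sum_range_succ, Finset.sum_eq_zero, zero_add, mul_eq_zero] at h1
    · exact h1.resolve_left (by exact_mod_cast coeff_lag_self_ne_zero hb j a)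
    · intro i hi
      have hi' := Finset.mem_range.1 hi
      rw [ih i hi' (by omega), mul_zero]

lemma integrableOn_rpow_mul_exp {b α : ℝ} (hb : 0 < b) (hα : -1 < α) :
    IntegrableOn (fun x : ℝ => x ^ α * Real.exp (-b * x)) (Ioi 0) := by
  simpa using integrableOn_rpow_mul_exp_neg_mul_rpow hα one_pos hb

lemma integrableOn_rpow_mul_exp_mul_eval {b α : ℝ} (hb : 0 < b) (hα : -1 < α) (p : ℝ[X]) :
    IntegrableOn (fun x : ℝ => x ^ α * Real.exp (-b * x) * p.eval x) (Ioi 0) := by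
  induction p using Polynomial.induction_on' with
  | add p q hp hq => simp only [eval_add, mul_add]; exact Integrable.add hp hq
  | monomial n c =>
    have hn : -1 < α + n := by have : (0 : ℝ) ≤ n := n.cast_nonneg; linarith
    refine IntegrableOn.congr_fun ((integrableOn_rpow_mul_exp hb hn).mul_const c) ?_
      measurableSet_Ioi
    intro x hx
    simp only [eval_monomial, Real.rpow_add_natCast (ne_of_gt hx)]
    ring

/-- The integral of a polynomial against the Gamma weight `x ^ α e^{-b x}`. -/
noncomputable def gammaInt (b α : ℝ) (p : ℝ[X]) : ℝ :=
  ∫ x in Ioi (0 : ℝ), x ^ α * Real.exp (-b * x) * p.eval x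

section gammaInt

variable {b α : ℝ}

lemma gammaInt_add (hb : 0 < b) (hα : -1 < α) (p q : ℝ[X]) :
    gammaInt b α (p + q) = gammaInt b α p + gammaInt b α q := by
  simp only [gammaInt, eval_add, mul_add]
  exact integral_add (integrableOn_rpow_mul_exp_mul_eval hb hα p)
    (integrableOn_rpow_mul_exp_mul_eval hb hα q)

lemma gammaInt_C_mul (c : ℝ) (p : ℝ[X]) : gammaInt b α (C c * p) = c * gammaInt b α p := by
  simp only [gammaInt, ← integral_const_mul, eval_mul, eval_C]
  exact integral_congr_ae (ae_of_all _ fun x => by ring)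

lemma gammaInt_sub (hb : 0 < b) (hα : -1 < α) (p q : ℝ[X]) :
    gammaInt b α (p - q) = gammaInt b α p - gammaInt b α q := by
  have h : p - q = p + C (-1) * q := by simp [sub_eq_add_neg]
  rw [h, gammaInt_add hb hα, gammaInt_C_mul]
  ring

lemma gammaInt_X_mul (p : ℝ[X]) : gammaInt b α (X * p) = gammaInt b (α + 1) p := by
  refine setIntegral_congr_fun measurableSet_Ioi fun x hx => ?_
  simp only [eval_mul, eval_X, Real.rpow_add_one (ne_of_gt hx)]
  ring

lemma gammaInt_one (hb : 0 < b) (hα : -1 < α) :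
    gammaInt b α 1 = b ^ (-(α + 1)) * Real.Gamma (α + 1) := by
  have h := Real.integral_rpow_mul_exp_neg_mul_Ioi (a := α + 1) (by linarith) hb
  simp only [add_sub_cancel_right] at h
  simp only [gammaInt, eval_one, mul_one, neg_mul]
  rw [h, one_div, Real.inv_rpow hb.le, Real.rpow_neg hb.le]

lemma gammaInt_X_pow (n : ℕ) : gammaInt b α (X ^ n) = gammaInt b (α + n) 1 := by
  induction n generalizing α with
  | zero => simp
  | succ n ih =>
    rw [pow_succ', gammaInt_X_mul, ih]
    push_cast
    ring_nf

lemma gammaInt_add_one (hb : 0 < b) (hα : -1 < α) :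
    b * gammaInt b (α + 1) 1 = (α + 1) * gammaInt b α 1 := by
  rw [gammaInt_one hb hα, gammaInt_one hb (by linarith), Real.Gamma_add_one (by linarith),
    show -(α + 1) = -(α + 1 + 1) + 1 by ring, Real.rpow_add_one hb.ne']
  ring

/-- Integration by parts for polynomials against the Gamma weight. -/
lemma gammaInt_deriv (hb : 0 < b) (hα : -1 < α) (p : ℝ[X]) :
    gammaInt b α ((C (α + 1) - C b * X) * p + X * derivative p) = 0 := by
  -- The integrand is the derivative of x^{α+1} e^{-bx} p(x). On monomials its vanishing is the
  -- Gamma recursion, so no boundary limit has to be taken.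
  induction p using Polynomial.induction_on' with
  | add p q hp hq =>
    rw [← add_zero (0 : ℝ)]
    nth_rewrite 1 [← hp]
    rw [← hq, ← gammaInt_add hb hα]
    congr 1
    simp only [derivative_add]
    ring
  | monomial n c =>
    have hn : -1 < α + n := by have : (0 : ℝ) ≤ n := n.cast_nonneg; linarith
    have h1 : (C (α + 1) - C b * X) * monomial n c + X * derivative (monomial n c)
        = C c * (C (α + n + 1) * X ^ n - C b * X ^ (n + 1)) := by
      rw [derivative_monomial, ← C_mul_X_pow_eq_monomial, ← C_mul_X_pow_eq_monomial]
      rcases n with _ | n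
      · simp; ring
      · simp only [C_add, C_mul, C_1, Nat.add_sub_cancel]
        ring
    have h2 := gammaInt_add_one hb hn
    rw [h1, gammaInt_C_mul, gammaInt_sub hb hα, gammaInt_C_mul, gammaInt_C_mul, gammaInt_X_pow,
      gammaInt_X_pow]
    push_cast
    rw [← add_assoc, h2]
    ring

/-- By Rodrigues, (n+1) x^α e^{-bx} L_{n+1}^(α)(bx) is the derivative of x^{α+1} e^{-bx}
L_n^(α+1)(bx), so the derivative moves onto p. Iteration yields orthogonality, and the choice p =
L_{n+1}^(α) yields the norm. -/
lemma gammaInt_lag_succ_mul (hb : 0 < b) (hα : -1 < α) (n : ℕ) (p : ℝ[X]) :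
    (n + 1) * gammaInt b α (lag b (n + 1) α * p) =
      - gammaInt b (α + 1) (lag b n (α + 1) * derivative p) := by
  have h := gammaInt_deriv hb hα (lag b n (α + 1) * p)
  have h1 : (C (α + 1) - C b * X) * (lag b n (α + 1) * p) + X * derivative (lag b n (α + 1) * p)
      = C ((n : ℝ) + 1) * (lag b (n + 1) α * p) + X * (lag b n (α + 1) * derivative p) := by
    rw [← mul_assoc (C ((n : ℝ) + 1)), lag_succ, derivative_mul]
    ring
  rw [h1, gammaInt_add hb hα, gammaInt_C_mul, gammaInt_X_mul] at h
  linarith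

lemma gammaInt_lag_mul_eq_zero (hb : 0 < b) (n : ℕ) (hα : -1 < α) (p : ℝ[X])
    (hp : derivative^[n] p = 0) : gammaInt b α (lag b n α * p) = 0 := by
  induction n generalizing α p with
  | zero =>
    have : p = 0 := hp
    simp [this, gammaInt]
  | succ n ih =>
    have h := gammaInt_lag_succ_mul hb hα n p
    rw [ih (by linarith) (derivative p) hp, neg_zero, mul_eq_zero] at h
    exact h.resolve_left (by positivity)

/-- The squared norm of the Laguerre polynomial. -/
noncomputable def lagNormSq (b : ℝ) (n : ℕ) (α : ℝ) : ℝ :=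
  Real.Gamma (α + n + 1) / n.factorial * b ^ (-(α + 1))

lemma lagNormSq_pos (hb : 0 < b) (hα : -1 < α) (n : ℕ) : 0 < lagNormSq b n α := by
  have : (0 : ℝ) ≤ n := n.cast_nonneg
  have := Real.Gamma_pos_of_pos (s := α + n + 1) (by linarith)
  unfold lagNormSq
  positivity

lemma gammaInt_lag_mul_self (hb : 0 < b) (n : ℕ) (hα : -1 < α) :
    gammaInt b α (lag b n α * lag b n α) = lagNormSq b n α := by
  induction n generalizing α with
  | zero => simp [lag_zero, lagNormSq, gammaInt_one hb hα, mul_comm]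
  | succ n ih =>
    have h := gammaInt_lag_succ_mul hb hα n (lag b (n + 1) α)
    rw [derivative_lag_succ, show lag b n (α + 1) * (-C b * lag b n (α + 1))
      = C (-b) * (lag b n (α + 1) * lag b n (α + 1)) by rw [C_neg]; ring, gammaInt_C_mul,
      ih (by linarith)] at h
    have hn : (n : ℝ) + 1 ≠ 0 := by positivity
    have hf : (n.factorial : ℝ) ≠ 0 := by positivity
    have h3 : b * b ^ (-(α + 1 + 1)) = b ^ (-(α + 1)) := by
      rw [show -(α + 1) = -(α + 1 + 1) + 1 by ring, Real.rpow_add_one hb.ne']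
      ring
    refine mul_left_cancel₀ hn (h.trans ?_)
    unfold lagNormSq
    rw [Nat.factorial_succ, ← h3]
    push_cast
    rw [show α + ((n : ℝ) + 1) + 1 = α + 1 + n + 1 by ring]
    field_simp

lemma gammaInt_lag_mul_lag_of_ne (hb : 0 < b) (hα : -1 < α) {i j : ℕ} (hij : i ≠ j) :
    gammaInt b α (lag b i α * lag b j α) = 0 := by
  rcases hij.lt_or_gt with h | h
  · rw [mul_comm]
    exact gammaInt_lag_mul_eq_zero hb j hα _
      (iterate_derivative_eq_zero ((natDegree_lag_le b i α).trans_lt h))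
  · exact gammaInt_lag_mul_eq_zero hb i hα _
      (iterate_derivative_eq_zero ((natDegree_lag_le b j α).trans_lt h))

/-- The Weyl fractional integral of order `s` of `e^{-b x} L_n^{(a)}(b x)`. -/
lemma gammaInt_lag_comp (hb : 0 < b) {s : ℝ} (hs : 0 < s) (n : ℕ) (a x : ℝ) :
    gammaInt b (s - 1) ((lag b n a).comp (X + C x)) =
      Real.Gamma s * b ^ (-s) * (lag b n (a - s)).eval x := by
  have hs' : -1 < s - 1 := by linarith
  induction n generalizing a with
  | zero =>
    rw [lag_zero, one_comp, gammaInt_one hb hs', lag_zero, eval_one]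
    ring_nf
  | succ n ih =>
    -- Rodrigues at the point t + x, where t is `X`. Splitting a + 1 - b(t + x) as (s - bt) + (a + 1
    -- - s - bx) isolates a total derivative for the weight t^{s-1} e^{-bt}; what remains is the
    -- recursion for the parameter a - s.
    have h0 : C ((n : ℝ) + 1) * (lag b (n + 1) a).comp (X + C x) =
        ((C (s - 1 + 1) - C b * X) * (lag b n (a + 1)).comp (X + C x)
          + X * derivative ((lag b n (a + 1)).comp (X + C x)))
        + (C (a + 1 - s - b * x) * (lag b n (a + 1)).comp (X + C x)
          + C (x * b) * ((lag b n (a + 1)).comp (X + C x)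
            - (lag b n (a + 1 + 1)).comp (X + C x))) := by
      have h := congrArg (fun p => p.comp (X + C x)) (lag_succ b a n)
      have hd : derivative ((lag b n (a + 1)).comp (X + C x)) =
          C b * ((lag b n (a + 1)).comp (X + C x) - (lag b n (a + 1 + 1)).comp (X + C x)) := by
        rw [derivative_comp, derivative_lag_eq_sub]
        simp
      simp only [mul_comp, add_comp, sub_comp, C_comp, X_comp, derivative_lag_eq_sub] at h
      rw [h, hd]
      simp only [C_add, C_sub, C_mul, C_1]
      ring
    have h1 := congrArg (gammaInt b (s - 1)) h0
    rw [gammaInt_C_mul, gammaInt_add hb hs', gammaInt_deriv hb hs', gammaInt_add hb hs',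
      gammaInt_C_mul, gammaInt_C_mul, gammaInt_sub hb hs', ih, ih] at h1
    have h2 := congrArg (eval x) (lag_succ b (a - s) n)
    simp only [eval_mul, eval_add, eval_sub, eval_C, eval_X, derivative_lag_eq_sub] at h2
    refine mul_left_cancel₀ (show (n : ℝ) + 1 ≠ 0 by positivity) ?_
    rw [show a + 1 - s = a - s + 1 by ring, show a + 1 + 1 - s = a - s + 1 + 1 by ring] at h1
    linear_combination h1 - Real.Gamma s * b ^ (-s) * h2

end gammaInt

end TemperedLaguerre

/-! ### Uniqueness of moments under exponential decay. -/

namespace TemperedLaguerre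

open Polynomial

section Moments

variable {G : ℝ → ℂ} {δ : ℝ}

/-- Vanishing moments stay zero after an exponential tilt inside the region of convergence. -/
lemma integral_pow_mul_exp_smul_eq_zero_of_shift (hδ : 0 < δ)
    (hG : ∀ n : ℕ, IntegrableOn (fun x : ℝ => (x ^ n * Real.exp (δ * x)) • G x) (Ioi 0))
    {t : ℝ} (ht : 0 ≤ t)
    (h0 : ∀ n : ℕ, ∫ x in Ioi (0 : ℝ), (x ^ n * Real.exp (-t * x)) • G x = 0) (n : ℕ) :
    ∫ x in Ioi (0 : ℝ), (x ^ n * Real.exp (-(t + δ) * x)) • G x = 0 := by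
  have hmeas : AEStronglyMeasurable G (volume.restrict (Ioi 0)) := by
    have h1 := (hG 0).aestronglyMeasurable
    have h2 : AEStronglyMeasurable (fun x : ℝ => Real.exp (-(δ * x))) (volume.restrict (Ioi 0)) := by
      fun_prop
    refine (h2.smul h1).congr (ae_of_all _ fun x => ?_)
    simp only [Pi.smul_apply', smul_smul, pow_zero, one_mul, ← Real.exp_add]
    simp
  -- Expand e^{-δx} in its power series: every term is a vanishing moment, and all partial sums are
  -- dominated by x^n e^{δx} |G|.
  have hs : HasSum (fun k : ℕ => ∫ x in Ioi (0 : ℝ),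
      ((-δ) ^ k / k.factorial) • ((x ^ (n + k) * Real.exp (-t * x)) • G x))
      (∫ x in Ioi (0 : ℝ), (x ^ n * Real.exp (-(t + δ) * x)) • G x) := by
    refine hasSum_integral_of_dominated_convergence
      (fun k x => ((δ * x) ^ k / k.factorial) * ‖(x ^ n) • G x‖) ?_ ?_ ?_ ?_ ?_
    · intro k
      have : AEStronglyMeasurable (fun x : ℝ => x ^ (n + k) * Real.exp (-t * x))
        (volume.restrict (Ioi 0)) := by fun_prop
      exact (this.smul hmeas).const_smul ((-δ) ^ k / (k.factorial : ℝ))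
    · intro k
      filter_upwards [ae_restrict_mem measurableSet_Ioi] with x hx
      have hx : 0 < x := hx
      have he : Real.exp (-t * x) ≤ 1 := Real.exp_le_one_iff.2 (by nlinarith)
      rw [norm_smul, norm_smul, norm_smul, norm_div, norm_pow, norm_neg, norm_mul, norm_pow,
        norm_pow, Real.norm_of_nonneg hδ.le, Real.norm_of_nonneg hx.le, Real.norm_of_nonneg
        (Real.exp_pos _).le, Real.norm_natCast, mul_pow, pow_add]
      have : x ^ n * x ^ k * Real.exp (-t * x) * ‖G x‖ ≤ x ^ n * x ^ k * 1 * ‖G x‖ := by gcongr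
      calc δ ^ k / k.factorial * (x ^ n * x ^ k * Real.exp (-t * x) * ‖G x‖)
          ≤ δ ^ k / k.factorial * (x ^ n * x ^ k * 1 * ‖G x‖) := by gcongr
        _ = _ := by ring
    · filter_upwards with x
      exact (Real.summable_pow_div_factorial _).mul_right _
    · refine (hG n).norm.congr ?_
      filter_upwards with x
      rw [tsum_mul_right, (NormedSpace.expSeries_div_hasSum_exp (δ * x)).tsum_eq,
        ← Real.exp_eq_exp_ℝ, mul_comm (x ^ n), mul_smul, norm_smul,
        Real.norm_of_nonneg (Real.exp_pos _).le]
    · filter_upwards with x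
      have h1 : HasSum (fun k : ℕ => (-δ * x) ^ k / k.factorial) (Real.exp (-δ * x)) := by
        rw [Real.exp_eq_exp_ℝ]
        exact NormedSpace.expSeries_div_hasSum_exp (-δ * x)
      have h2 := h1.smul_const ((x ^ n * Real.exp (-t * x)) • G x)
      have e2 : Real.exp (-δ * x) • ((x ^ n * Real.exp (-t * x)) • G x)
          = (x ^ n * Real.exp (-(t + δ) * x)) • G x := by
        rw [smul_smul, show -(t + δ) * x = -δ * x + -t * x by ring, Real.exp_add]
        congr 1; ring
      rw [e2] at h2
      refine h2.congr_fun fun k => ?_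
      rw [smul_smul, smul_smul]
      congr 1
      rw [mul_pow, pow_add]; ring
  have hz : ∀ k : ℕ, ∫ x in Ioi (0 : ℝ),
      ((-δ) ^ k / k.factorial) • ((x ^ (n + k) * Real.exp (-t * x)) • G x) = 0 := by
    intro k
    rw [integral_smul, h0, smul_zero]
  simp only [hz] at hs
  exact hs.unique hasSum_zero

/-- A function on the half line with exponential decay is determined by its moments. -/
lemma ae_eq_zero_of_moments_eq_zero (hδ : 0 < δ)
    (hG : ∀ n : ℕ, IntegrableOn (fun x : ℝ => (x ^ n * Real.exp (δ * x)) • G x) (Ioi 0))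
    (h0 : ∀ n : ℕ, ∫ x in Ioi (0 : ℝ), (x ^ n) • G x = 0) :
    ∀ᵐ x ∂(volume.restrict (Ioi (0 : ℝ))), G x = 0 := by
  -- One tilt is limited to δ by the region of convergence, but tilts can be repeated. This reaches
  -- every power of e^{-δx}, hence every polynomial in it.
  have hexp : ∀ j n : ℕ, ∫ x in Ioi (0 : ℝ), (x ^ n * Real.exp (-(j * δ) * x)) • G x = 0 := by
    intro j
    induction j with
    | zero => simpa using h0
    | succ j ih =>
      intro n
      have := integral_pow_mul_exp_smul_eq_zero_of_shift hδ hG (t := j * δ) (by positivity) ih n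
      push_cast
      rwa [add_mul, one_mul]
  have hint : IntegrableOn G (Ioi 0) := by
    have h1 : IntegrableOn (fun x : ℝ => Real.exp (-(δ * x)) • ((x ^ 0 * Real.exp (δ * x)) • G x))
        (Ioi 0) := by
      refine Integrable.bdd_smul (φ := fun x : ℝ => Real.exp (-(δ * x))) (hG 0) 1 (by fun_prop) ?_
      filter_upwards [ae_restrict_mem measurableSet_Ioi] with x hx
      have hx : 0 < x := hx
      rw [Real.norm_of_nonneg (Real.exp_pos _).le]
      exact Real.exp_le_one_iff.2 (by nlinarith)
    refine h1.congr (ae_of_all _ fun x => ?_)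
    simp only [smul_smul, pow_zero, one_mul, ← Real.exp_add]
    simp
  have hbd : ∀ p : ℝ[X], IntegrableOn (fun x : ℝ => (p.eval (Real.exp (-δ * x))) • G x) (Ioi 0) := by
    intro p
    obtain ⟨C, hC⟩ := (isCompact_Icc (a := (0 : ℝ)) (b := 1)).exists_bound_of_continuousOn
      p.continuous.continuousOn
    refine Integrable.bdd_smul (φ := fun x : ℝ => p.eval (Real.exp (-δ * x))) hint C ?_ ?_
    · exact (p.continuous.comp (by fun_prop)).aestronglyMeasurable
    · filter_upwards [ae_restrict_mem measurableSet_Ioi] with x hx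
      have hx : 0 < x := hx
      exact hC _ ⟨(Real.exp_pos _).le, Real.exp_le_one_iff.2 (by nlinarith)⟩
  have hpoly : ∀ p : ℝ[X], ∫ x in Ioi (0 : ℝ), (p.eval (Real.exp (-δ * x))) • G x = 0 := by
    intro p
    induction p using Polynomial.induction_on' with
    | add p q hp hq =>
      simp only [eval_add, add_smul]
      rw [integral_add (hbd p) (hbd q), hp, hq, add_zero]
    | monomial n c =>
      simp only [eval_monomial, mul_smul]
      rw [integral_smul]
      have h1 := hexp n 0
      have h2 : ∫ x in Ioi (0 : ℝ), (Real.exp (-δ * x)) ^ n • G x = 0 := by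
        rw [← h1]
        refine integral_congr_ae (ae_of_all _ fun x => ?_)
        simp only [← Real.exp_nat_mul, pow_zero, one_mul]
        congr 2; ring
      rw [h2, smul_zero]
  have key := isOpen_Ioi.ae_eq_zero_of_integral_contDiff_smul_eq_zero (μ := volume) (U := Ioi (0 : ℝ)) (f := G)
    hint.locallyIntegrableOn ?_
  · rw [ae_restrict_iff' measurableSet_Ioi]; exact key
  intro φ hφ hφc hφs
  have hφ0 : ∀ x ≤ 0, φ x = 0 := fun x hx => by
    by_contra h
    exact absurd (hφs (subset_tsupport φ h)) (not_lt.2 hx)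
  obtain ⟨R, hR⟩ : ∃ R : ℝ, ∀ x, R < x → φ x = 0 := by
    obtain ⟨R, hR⟩ := hφc.isCompact.bddAbove
    refine ⟨R, fun x hx => ?_⟩
    by_contra h
    exact absurd (hR (subset_tsupport φ h)) (not_le.2 hx)
  -- In the variable z = e^{-δx} the test function becomes continuous on [0, 1], ready for
  -- Weierstrass approximation. Near z = 0 it vanishes by compact support, and at z = 0 the
  -- convention `Real.log 0 = 0` gives φ(0) = 0 as needed.
  have hψ : ContinuousOn (fun z : ℝ => φ (-Real.log z / δ)) (Icc 0 1) := by
    intro z hz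
    rcases hz.1.eq_or_lt with h | h
    · subst h
      have : (fun z : ℝ => φ (-Real.log z / δ)) =ᶠ[𝓝[Icc 0 1] 0] fun _ => 0 := by
        have h1 : ∀ᶠ z in 𝓝[Icc 0 1] (0 : ℝ), z < Real.exp (-(|R| + 1) * δ) :=
          mem_nhdsWithin_of_mem_nhds (Iio_mem_nhds (Real.exp_pos _))
        filter_upwards [h1, self_mem_nhdsWithin] with z hz1 hz2
        rcases hz2.1.eq_or_lt with h | h
        · rw [← h]; simpa using hφ0 0 le_rfl
        · apply hR
          rw [lt_div_iff₀ hδ]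
          have := Real.log_lt_log h hz1
          rw [Real.log_exp] at this
          nlinarith [le_abs_self R]
      refine ContinuousWithinAt.congr_of_eventuallyEq continuousWithinAt_const this ?_
      simpa using hφ0 0 le_rfl
    · refine ContinuousAt.continuousWithinAt ?_
      exact hφ.continuous.continuousAt.comp ((Real.continuousAt_log h.ne').neg.div_const δ)
  have hle : ∀ ε > 0, ‖∫ x in Ioi (0 : ℝ), φ x • G x‖ ≤ ε * ∫ x in Ioi (0 : ℝ), ‖G x‖ := by
    intro ε hε
    obtain ⟨p, hp⟩ := exists_polynomial_near_of_continuousOn 0 1 _ hψ ε hε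
    have hφi : IntegrableOn (fun x => φ x • G x) (Ioi 0) := by
      obtain ⟨C, hC⟩ := hφc.exists_bound_of_continuous hφ.continuous
      exact Integrable.bdd_smul hint C hφ.continuous.aestronglyMeasurable (ae_of_all _ hC)
    rw [← sub_zero (∫ x in Ioi (0 : ℝ), φ x • G x), ← hpoly p, ← integral_sub hφi (hbd p),
      ← integral_const_mul]
    refine norm_integral_le_of_norm_le (hint.norm.const_mul ε) ?_
    filter_upwards [ae_restrict_mem measurableSet_Ioi] with x hx
    have hx : 0 < x := hx
    rw [← sub_smul, norm_smul]
    gcongr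
    have := hp (Real.exp (-δ * x)) ⟨(Real.exp_pos _).le, Real.exp_le_one_iff.2 (by nlinarith)⟩
    rw [Real.log_exp, show -(-δ * x) / δ = x by field_simp, abs_sub_comm] at this
    exact this.le
  have h3 : ‖∫ x in Ioi (0 : ℝ), φ x • G x‖ ≤ 0 := by
    have ht : Tendsto (fun ε : ℝ => ε * ∫ x in Ioi (0 : ℝ), ‖G x‖) (𝓝[>] 0) (𝓝 0) := by
      have : Tendsto (fun ε : ℝ => ε * ∫ x in Ioi (0 : ℝ), ‖G x‖) (𝓝 0)
        (𝓝 (0 * ∫ x in Ioi (0 : ℝ), ‖G x‖)) := tendsto_id.mul_const _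
      rw [zero_mul] at this
      exact this.mono_left nhdsWithin_le_nhds
    exact ge_of_tendsto ht (eventually_mem_nhdsWithin.mono fun ε hε => hle ε hε)
  rw [← norm_le_zero_iff.1 h3]
  refine (setIntegral_eq_integral_of_forall_compl_eq_zero fun x hx => ?_).symm
  rw [hφ0 x (not_lt.1 hx), zero_smul]

end Moments

end TemperedLaguerre

/-! ### Completeness of the Laguerre functions and Parseval's identity. -/

namespace TemperedLaguerre

open Polynomial

section Parseval

variable {lam α : ℝ}

/-- The functions `x ^ (α / 2) e^{-lam x} p(x)` with `p` a polynomial. -/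
noncomputable def expPoly (lam α : ℝ) (p : ℝ[X]) (x : ℝ) : ℝ :=
  x ^ (α / 2) * Real.exp (-lam * x) * p.eval x

lemma expPoly_mul_expPoly (p q : ℝ[X]) {x : ℝ} (hx : 0 < x) :
    expPoly lam α p x * expPoly lam α q x =
      x ^ α * Real.exp (-(2 * lam) * x) * (p * q).eval x := by
  have h1 : x ^ α = x ^ (α / 2) * x ^ (α / 2) := by rw [← Real.rpow_add hx]; ring_nf
  have h2 : Real.exp (-(2 * lam) * x) = Real.exp (-lam * x) * Real.exp (-lam * x) := by
    rw [← Real.exp_add]; ring_nf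
  rw [expPoly, expPoly, eval_mul, h1, h2]
  ring

lemma measurable_expPoly (p : ℝ[X]) : Measurable (expPoly lam α p) := by
  unfold expPoly
  have := p.continuous.measurable
  fun_prop

lemma memLp_expPoly (hlam : 0 < lam) (hα : -1 < α) (p : ℝ[X]) :
    MemLp (expPoly lam α p) 2 (volume.restrict (Ioi 0)) := by
  rw [memLp_two_iff_integrable_sq (measurable_expPoly p).aestronglyMeasurable]
  refine IntegrableOn.congr_fun (integrableOn_rpow_mul_exp_mul_eval (b := 2 * lam) (by positivity) hα (p * p))
    (fun x hx => ?_) measurableSet_Ioi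
  rw [sq, expPoly_mul_expPoly p p hx]

lemma integrable_expPoly_smul {U : ℝ → ℂ} (hlam : 0 < lam) (hα : -1 < α) (p : ℝ[X])
    (hU : MemLp U 2 (volume.restrict (Ioi 0))) :
    IntegrableOn (fun x => expPoly lam α p x • U x) (Ioi 0) := by
  have h := MemLp.integrable_mul (memLp_expPoly hlam hα p).ofReal (𝕜 := ℂ) hU
  refine h.congr (ae_of_all _ fun x => ?_)
  simp

lemma integral_expPoly_mul_expPoly (p q : ℝ[X]) :
    ∫ x in Ioi (0 : ℝ), expPoly lam α p x * expPoly lam α q x = gammaInt (2 * lam) α (p * q) :=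
  setIntegral_congr_fun measurableSet_Ioi fun _ hx => expPoly_mul_expPoly p q hx

/-- The integral of a function against `x ^ (α / 2) e^{-lam x} p(x)`. -/
noncomputable def polyCoeff (lam α : ℝ) (U : ℝ → ℂ) (p : ℝ[X]) : ℂ :=
  ∫ x in Ioi (0 : ℝ), expPoly lam α p x • U x

lemma polyCoeff_eq_sum {U : ℝ → ℂ} (hlam : 0 < lam) (hα : -1 < α)
    (hU : MemLp U 2 (volume.restrict (Ioi 0))) {p : ℝ[X]} {n : ℕ} (hp : p.natDegree ≤ n) :
    polyCoeff lam α U p =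
      ∑ j ∈ Finset.range (n + 1), ((p.coeff j : ℝ) : ℂ) * polyCoeff lam α U (X ^ j) := by
  simp only [polyCoeff, ← integral_const_mul]
  rw [← integral_finsetSum _ fun j _ => (integrable_expPoly_smul hlam hα (X ^ j) hU).const_mul _]
  refine integral_congr_ae (ae_of_all _ fun x => ?_)
  simp only [expPoly, eval_eq_sum_range' (Nat.lt_succ_of_le hp), Complex.real_smul, eval_pow, eval_X,
    Finset.mul_sum, Complex.ofReal_sum, Finset.sum_mul]
  refine Finset.sum_congr rfl fun j _ => ?_
  push_cast
  ring

/-- If the first Laguerre coefficients vanish, then so do the first moments. -/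
lemma polyCoeff_X_pow_eq_zero {U : ℝ → ℂ} (hlam : 0 < lam) (hα : -1 < α)
    (hU : MemLp U 2 (volume.restrict (Ioi 0))) {N : ℕ}
    (h : ∀ n ≤ N, polyCoeff lam α U (lag (2 * lam) n α) = 0) :
    ∀ j ≤ N, polyCoeff lam α U (X ^ j) = 0 := by
  refine eq_zero_of_lag_sum_eq_zero (b := 2 * lam) (by positivity) α _ N fun n hn => ?_
  rw [← polyCoeff_eq_sum hlam hα hU (natDegree_lag_le _ n α), h n hn]

/-- Completeness of the Laguerre functions. -/
lemma ae_eq_zero_of_polyCoeff_lag_eq_zero {U : ℝ → ℂ} (hlam : 0 < lam) (hα : -1 < α)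
    (hU : MemLp U 2 (volume.restrict (Ioi 0)))
    (h : ∀ n, polyCoeff lam α U (lag (2 * lam) n α) = 0) :
    ∀ᵐ x ∂(volume.restrict (Ioi (0 : ℝ))), U x = 0 := by
  have h1 : ∀ n, polyCoeff lam α U (X ^ n) = 0 := fun n =>
    polyCoeff_X_pow_eq_zero hlam hα hU (fun k _ => h k) n le_rfl
  -- Half of the decay e^{-lam x} is given to the tilt; the remaining e^{-lam x / 2} keeps all
  -- moments integrable.
  have h2 := ae_eq_zero_of_moments_eq_zero (G := fun x => (x ^ (α / 2) * Real.exp (-lam * x)) • U x)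
    (δ := lam / 2) (by positivity) ?_ ?_
  · filter_upwards [h2, ae_restrict_mem measurableSet_Ioi] with x hx hx0
    have hx0 : 0 < x := hx0
    have : x ^ (α / 2) * Real.exp (-lam * x) ≠ 0 := by positivity
    exact (smul_eq_zero.1 hx).resolve_left this
  · intro n
    refine IntegrableOn.congr_fun (integrable_expPoly_smul (lam := lam / 2) (by positivity) hα (X ^ n) hU)
      (fun x hx => ?_) measurableSet_Ioi
    have h3 : Real.exp (-(lam / 2) * x) = Real.exp (lam / 2 * x) * Real.exp (-lam * x) := by
      rw [← Real.exp_add]; ring_nf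
    simp only [expPoly, smul_smul, eval_pow, eval_X, h3]
    congr 1; ring
  · intro n
    rw [← h1 n]
    refine setIntegral_congr_fun measurableSet_Ioi fun x hx => ?_
    simp only [expPoly, smul_smul, eval_pow, eval_X]
    congr 1; ring

/-- Parseval's identity for the Laguerre functions. -/
theorem hasSum_sq_polyCoeff_lag {U : ℝ → ℂ} (hlam : 0 < lam) (hα : -1 < α)
    (hU : MemLp U 2 (volume.restrict (Ioi 0))) :
    HasSum (fun n => ‖polyCoeff lam α U (lag (2 * lam) n α)‖ ^ 2 / lagNormSq (2 * lam) n α)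
      ((eLpNorm U 2 (volume.restrict (Ioi 0))).toReal ^ 2) := by
  have hb : 0 < 2 * lam := by positivity
  set μ : Measure ℝ := volume.restrict (Ioi 0)
  set r : ℕ → ℝ := fun n => (Real.sqrt (lagNormSq (2 * lam) n α))⁻¹ with hr
  have hrsq : ∀ n, r n * r n * lagNormSq (2 * lam) n α = 1 := fun n => by
    have hpos := lagNormSq_pos hb hα n
    have := Real.mul_self_sqrt hpos.le
    have h0 : Real.sqrt (lagNormSq (2 * lam) n α) ≠ 0 := (Real.sqrt_pos.2 hpos).ne'
    simp only [hr]
    field_simp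
    rw [sq, this]
  have hmem : ∀ n, MemLp (fun x => ((r n * expPoly lam α (lag (2 * lam) n α) x : ℝ) : ℂ)) 2 μ :=
    fun n => MemLp.ofReal ((memLp_expPoly hlam hα _).const_mul (r n))
  let e : ℕ → Lp ℂ 2 μ := fun n => (hmem n).toLp
  have hinner : ∀ (f : Lp ℂ 2 μ) n, inner ℂ (e n) f =
      (r n : ℂ) * polyCoeff lam α f (lag (2 * lam) n α) := by
    intro f n
    rw [L2.inner_def, polyCoeff, ← integral_const_mul]
    refine integral_congr_ae ?_
    filter_upwards [(hmem n).coeFn_toLp] with x hx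
    rw [hx, RCLike.inner_apply, Complex.conj_ofReal, Complex.real_smul]
    push_cast
    ring
  have hcongr : ∀ (f : Lp ℂ 2 μ) (g : ℝ → ℂ) p, f =ᵐ[μ] g →
      polyCoeff lam α f p = polyCoeff lam α g p := by
    intro f g p h
    refine integral_congr_ae ?_
    filter_upwards [h] with x hx
    rw [hx]
  have horth : Orthonormal ℂ e := by
    rw [orthonormal_iff_ite]
    intro i j
    rw [hinner, hcongr _ _ _ (hmem j).coeFn_toLp, polyCoeff]
    have h1 : ∫ x in Ioi (0 : ℝ), expPoly lam α (lag (2 * lam) i α) x •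
        ((r j * expPoly lam α (lag (2 * lam) j α) x : ℝ) : ℂ) =
        ((r j * gammaInt (2 * lam) α (lag (2 * lam) i α * lag (2 * lam) j α) : ℝ) : ℂ) := by
      rw [← integral_expPoly_mul_expPoly, ← integral_const_mul, ← integral_complex_ofReal]
      refine integral_congr_ae (ae_of_all _ fun x => ?_)
      simp only [Complex.real_smul]
      push_cast
      ring
    rw [h1]
    split_ifs with hij
    · subst hij
      rw [gammaInt_lag_mul_self hb i hα, ← Complex.ofReal_mul, ← mul_assoc, hrsq]
      simp
    · rw [gammaInt_lag_mul_lag_of_ne hb hα hij]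
      simp
  have hbot : (Submodule.span ℂ (Set.range e))ᗮ = ⊥ := by
    rw [Submodule.eq_bot_iff]
    intro f hf
    have h1 : ∀ n, polyCoeff lam α f (lag (2 * lam) n α) = 0 := by
      intro n
      have h2 := (Submodule.mem_orthogonal _ _).1 hf (e n) (Submodule.subset_span ⟨n, rfl⟩)
      rw [hinner, mul_eq_zero] at h2
      refine h2.resolve_left ?_
      have := hrsq n
      intro h3
      have h4 : r n = 0 := by exact_mod_cast h3
      rw [h4] at this
      simp at this
    have h3 := ae_eq_zero_of_polyCoeff_lag_eq_zero hlam hα (Lp.memLp f) h1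
    exact (Lp.eq_zero_iff_ae_eq_zero).2 h3
  let B := HilbertBasis.mkOfOrthogonalEqBot horth hbot
  have hB : ∀ n, B n = e n := fun n => by
    rw [HilbertBasis.coe_mkOfOrthogonalEqBot]
  have hs := B.hasSum_inner_mul_inner hU.toLp hU.toLp
  rw [inner_self_eq_norm_sq_to_K, Lp.norm_toLp] at hs
  rw [← Complex.hasSum_ofReal]
  push_cast
  refine hs.congr_fun fun n => ?_
  rw [hB, ← inner_conj_symm, hinner, hcongr _ _ _ hU.coeFn_toLp, ← Complex.normSq_eq_conj_mul_self,
    Complex.normSq_eq_norm_sq, norm_mul, mul_pow, Complex.norm_real, Real.norm_eq_abs, sq_abs]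
  push_cast
  have h5 : ((lagNormSq (2 * lam) n α : ℝ) : ℂ) ≠ 0 := by
    exact_mod_cast (lagNormSq_pos hb hα n).ne'
  have h6 : ((r n : ℝ) : ℂ) ^ 2 * ((lagNormSq (2 * lam) n α : ℝ) : ℂ) = 1 := by
    have := hrsq n
    rw [← sq] at this
    exact_mod_cast this
  rw [div_eq_iff h5, mul_right_comm, h6, one_mul]

end Parseval

end TemperedLaguerre

/-! ### Weak derivatives, cutoffs and integration by parts at the origin. -/

namespace TemperedLaguerre

section WeakDeriv

lemma integrableOn_Ioi_smul_of_test {φ : ℝ → ℝ} {f : ℝ → ℂ} (hφ : Continuous φ)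
    (hc : HasCompactSupport φ) (hs : tsupport φ ⊆ Ioi 0) (hf : LocallyIntegrableOn f (Ioi 0)) :
    IntegrableOn (fun x => φ x • f x) (Ioi 0) := by
  have h1 : IntegrableOn f (tsupport φ) := hf.integrableOn_compact_subset hs hc.isCompact
  have h2 : IntegrableOn (fun x => φ x • f x) (tsupport φ) := by
    obtain ⟨C, hC⟩ := hc.exists_bound_of_continuous hφ
    exact Integrable.bdd_smul (φ := φ) h1 C hφ.aestronglyMeasurable (ae_of_all _ hC)
  refine Integrable.integrableOn ((integrableOn_iff_integrable_of_support_subset fun x hx => ?_).1 h2)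
  exact subset_tsupport φ (left_ne_zero_of_smul hx)

lemma tsupport_iteratedDeriv_subset (φ : ℝ → ℝ) (n : ℕ) :
    tsupport (iteratedDeriv n φ) ⊆ tsupport φ := by
  induction n with
  | zero => simp
  | succ n ih =>
    rw [iteratedDeriv_succ]
    exact (closure_minimal (support_deriv_subset) (isClosed_tsupport _)).trans ih

lemma hasCompactSupport_iteratedDeriv {φ : ℝ → ℝ} (h : HasCompactSupport φ) (n : ℕ) :
    HasCompactSupport (iteratedDeriv n φ) :=
  HasCompactSupport.of_support_subset_isCompact h.isCompact
    ((subset_tsupport _).trans (tsupport_iteratedDeriv_subset φ n))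

lemma contDiff_iteratedDeriv {φ : ℝ → ℝ} (h : ContDiff ℝ ∞ φ) (n : ℕ) :
    ContDiff ℝ ∞ (iteratedDeriv n φ) := by
  induction n with
  | zero => simpa using h
  | succ n ih => rw [iteratedDeriv_succ]; exact (contDiff_infty_iff_deriv.1 ih).2

variable {f g f₁ g₁ f₂ g₂ : ℝ → ℂ} {k : ℕ}

lemma locallyIntegrableOn_Ioi_congr (h : LocallyIntegrableOn f (Ioi 0))
    (hf : ∀ᵐ x ∂(volume.restrict (Ioi (0 : ℝ))), f x = f₁ x) : LocallyIntegrableOn f₁ (Ioi 0) := by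
  intro x hx
  obtain ⟨t, ht, hi⟩ := h x hx
  refine ⟨t ∩ Ioi 0, inter_mem ht self_mem_nhdsWithin, ?_⟩
  exact (hi.mono_set inter_subset_left).congr_fun_ae (ae_restrict_of_ae_restrict_of_subset inter_subset_right hf)

lemma HasWeakDeriv.congr (h : HasWeakDeriv k f g)
    (hf : ∀ᵐ x ∂(volume.restrict (Ioi (0 : ℝ))), f x = f₁ x)
    (hg : ∀ᵐ x ∂(volume.restrict (Ioi (0 : ℝ))), g x = g₁ x) : HasWeakDeriv k f₁ g₁ := by
  obtain ⟨h1, h2, h3⟩ := h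
  refine ⟨?_, ?_, fun φ hφ hc hs => ?_⟩
  · exact locallyIntegrableOn_Ioi_congr h1 hf
  · exact locallyIntegrableOn_Ioi_congr h2 hg
  · have e1 : ∫ x in Ioi (0 : ℝ), iteratedDeriv k φ x • f x =
        ∫ x in Ioi (0 : ℝ), iteratedDeriv k φ x • f₁ x :=
      integral_congr_ae (by filter_upwards [hf] with x hx; rw [hx])
    have e2 : ∫ x in Ioi (0 : ℝ), φ x • g x = ∫ x in Ioi (0 : ℝ), φ x • g₁ x :=
      integral_congr_ae (by filter_upwards [hg] with x hx; rw [hx])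
    rw [← e1, ← e2, h3 φ hφ hc hs]

lemma HasWeakDeriv.sub (h₁ : HasWeakDeriv k f₁ g₁) (h₂ : HasWeakDeriv k f₂ g₂) :
    HasWeakDeriv k (fun x => f₁ x - f₂ x) (fun x => g₁ x - g₂ x) := by
  refine ⟨h₁.1.sub h₂.1, h₁.2.1.sub h₂.2.1, fun φ hφ hc hs => ?_⟩
  have hk := (contDiff_iteratedDeriv hφ k).continuous
  have hkc := hasCompactSupport_iteratedDeriv hc k
  have hks := (tsupport_iteratedDeriv_subset φ k).trans hs
  simp only [smul_sub]
  rw [integral_sub (integrableOn_Ioi_smul_of_test hk hkc hks h₁.1)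
      (integrableOn_Ioi_smul_of_test hk hkc hks h₂.1),
    integral_sub (integrableOn_Ioi_smul_of_test hφ.continuous hc hs h₁.2.1)
      (integrableOn_Ioi_smul_of_test hφ.continuous hc hs h₂.2.1), h₁.2.2 φ hφ hc hs,
    h₂.2.2 φ hφ hc hs, mul_sub]

lemma HasWeakDeriv.ae_eq (h₁ : HasWeakDeriv k f g₁) (h₂ : HasWeakDeriv k f g₂) :
    ∀ᵐ x ∂(volume.restrict (Ioi (0 : ℝ))), g₁ x = g₂ x := by
  have key := isOpen_Ioi.ae_eq_zero_of_integral_contDiff_smul_eq_zero (μ := volume)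
    (U := Ioi (0 : ℝ)) (f := fun x => g₁ x - g₂ x) (h₁.2.1.sub h₂.2.1) ?_
  · rw [ae_restrict_iff' measurableSet_Ioi]
    filter_upwards [key] with x hx hx0
    exact sub_eq_zero.1 (hx hx0)
  · intro φ hφ hc hs
    have h3 := (h₁.2.2 φ hφ hc hs).symm.trans (h₂.2.2 φ hφ hc hs)
    have h4 := mul_left_cancel₀ (by simp : ((-1 : ℂ) ^ k) ≠ 0) h3
    rw [← setIntegral_eq_integral_of_forall_compl_eq_zero (s := Ioi 0)]
    · simp only [smul_sub]
      rw [integral_sub (integrableOn_Ioi_smul_of_test hφ.continuous hc hs h₁.2.1)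
        (integrableOn_Ioi_smul_of_test hφ.continuous hc hs h₂.2.1), h4, sub_self]
    · intro x hx
      have : φ x = 0 := by
        by_contra h
        exact hx (hs (subset_tsupport φ h))
      rw [this, zero_smul]

/-- Inserting φ' into the relation of order k and comparing with the relation of order k + 1 for φ
identifies consecutive weak derivatives. -/
lemma HasWeakDeriv.of_succ (h₁ : HasWeakDeriv k f g₁) (h₂ : HasWeakDeriv (k + 1) f g₂) :
    HasWeakDeriv 1 g₁ g₂ := by
  refine ⟨h₁.2.1, h₂.2.1, fun φ hφ hc hs => ?_⟩
  have h3 := h₁.2.2 (deriv φ) (contDiff_infty_iff_deriv.1 hφ).2 hc.deriv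
    ((closure_minimal support_deriv_subset (isClosed_tsupport _)).trans hs)
  have h4 := h₂.2.2 φ hφ hc hs
  rw [iteratedDeriv_succ', h3, pow_succ, mul_assoc] at h4
  rw [iteratedDeriv_one, mul_left_cancel₀ (by simp : ((-1 : ℂ) ^ k) ≠ 0) h4, pow_one]

end WeakDeriv

section Cutoff

/-- A smooth cutoff function, equal to `1` on `[2 ε, 1 / ε]` and supported in `[ε, 2 / ε]`. -/
noncomputable def cutoff (ε x : ℝ) : ℝ :=
  Real.smoothTransition (x / ε - 1) * (1 - Real.smoothTransition (ε * x - 1))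

variable {ε : ℝ}

lemma contDiff_cutoff (ε : ℝ) : ContDiff ℝ ∞ (cutoff ε) := by
  have h : ContDiff ℝ ∞ Real.smoothTransition := Real.smoothTransition.contDiff
  unfold cutoff
  exact (h.comp (by fun_prop)).mul (contDiff_const.sub (h.comp (by fun_prop)))

lemma cutoff_nonneg (ε x : ℝ) : 0 ≤ cutoff ε x :=
  mul_nonneg (Real.smoothTransition.nonneg _) (sub_nonneg.2 (Real.smoothTransition.le_one _))

lemma cutoff_le_one (ε x : ℝ) : cutoff ε x ≤ 1 :=
  mul_le_one₀ (Real.smoothTransition.le_one _) (sub_nonneg.2 (Real.smoothTransition.le_one _))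
    (sub_le_self _ (Real.smoothTransition.nonneg _))

lemma tsupport_cutoff_subset (hε : 0 < ε) : tsupport (cutoff ε) ⊆ Icc ε (2 / ε) := by
  refine closure_minimal (fun x hx => ?_) isClosed_Icc
  by_contra h
  refine hx ?_
  rw [mem_Icc, not_and_or, not_le, not_le] at h
  rcases h with h | h
  · rw [cutoff, Real.smoothTransition.zero_of_nonpos, zero_mul]
    rw [sub_nonpos, div_le_one hε]; exact h.le
  · rw [cutoff, Real.smoothTransition.one_of_one_le (x := ε * x - 1), sub_self, mul_zero]
    rw [div_lt_iff₀' hε] at h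
    linarith

lemma hasCompactSupport_cutoff (hε : 0 < ε) : HasCompactSupport (cutoff ε) :=
  HasCompactSupport.of_support_subset_isCompact isCompact_Icc
    ((subset_tsupport _).trans (tsupport_cutoff_subset hε))

lemma tendsto_cutoff {x : ℝ} (hx : 0 < x) : Tendsto (fun ε => cutoff ε x) (𝓝[>] 0) (𝓝 1) := by
  refine Tendsto.congr' ?_ tendsto_const_nhds
  have h1 : ∀ᶠ ε in 𝓝[>] (0 : ℝ), ε < x / 2 := mem_nhdsWithin_of_mem_nhds (Iio_mem_nhds (by positivity))
  have h2 : ∀ᶠ ε in 𝓝[>] (0 : ℝ), ε < 1 / x := mem_nhdsWithin_of_mem_nhds (Iio_mem_nhds (by positivity))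
  filter_upwards [h1, h2, self_mem_nhdsWithin] with ε h1 h2 h3
  have h3 : 0 < ε := h3
  rw [lt_div_iff₀ hx] at h2
  rw [cutoff, Real.smoothTransition.one_of_one_le, Real.smoothTransition.zero_of_nonpos (by linarith)]
  · norm_num
  · rw [le_sub_iff_add_le, le_div_iff₀ h3]; linarith

lemma exists_bound_deriv_smoothTransition : ∃ C : ℝ, 0 ≤ C ∧
    (∀ x, |deriv Real.smoothTransition x| ≤ C) ∧ ∀ x, 1 < x → deriv Real.smoothTransition x = 0 := by
  have h : ContDiff ℝ ∞ Real.smoothTransition := Real.smoothTransition.contDiff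
  have hc : Continuous (deriv Real.smoothTransition) := (contDiff_infty_iff_deriv.1 h).2.continuous
  obtain ⟨C, hC⟩ := (isCompact_Icc (a := (0 : ℝ)) (b := 1)).exists_bound_of_continuousOn hc.continuousOn
  have h1 : ∀ x, 1 < x → deriv Real.smoothTransition x = 0 := fun x hx => by
    have : Real.smoothTransition =ᶠ[𝓝 x] fun _ => 1 := by
      filter_upwards [Ioi_mem_nhds hx] with y hy
      exact Real.smoothTransition.one_of_one_le (le_of_lt hy)
    rw [this.deriv_eq, deriv_const]
  have h0 : ∀ x < 0, deriv Real.smoothTransition x = 0 := fun x hx => by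
    have : Real.smoothTransition =ᶠ[𝓝 x] fun _ => 0 := by
      filter_upwards [Iio_mem_nhds hx] with y hy
      exact Real.smoothTransition.zero_of_nonpos (le_of_lt hy)
    rw [this.deriv_eq, deriv_const]
  have hC0 : 0 ≤ C := (norm_nonneg _).trans (hC 0 (by simp))
  refine ⟨C, hC0, fun x => ?_, h1⟩
  rcases lt_or_ge x 0 with hx | hx
  · simpa [h0 x hx] using hC0
  rcases lt_or_ge 1 x with hx' | hx'
  · simpa [h1 x hx'] using hC0
  · exact hC x ⟨hx, hx'⟩

/-- The inner transition has slope of order 1/ε but only acts up to 2ε, while the outer one has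
slope of order ε. The first matches averages over (0, 2ε), the second is harmless against an
integrable function. -/
lemma exists_bound_deriv_cutoff : ∃ C : ℝ, 0 ≤ C ∧ ∀ ε > 0, ∀ x > 0,
    |deriv (cutoff ε) x| ≤ C * ε + (Ioc 0 (2 * ε)).indicator (fun _ => C * ε⁻¹) x := by
  obtain ⟨C, hC0, hC, hC1⟩ := exists_bound_deriv_smoothTransition
  refine ⟨C, hC0, fun ε hε x hx => ?_⟩
  have h : ContDiff ℝ ∞ Real.smoothTransition := Real.smoothTransition.contDiff
  have hd : ∀ y, HasDerivAt Real.smoothTransition (deriv Real.smoothTransition y) y := fun y =>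
    (h.differentiable (by simp)).differentiableAt.hasDerivAt
  have e1 : HasDerivAt (fun x => Real.smoothTransition (x / ε - 1))
      (deriv Real.smoothTransition (x / ε - 1) * (1 / ε)) x :=
    (hd _).comp x (((hasDerivAt_id x).div_const ε).sub_const 1)
  have e2 : HasDerivAt (fun x => Real.smoothTransition (ε * x - 1))
      (deriv Real.smoothTransition (ε * x - 1) * (ε * 1)) x :=
    (hd _).comp x (((hasDerivAt_id x).const_mul ε).sub_const 1)
  have e3 := (e1.mul (e2.const_sub 1)).deriv
  have e4 : deriv (cutoff ε) x = _ := e3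
  rw [e4, add_comm]
  have b1 : |1 - Real.smoothTransition (ε * x - 1)| ≤ 1 := by
    rw [abs_of_nonneg (sub_nonneg.2 (Real.smoothTransition.le_one _))]
    exact sub_le_self _ (Real.smoothTransition.nonneg _)
  have b2 : |Real.smoothTransition (x / ε - 1)| ≤ 1 := by
    rw [abs_of_nonneg (Real.smoothTransition.nonneg _)]
    exact Real.smoothTransition.le_one _
  refine (abs_add_le _ _).trans (add_le_add ?_ ?_)
  · rw [abs_mul, abs_neg, abs_mul, mul_one, abs_of_pos hε]
    calc _ ≤ 1 * (C * ε) := by gcongr; exact hC _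
      _ = _ := one_mul _
  · rw [abs_mul, abs_mul, one_div, abs_of_pos (inv_pos.2 hε)]
    by_cases hx2 : x ≤ 2 * ε
    · rw [indicator_of_mem (show x ∈ Ioc 0 (2 * ε) from ⟨hx, hx2⟩)]
      calc _ ≤ C * ε⁻¹ * 1 := by gcongr; exact hC _
        _ = _ := mul_one _
    · rw [indicator_of_notMem (fun h => hx2 h.2), hC1]
      · simp
      · rw [lt_sub_iff_add_lt, lt_div_iff₀ hε]; linarith

end Cutoff

/-- Integration by parts for a weak derivative on the half line, without boundary terms. -/
theorem HasWeakDeriv.integral_deriv_smul {w w' : ℝ → ℂ} (h : HasWeakDeriv 1 w w') {E : ℝ → ℝ}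
    (hE : ContDiff ℝ ∞ E) (h1 : IntegrableOn (fun x => E x • w x) (Ioi 0))
    (h2 : IntegrableOn (fun x => deriv E x • w x) (Ioi 0))
    (h3 : IntegrableOn (fun x => E x • w' x) (Ioi 0))
    (hlim : Tendsto (fun ε => ε⁻¹ * ∫ x in Ioc 0 ε, ‖E x • w x‖) (𝓝[>] 0) (𝓝 0)) :
    ∫ x in Ioi (0 : ℝ), deriv E x • w x = - ∫ x in Ioi (0 : ℝ), E x • w' x := by
  have hlimit : ∀ v : ℝ → ℂ, IntegrableOn v (Ioi 0) →
      Tendsto (fun ε => ∫ x in Ioi (0 : ℝ), cutoff ε x • v x) (𝓝[>] 0) (𝓝 (∫ x in Ioi (0 : ℝ), v x)) := by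
    intro v hv
    refine tendsto_integral_filter_of_dominated_convergence (fun x => ‖v x‖) ?_ ?_ hv.norm ?_
    · exact Eventually.of_forall fun ε =>
        (contDiff_cutoff ε).continuous.aestronglyMeasurable.smul hv.aestronglyMeasurable
    · refine Eventually.of_forall fun ε => ae_of_all _ fun x => ?_
      rw [norm_smul, Real.norm_of_nonneg (cutoff_nonneg ε x)]
      exact mul_le_of_le_one_left (norm_nonneg _) (cutoff_le_one ε x)
    · filter_upwards [ae_restrict_mem measurableSet_Ioi] with x hx
      simpa using (tendsto_cutoff hx).smul_const (v x)
  obtain ⟨C, hC0, hC⟩ := exists_bound_deriv_cutoff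
  have hdc : ∀ ε, Continuous (deriv (cutoff ε)) := fun ε =>
    (contDiff_infty_iff_deriv.1 (contDiff_cutoff ε)).2.continuous
  have hpt : ∀ ε > 0, ∀ᵐ x ∂(volume.restrict (Ioi (0 : ℝ))), ‖deriv (cutoff ε) x • (E x • w x)‖ ≤
      C * ε * ‖E x • w x‖ + (Ioc 0 (2 * ε)).indicator (fun x => C * ε⁻¹ * ‖E x • w x‖) x := by
    intro ε hε
    filter_upwards [ae_restrict_mem measurableSet_Ioi] with x hx
    rw [norm_smul (deriv (cutoff ε) x), Real.norm_eq_abs]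
    refine (mul_le_mul_of_nonneg_right (hC ε hε x hx) (norm_nonneg _)).trans (le_of_eq ?_)
    rw [add_mul]
    congr 1
    by_cases hm : x ∈ Ioc 0 (2 * ε)
    · rw [indicator_of_mem hm, indicator_of_mem hm]
    · rw [indicator_of_notMem hm, indicator_of_notMem hm, zero_mul]
  have hbint : ∀ ε > 0, IntegrableOn (fun x => C * ε * ‖E x • w x‖ +
      (Ioc 0 (2 * ε)).indicator (fun x => C * ε⁻¹ * ‖E x • w x‖) x) (Ioi 0) := by
    intro ε _
    exact Integrable.add (h1.norm.const_mul _)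
      (Integrable.indicator (h1.norm.const_mul _) measurableSet_Ioc)
  -- This is the only place where the boundary enters: the term with the derivative of the cutoff is
  -- bounded by ε times an L¹ norm plus an average over (0, 2ε).
  have hmid : Tendsto (fun ε => ∫ x in Ioi (0 : ℝ), deriv (cutoff ε) x • (E x • w x)) (𝓝[>] 0) (𝓝 0) := by
    have hb : Tendsto (fun ε => C * ε * (∫ x in Ioi (0 : ℝ), ‖E x • w x‖) +
        2 * C * ((2 * ε)⁻¹ * ∫ x in Ioc 0 (2 * ε), ‖E x • w x‖)) (𝓝[>] 0) (𝓝 0) := by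
      have t1 : Tendsto (fun ε : ℝ => C * ε * (∫ x in Ioi (0 : ℝ), ‖E x • w x‖)) (𝓝[>] 0) (𝓝 0) := by
        have : Continuous (fun ε : ℝ => C * ε * (∫ x in Ioi (0 : ℝ), ‖E x • w x‖)) := by fun_prop
        have := this.tendsto 0
        simp only [mul_zero, zero_mul] at this
        exact this.mono_left nhdsWithin_le_nhds
      have t2 : Tendsto (fun ε : ℝ => 2 * ε) (𝓝[>] 0) (𝓝[>] 0) := by
        refine tendsto_nhdsWithin_iff.2 ⟨?_, ?_⟩
        · have : Continuous (fun ε : ℝ => 2 * ε) := by fun_prop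
          have := this.tendsto 0
          simp only [mul_zero] at this
          exact this.mono_left nhdsWithin_le_nhds
        · filter_upwards [self_mem_nhdsWithin] with ε hε
          have hε : 0 < ε := hε
          exact mul_pos two_pos hε
      simpa using t1.add ((hlim.comp t2).const_mul (2 * C))
    refine squeeze_zero_norm' ?_ hb
    filter_upwards [self_mem_nhdsWithin] with ε hε
    have hε : 0 < ε := hε
    refine (norm_integral_le_of_norm_le (hbint ε hε) (hpt ε hε)).trans (le_of_eq ?_)
    rw [integral_add (h1.norm.const_mul _)
      (Integrable.indicator (h1.norm.const_mul _) measurableSet_Ioc), integral_const_mul,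
      integral_indicator measurableSet_Ioc, integral_const_mul,
      Measure.restrict_restrict measurableSet_Ioc, inter_eq_left.2 Ioc_subset_Ioi_self]
    field_simp
  have heq : ∀ᶠ ε in 𝓝[>] (0 : ℝ), (∫ x in Ioi (0 : ℝ), cutoff ε x • (deriv E x • w x)) +
      ∫ x in Ioi (0 : ℝ), deriv (cutoff ε) x • (E x • w x) =
      - ∫ x in Ioi (0 : ℝ), cutoff ε x • (E x • w' x) := by
    filter_upwards [self_mem_nhdsWithin] with ε hε
    have hε : 0 < ε := hε
    have hs : tsupport (fun x => cutoff ε x * E x) ⊆ Ioi 0 :=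
      (tsupport_mul_subset_left).trans ((tsupport_cutoff_subset hε).trans
        fun x hx => hε.trans_le hx.1)
    have h4 := h.2.2 (fun x => cutoff ε x * E x) ((contDiff_cutoff ε).mul hE)
      (hasCompactSupport_cutoff hε).mul_right hs
    simp only [iteratedDeriv_one, pow_one, neg_one_mul] at h4
    simp only [smul_smul]
    rw [← h4]
    have i1 : IntegrableOn (fun x => cutoff ε x • (deriv E x • w x)) (Ioi 0) := by
      refine Integrable.bdd_smul (φ := cutoff ε) h2 1 (contDiff_cutoff ε).continuous.aestronglyMeasurable
        (ae_of_all _ fun x => ?_)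
      rw [Real.norm_of_nonneg (cutoff_nonneg ε x)]
      exact cutoff_le_one ε x
    have i2 : IntegrableOn (fun x => deriv (cutoff ε) x • (E x • w x)) (Ioi 0) :=
      Integrable.mono' (hbint ε hε)
        ((hdc ε).aestronglyMeasurable.smul h1.aestronglyMeasurable) (hpt ε hε)
    simp only [smul_smul] at i1 i2
    rw [← integral_add i1 i2]
    refine integral_congr_ae (ae_of_all _ fun x => ?_)
    have d1 : deriv (fun x => cutoff ε x * E x) x = deriv (cutoff ε) x * E x + cutoff ε x * deriv E x :=
      deriv_fun_mul ((contDiff_cutoff ε).differentiable (by simp)).differentiableAt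
        (hE.differentiable (by simp)).differentiableAt
    simp only [d1, add_smul]
    rw [add_comm]
  have hl := (hlimit _ h2).add hmid
  rw [add_zero] at hl
  exact tendsto_nhds_unique (hl.congr' heq) (hlimit _ h3).neg

end TemperedLaguerre

/-! ### Repeated integration by parts against functions not vanishing at 0, with exponential decay
at infinity. -/

namespace TemperedLaguerre

lemma integrableOn_Ioi_smul_of_hasCompactSupport {Ψ : ℝ → ℝ} {g : ℝ → ℂ} (hΨ : Continuous Ψ)
    (hc : HasCompactSupport Ψ) (hg : ∀ R : ℝ, IntegrableOn g (Ioc 0 R)) :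
    IntegrableOn (fun x => Ψ x • g x) (Ioi 0) := by
  obtain ⟨R, hR⟩ := hc.isCompact.bddAbove
  obtain ⟨C, hC⟩ := hc.exists_bound_of_continuous hΨ
  have h1 : IntegrableOn (fun x => Ψ x • g x) (Ioc 0 R) :=
    Integrable.bdd_smul (φ := Ψ) (hg R) C hΨ.aestronglyMeasurable (ae_of_all _ hC)
  have h2 : IntegrableOn (fun x => Ψ x • g x) (Ioi R) := by
    refine IntegrableOn.congr_fun integrableOn_zero (fun x hx => ?_) measurableSet_Ioi
    have : Ψ x = 0 := by
      by_contra h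
      exact absurd (hR (subset_tsupport Ψ h)) (not_le.2 hx)
    simp [this]
  refine (h1.union h2).mono_set fun x hx => ?_
  rcases le_or_gt x R with h | h
  · exact Or.inl ⟨hx, h⟩
  · exact Or.inr h

lemma tendsto_average_smul {Ψ : ℝ → ℝ} {g : ℝ → ℂ} (hΨ : Continuous Ψ)
    (hg : ∀ R : ℝ, IntegrableOn g (Ioc 0 R))
    (hlim : Tendsto (fun ε => ε⁻¹ * ∫ x in Ioc 0 ε, ‖g x‖) (𝓝[>] 0) (𝓝 0)) :
    Tendsto (fun ε => ε⁻¹ * ∫ x in Ioc 0 ε, ‖Ψ x • g x‖) (𝓝[>] 0) (𝓝 0) := by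
  obtain ⟨C, hC⟩ := (isCompact_Icc (a := (0 : ℝ)) (b := 1)).exists_bound_of_continuousOn
    hΨ.continuousOn
  have h1 : ∀ᶠ ε in 𝓝[>] (0 : ℝ), ε < 1 := mem_nhdsWithin_of_mem_nhds (Iio_mem_nhds one_pos)
  have hb := hlim.const_mul C
  rw [mul_zero] at hb
  refine squeeze_zero_norm' ?_ hb
  filter_upwards [h1, self_mem_nhdsWithin] with ε h1 h0
  have h0 : 0 < ε := h0
  rw [norm_mul, Real.norm_of_nonneg (inv_pos.2 h0).le, mul_left_comm]
  gcongr
  rw [← integral_const_mul]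
  refine norm_integral_le_of_norm_le ((hg ε).norm.const_mul C) ?_
  filter_upwards [ae_restrict_mem measurableSet_Ioc] with x hx
  rw [norm_norm, norm_smul]
  gcongr
  exact hC x ⟨hx.1.le, hx.2.trans h1.le⟩

/-- Repeated integration by parts up to the boundary, if all lower weak derivatives vanish at `0`
in the mean. -/
lemma integral_iteratedDeriv_smul_of_hasCompactSupport {G : ℕ → ℝ → ℂ} {M : ℕ}
    (hG : ∀ j ≤ M, HasWeakDeriv j (G 0) (G j))
    (hint : ∀ j ≤ M, ∀ R : ℝ, IntegrableOn (G j) (Ioc 0 R))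
    (hlim : ∀ j < M, Tendsto (fun ε => ε⁻¹ * ∫ x in Ioc 0 ε, ‖G j x‖) (𝓝[>] 0) (𝓝 0))
    {j : ℕ} (hj : j ≤ M) {Ψ : ℝ → ℝ} (hΨ : ContDiff ℝ ∞ Ψ) (hc : HasCompactSupport Ψ) :
    ∫ x in Ioi (0 : ℝ), iteratedDeriv j Ψ x • G 0 x =
      (-1) ^ j * ∫ x in Ioi (0 : ℝ), Ψ x • G j x := by
  induction j generalizing Ψ with
  | zero => simp
  | succ j ih =>
    have hΨ' : ContDiff ℝ ∞ (deriv Ψ) := (contDiff_infty_iff_deriv.1 hΨ).2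
    have h1 := HasWeakDeriv.of_succ (hG j (by omega)) (hG (j + 1) hj)
    have hi := hint j (by omega)
    rw [iteratedDeriv_succ', ih (by omega) hΨ' hc.deriv,
      h1.integral_deriv_smul hΨ (integrableOn_Ioi_smul_of_hasCompactSupport hΨ.continuous hc hi)
        (integrableOn_Ioi_smul_of_hasCompactSupport hΨ'.continuous hc.deriv hi)
        (integrableOn_Ioi_smul_of_hasCompactSupport hΨ.continuous hc (hint (j + 1) hj))
        (tendsto_average_smul hΨ.continuous hi (hlim j (by omega)))]
    ring

/-- Removal of the compact support in an integration by parts formula. -/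
lemma integral_iteratedDeriv_smul_of_integrable {F f : ℝ → ℂ} {M : ℕ}
    (h : ∀ Ψ : ℝ → ℝ, ContDiff ℝ ∞ Ψ → HasCompactSupport Ψ →
      ∫ x in Ioi (0 : ℝ), iteratedDeriv M Ψ x • F x = (-1) ^ M * ∫ x in Ioi (0 : ℝ), Ψ x • f x)
    (hFm : AEStronglyMeasurable F (volume.restrict (Ioi 0)))
    {E : ℝ → ℝ} (hE : ContDiff ℝ ∞ E)
    (hF : ∀ i ≤ M, IntegrableOn (fun x => iteratedDeriv i E x • F x) (Ioi 0))
    (hf : IntegrableOn (fun x => E x • f x) (Ioi 0)) :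
    ∫ x in Ioi (0 : ℝ), iteratedDeriv M E x • F x =
      (-1) ^ M * ∫ x in Ioi (0 : ℝ), E x • f x := by
  let B : ContDiffBump (0 : ℝ) := ⟨1, 2, one_pos, one_lt_two⟩
  have hB : ContDiff ℝ ∞ B := B.contDiff
  have hbound : ∀ i, ∃ C, ∀ x, ‖iteratedDeriv i B x‖ ≤ C := fun i =>
    (hasCompactSupport_iteratedDeriv B.hasCompactSupport i).exists_bound_of_continuous
      (contDiff_iteratedDeriv hB i).continuous
  choose C hC using hbound
  have hC0 : ∀ i, 0 ≤ C i := fun i => (norm_nonneg _).trans (hC i 0)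
  -- The bump is dilated by 1/c_n. Since c_n ≤ 1, each derivative of the dilated bump is bounded
  -- uniformly in n, so Leibniz' rule supplies a dominating function.
  let c : ℕ → ℝ := fun n => ((n : ℝ) + 1)⁻¹
  have hc0 : ∀ n, 0 < c n := fun n => by positivity
  have hc1 : ∀ n, c n ≤ 1 := fun n => inv_le_one_of_one_le₀ (by
    have : (0 : ℝ) ≤ n := n.cast_nonneg
    linarith)
  have hct : Tendsto c atTop (𝓝 0) := by
    simpa [c, one_div] using tendsto_one_div_add_atTop_nhds_zero_nat (𝕜 := ℝ)
  let χ : ℕ → ℝ → ℝ := fun n x => B (c n * x)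
  have hχ : ∀ n, ContDiff ℝ ∞ (χ n) := fun n => hB.comp (by fun_prop)
  have hχc : ∀ n, HasCompactSupport (χ n) := fun n =>
    B.hasCompactSupport.comp_homeomorph (Homeomorph.mulLeft₀ (c n) (hc0 n).ne')
  have hχ1 : ∀ x, ∀ᶠ n in atTop, χ n =ᶠ[𝓝 x] fun _ => 1 := by
    intro x
    have h1 : Tendsto (fun n => c n * (|x| + 1)) atTop (𝓝 0) := by simpa using hct.mul_const (|x| + 1)
    filter_upwards [h1.eventually (Iio_mem_nhds one_pos)] with n hn
    have hn : c n * (|x| + 1) < 1 := hn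
    filter_upwards [Metric.ball_mem_nhds x one_pos] with y hy
    apply B.one_of_mem_closedBall
    rw [mem_closedBall_zero_iff, norm_mul, Real.norm_of_nonneg (hc0 n).le]
    refine le_trans ?_ hn.le
    have := hc0 n
    gcongr
    rw [Metric.mem_ball, dist_eq_norm] at hy
    have := norm_sub_norm_le y x
    rw [Real.norm_eq_abs x] at this
    linarith
  have hEχ : ∀ n, ContDiff ℝ ∞ (fun x => χ n x * E x) := fun n => (hχ n).mul hE
  have hev : ∀ x, ∀ᶠ n in atTop, (fun x => χ n x * E x) =ᶠ[𝓝 x] E := fun x => by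
    filter_upwards [hχ1 x] with n hn
    filter_upwards [hn] with y hy
    rw [hy, one_mul]
  have t1 : Tendsto (fun n => ∫ x in Ioi (0 : ℝ), iteratedDeriv M (fun x => χ n x * E x) x • F x) atTop
      (𝓝 (∫ x in Ioi (0 : ℝ), iteratedDeriv M E x • F x)) := by
    refine tendsto_integral_of_dominated_convergence
      (fun x => ∑ i ∈ Finset.range (M + 1),
        (M.choose i * C i) * ‖iteratedDeriv (M - i) E x • F x‖) ?_ ?_ ?_ ?_
    · exact fun n => (contDiff_iteratedDeriv (hEχ n) M).continuous.aestronglyMeasurable.smul hFm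
    · exact integrable_finsetSum _ fun i _ => (hF (M - i) (by omega)).norm.const_mul _
    · refine fun n => ae_of_all _ fun x => ?_
      have e1 : iteratedDeriv M (fun x => χ n x * E x) x = _ :=
        iteratedDeriv_mul ((hχ n).contDiffAt.of_le (by exact_mod_cast le_top))
          (hE.contDiffAt.of_le (by exact_mod_cast le_top))
      rw [e1, Finset.sum_smul]
      refine (norm_sum_le _ _).trans (Finset.sum_le_sum fun i _ => ?_)
      rw [mul_smul, norm_smul, norm_mul, Real.norm_natCast]
      gcongr
      have e2 : iteratedDeriv i (χ n) = fun x => c n ^ i * iteratedDeriv i B (c n * x) :=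
        iteratedDeriv_comp_const_mul (hB.of_le (by exact_mod_cast le_top)) (c n)
      rw [e2, norm_mul, norm_pow, Real.norm_of_nonneg (hc0 n).le]
      calc _ ≤ 1 * C i := by
            gcongr
            · exact pow_le_one₀ (hc0 n).le (hc1 n)
            · exact hC i _
        _ = C i := one_mul _
    · refine ae_of_all _ fun x => tendsto_const_nhds.congr' ?_
      filter_upwards [hev x] with n hn
      rw [hn.iteratedDeriv_eq M]
  have t2 : Tendsto (fun n => ∫ x in Ioi (0 : ℝ), (χ n x * E x) • f x) atTop
      (𝓝 (∫ x in Ioi (0 : ℝ), E x • f x)) := by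
    refine tendsto_integral_of_dominated_convergence (fun x => ‖E x • f x‖) ?_ hf.norm ?_ ?_
    · intro n
      simp only [mul_smul]
      exact (hχ n).continuous.aestronglyMeasurable.smul hf.aestronglyMeasurable
    · refine fun n => ae_of_all _ fun x => ?_
      rw [mul_smul, norm_smul, Real.norm_of_nonneg B.nonneg]
      exact mul_le_of_le_one_left (norm_nonneg _) B.le_one
    · refine ae_of_all _ fun x => tendsto_const_nhds.congr' ?_
      filter_upwards [hev x] with n hn
      have := hn.self_of_nhds
      simp only at this
      rw [this]
  have heq : ∀ n, ∫ x in Ioi (0 : ℝ), iteratedDeriv M (fun x => χ n x * E x) x • F x =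
      (-1) ^ M * ∫ x in Ioi (0 : ℝ), (χ n x * E x) • f x := fun n =>
    h _ (hEχ n) (hχc n).mul_right
  refine tendsto_nhds_unique t1 ?_
  simp only [heq]
  exact t2.const_mul _

open Polynomial

section ExpPoly

lemma contDiff_exp_mul_eval (b : ℝ) (p : ℝ[X]) :
    ContDiff ℝ ∞ (fun x : ℝ => Real.exp (-b * x) * p.eval x) :=
  by
  have h : ContDiff ℝ ∞ (fun x : ℝ => p.eval x) := by
    simpa only [Polynomial.coe_aeval_eq_eval] using Polynomial.contDiff_aeval (𝕜 := ℝ) p ∞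
  exact ContDiff.mul (by fun_prop) h

lemma deriv_exp_mul_eval (b : ℝ) (p : ℝ[X]) :
    deriv (fun x : ℝ => Real.exp (-b * x) * p.eval x) =
      fun x => Real.exp (-b * x) * (derivative p - C b * p).eval x := by
  ext x
  have h1 : HasDerivAt (fun x : ℝ => Real.exp (-b * x)) (Real.exp (-b * x) * (-b * 1)) x :=
    ((hasDerivAt_id x).const_mul (-b)).exp
  rw [(h1.fun_mul (p.hasDerivAt x)).deriv]
  simp only [eval_sub, eval_mul, eval_C]
  ring

/-- By `derivative_lag_eq_sub` the two terms in L_n^(a) cancel and one derivative gives -b e^{-bx}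
L_n^(a+1)(bx). Derivatives thus raise the parameter at fixed degree, the counterpart of the lowering
in `gammaInt_lag_comp`. -/
lemma iteratedDeriv_exp_mul_lag (b : ℝ) (n : ℕ) (a : ℝ) (i : ℕ) :
    iteratedDeriv i (fun x : ℝ => Real.exp (-b * x) * (lag b n a).eval x) =
      fun x => (-b) ^ i * (Real.exp (-b * x) * (lag b n (a + i)).eval x) := by
  induction i generalizing a with
  | zero => simp
  | succ i ih =>
    have h : (fun x : ℝ => Real.exp (-b * x) * (derivative (lag b n a) - C b * lag b n a).eval x) =
        fun x => -b * (Real.exp (-b * x) * (lag b n (a + 1)).eval x) := by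
      ext x
      rw [derivative_lag_eq_sub]
      simp only [eval_sub, eval_mul, eval_C]
      ring
    rw [iteratedDeriv_succ', deriv_exp_mul_eval, h]
    ext x
    rw [iteratedDeriv_const_mul_field, ih]
    push_cast
    rw [pow_succ, show a + 1 + (i : ℝ) = a + (i + 1) by ring]
    ring

/-- For a monomial, (δx)^n / n! is a single term of the series of e^{δx}. -/
lemma exists_bound_exp_mul_eval {δ : ℝ} (hδ : 0 < δ) (p : ℝ[X]) :
    ∃ C, ∀ x > 0, |Real.exp (-δ * x) * p.eval x| ≤ C := by
  induction p using Polynomial.induction_on' with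
  | add p q hp hq =>
    obtain ⟨C, hC⟩ := hp
    obtain ⟨D, hD⟩ := hq
    refine ⟨C + D, fun x hx => ?_⟩
    rw [eval_add, mul_add]
    exact (abs_add_le _ _).trans (add_le_add (hC x hx) (hD x hx))
  | monomial n c =>
    refine ⟨|c| * (n.factorial / δ ^ n), fun x hx => ?_⟩
    have h1 := Real.pow_div_factorial_le_exp (δ * x) (by positivity) n
    rw [div_le_iff₀ (by positivity), mul_pow] at h1
    have h2 : Real.exp (-δ * x) * Real.exp (δ * x) = 1 := by rw [← Real.exp_add]; simp
    rw [eval_monomial, mul_left_comm, abs_mul, abs_of_pos (by positivity : 0 < Real.exp (-δ * x) * x ^ n)]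
    gcongr
    rw [le_div_iff₀ (by positivity)]
    calc Real.exp (-δ * x) * x ^ n * δ ^ n = Real.exp (-δ * x) * (δ ^ n * x ^ n) := by ring
      _ ≤ Real.exp (-δ * x) * (Real.exp (δ * x) * n.factorial) := by gcongr
      _ = n.factorial := by rw [← mul_assoc, h2, one_mul]

lemma integrableOn_exp_mul_eval_smul {γ b : ℝ} (hγ : γ < b) {F : ℝ → ℂ} (p : ℝ[X])
    (hF : IntegrableOn (fun x : ℝ => Real.exp (-γ * x) • F x) (Ioi 0)) :
    IntegrableOn (fun x : ℝ => (Real.exp (-b * x) * p.eval x) • F x) (Ioi 0) := by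
  obtain ⟨C, hC⟩ := exists_bound_exp_mul_eval (sub_pos.2 hγ) p
  have h1 := Integrable.bdd_smul (φ := fun x => Real.exp (-(b - γ) * x) * p.eval x) hF C
    (contDiff_exp_mul_eval _ p).continuous.aestronglyMeasurable
    (by filter_upwards [ae_restrict_mem measurableSet_Ioi] with x hx; exact hC x hx)
  refine h1.congr (ae_of_all _ fun x => ?_)
  simp only [Pi.smul_apply', smul_smul]
  rw [mul_right_comm, ← Real.exp_add]
  ring_nf

end ExpPoly

end TemperedLaguerre

/-! ### Riemann-Liouville integrals: convolution form, adjoint and bounds near the origin. -/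

namespace TemperedLaguerre

section RLIntegral

variable {s γ : ℝ} {v : ℝ → ℂ}

/-- The integrand of a tempered fractional integral, as a convolution of functions on the line. -/
noncomputable def rlKernel (s γ : ℝ) (v : ℝ → ℂ) (x y : ℝ) : ℂ :=
  (Ioi (0 : ℝ)).indicator (fun t => t ^ (s - 1) * Real.exp (-γ * t)) (x - y) •
    (Ioi (0 : ℝ)).indicator (fun y => Real.exp (-γ * y) • v y) y

lemma rlKernel_eq (s γ : ℝ) (v : ℝ → ℂ) (x y : ℝ) : rlKernel s γ v x y =
    (Ioo 0 x).indicator (fun y => Real.exp (-γ * x) • ((x - y) ^ (s - 1) • v y)) y := by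
  unfold rlKernel
  by_cases hy : 0 < y
  · by_cases hxy : y < x
    · rw [indicator_of_mem (show x - y ∈ Ioi 0 from sub_pos.2 hxy), indicator_of_mem (show y ∈ Ioi 0 from hy),
        indicator_of_mem (show y ∈ Ioo 0 x from ⟨hy, hxy⟩), smul_smul, smul_smul]
      have : Real.exp (-γ * x) = Real.exp (-γ * (x - y)) * Real.exp (-γ * y) := by
        rw [← Real.exp_add]; ring_nf
      rw [this]
      congr 1; ring
    · rw [indicator_of_notMem (s := Ioi 0) (a := x - y) (fun h => hxy (sub_pos.1 h)), zero_smul,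
        indicator_of_notMem (fun h => hxy h.2)]
  · rw [indicator_of_notMem (s := Ioi 0) (a := y) hy, smul_zero, indicator_of_notMem (fun h => hy h.1)]

lemma integral_rlKernel (hs : 0 < s) (γ : ℝ) (v : ℝ → ℂ) (x : ℝ) :
    ∫ y, rlKernel s γ v x y = Real.Gamma s • (Real.exp (-γ * x) • rlIntegral s v x) := by
  simp only [rlKernel_eq]
  rw [integral_indicator measurableSet_Ioo, integral_smul, rlIntegral, smul_comm (Real.Gamma s),
    smul_smul (Real.Gamma s), mul_inv_cancel₀ (Real.Gamma_pos_of_pos hs).ne', one_smul]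

lemma integrable_rlKernel (hs : 0 < s) (hγ : 0 < γ)
    (hv : IntegrableOn (fun x => Real.exp (-γ * x) • v x) (Ioi 0)) :
    Integrable (fun p : ℝ × ℝ => rlKernel s γ v p.1 p.2) (volume.prod volume) := by
  have h1 : Integrable ((Ioi (0 : ℝ)).indicator fun t : ℝ => t ^ (s - 1) * Real.exp (-γ * t)) volume :=
    (integrableOn_rpow_mul_exp hγ (by linarith)).integrable_indicator measurableSet_Ioi
  have h2 : Integrable ((Ioi (0 : ℝ)).indicator fun y : ℝ => Real.exp (-γ * y) • v y) volume :=
    hv.integrable_indicator measurableSet_Ioi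
  exact h2.convolution_integrand (ContinuousLinearMap.lsmul ℝ ℝ : ℝ →L[ℝ] ℂ →L[ℝ] ℂ).flip h1

lemma integrableOn_exp_smul_rlIntegral (hs : 0 < s) (hγ : 0 < γ)
    (hv : IntegrableOn (fun x => Real.exp (-γ * x) • v x) (Ioi 0)) :
    IntegrableOn (fun x => Real.exp (-γ * x) • rlIntegral s v x) (Ioi 0) := by
  have h := (integrable_rlKernel hs hγ hv).integral_prod_left
  simp only [integral_rlKernel hs] at h
  have h2 := (h.smul (Real.Gamma s)⁻¹).integrableOn (s := Ioi 0)
  refine h2.congr (ae_of_all _ fun x => ?_)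
  simp only [Pi.smul_apply]
  rw [smul_smul, inv_mul_cancel₀ (Real.Gamma_pos_of_pos hs).ne', one_smul]

/-- Convergence of the defining integral is only known for almost every x, through Fubini; this is
what makes the fractional integral additive almost everywhere. -/
lemma ae_integrableOn_rlIntegrand (hs : 0 < s) (hγ : 0 < γ)
    (hv : IntegrableOn (fun x => Real.exp (-γ * x) • v x) (Ioi 0)) :
    ∀ᵐ x, IntegrableOn (fun y => (x - y) ^ (s - 1) • v y) (Ioo 0 x) := by
  filter_upwards [(integrable_rlKernel hs hγ hv).prod_right_ae] with x hx
  simp only [rlKernel_eq] at hx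
  rw [integrable_indicator_iff measurableSet_Ioo] at hx
  have h2 := Integrable.smul (Real.exp (-γ * x))⁻¹ hx
  refine h2.congr (ae_of_all _ fun y => ?_)
  simp only [Pi.smul_apply]
  rw [smul_smul, inv_mul_cancel₀ (Real.exp_pos _).ne', one_smul]

/-- Fubini's theorem for the fractional integral: its adjoint is the Weyl fractional integral. -/
theorem integral_smul_rlIntegral (hs : 0 < s) (hγ : 0 < γ)
    (hv : IntegrableOn (fun x => Real.exp (-γ * x) • v x) (Ioi 0)) {h : ℝ → ℝ} (hm : Measurable h)
    {C : ℝ} (hC : ∀ x > 0, |h x| ≤ C) :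
    ∫ x in Ioi (0 : ℝ), (h x * Real.exp (-γ * x)) • rlIntegral s v x =
      ∫ y in Ioi (0 : ℝ), ((Real.Gamma s)⁻¹ * ∫ t in Ioi (0 : ℝ),
        t ^ (s - 1) * (h (t + y) * Real.exp (-γ * (t + y)))) • v y := by
  have hΓ := (Real.Gamma_pos_of_pos hs).ne'
  set H : ℝ → ℝ := (Ioi (0 : ℝ)).indicator h with hH
  have hHm : Measurable H := hm.indicator measurableSet_Ioi
  have hC0 : 0 ≤ C := (abs_nonneg _).trans (hC 1 one_pos)
  have hHC : ∀ x, ‖H x‖ ≤ C := fun x => by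
    by_cases hx : x ∈ Ioi (0 : ℝ)
    · rw [hH, indicator_of_mem hx]; exact hC x hx
    · rw [hH, indicator_of_notMem hx]; simpa using hC0
  have hK : Integrable (fun p : ℝ × ℝ => H p.1 • rlKernel s γ v p.1 p.2) (volume.prod volume) :=
    Integrable.bdd_smul (φ := fun p : ℝ × ℝ => H p.1) (integrable_rlKernel hs hγ hv) C
      (hHm.comp measurable_fst).aestronglyMeasurable (ae_of_all _ fun p => hHC p.1)
  have hsw := integral_integral_swap (f := fun x y => H x • rlKernel s γ v x y) hK
  have hl : ∫ x, ∫ y, H x • rlKernel s γ v x y =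
      Real.Gamma s • ∫ x in Ioi (0 : ℝ), (h x * Real.exp (-γ * x)) • rlIntegral s v x := by
    rw [← integral_smul, ← integral_indicator measurableSet_Ioi]
    refine integral_congr_ae (ae_of_all _ fun x => ?_)
    simp only
    rw [integral_smul, integral_rlKernel hs]
    by_cases hx : x ∈ Ioi (0 : ℝ)
    · rw [hH, indicator_of_mem hx, indicator_of_mem hx, smul_comm, smul_smul (h x)]
    · rw [hH, indicator_of_notMem hx, indicator_of_notMem hx, zero_smul]
  have hr : ∫ y, ∫ x, H x • rlKernel s γ v x y = ∫ y in Ioi (0 : ℝ), (∫ t in Ioi (0 : ℝ),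
        t ^ (s - 1) * (h (t + y) * Real.exp (-γ * (t + y)))) • v y := by
    rw [← integral_indicator measurableSet_Ioi]
    refine integral_congr_ae (ae_of_all _ fun y => ?_)
    simp only [rlKernel, smul_smul]
    rw [integral_smul_const]
    by_cases hy : y ∈ Ioi (0 : ℝ)
    · have hy' : 0 < y := hy
      rw [indicator_of_mem hy, indicator_of_mem hy, smul_smul, ← integral_mul_const,
        ← integral_indicator measurableSet_Ioi]
      congr 1
      rw [← integral_add_right_eq_self _ y]
      refine integral_congr_ae (ae_of_all _ fun t => ?_)
      simp only [add_sub_cancel_right]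
      by_cases ht : t ∈ Ioi (0 : ℝ)
      · have ht' : 0 < t := ht
        rw [indicator_of_mem ht, indicator_of_mem ht, hH, indicator_of_mem (show t + y ∈ Ioi 0 from add_pos ht' hy'),
          mul_assoc, mul_assoc, ← Real.exp_add, ← mul_add]
        ring
      · rw [indicator_of_notMem ht, indicator_of_notMem ht, mul_zero, zero_mul]
    · rw [indicator_of_notMem hy, indicator_of_notMem hy, smul_zero]
  rw [hl, hr] at hsw
  simp only [mul_smul]
  rw [integral_smul, ← hsw, smul_smul, inv_mul_cancel₀ hΓ, one_smul]
  simp only [mul_smul]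

lemma integrableOn_Ioc_of_exp_smul {F : ℝ → ℂ}
    (hF : IntegrableOn (fun x => Real.exp (-γ * x) • F x) (Ioi 0)) (R : ℝ) :
    IntegrableOn F (Ioc 0 R) := by
  have h1 : IntegrableOn (fun x => Real.exp (-γ * x) • F x) (Ioc 0 R) :=
    hF.mono_set Ioc_subset_Ioi_self
  have hc : Continuous (fun x => Real.exp (γ * x)) := by fun_prop
  obtain ⟨C, hC⟩ := (isCompact_Icc (a := (0 : ℝ)) (b := R)).exists_bound_of_continuousOn hc.continuousOn
  have h2 := Integrable.bdd_smul (φ := fun x => Real.exp (γ * x)) h1 C hc.aestronglyMeasurable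
    (by filter_upwards [ae_restrict_mem measurableSet_Ioc] with x hx; exact hC x ⟨hx.1.le, hx.2⟩)
  refine h2.congr (ae_of_all _ fun x => ?_)
  simp only [Pi.smul_apply', smul_smul, ← Real.exp_add]
  simp

lemma locallyIntegrableOn_Ioi_of_Ioc {F : ℝ → ℂ} (hF : ∀ R : ℝ, IntegrableOn F (Ioc 0 R)) :
    LocallyIntegrableOn F (Ioi 0) := by
  intro x hx
  refine ⟨Ioc 0 (x + 1), ?_, hF _⟩
  have h : Ioo 0 (x + 1) ∈ 𝓝 x := Ioo_mem_nhds hx (lt_add_one x)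
  exact mem_nhdsWithin_of_mem_nhds (mem_of_superset h Ioo_subset_Ioc_self)

/-- The fractional integral of order `1` is a primitive. -/
lemma hasWeakDeriv_rlIntegral_one (hγ : 0 < γ)
    (hv : IntegrableOn (fun x => Real.exp (-γ * x) • v x) (Ioi 0)) :
    HasWeakDeriv 1 (rlIntegral 1 v) v := by
  refine ⟨locallyIntegrableOn_Ioi_of_Ioc
    (integrableOn_Ioc_of_exp_smul (integrableOn_exp_smul_rlIntegral one_pos hγ hv)),
    locallyIntegrableOn_Ioi_of_Ioc (integrableOn_Ioc_of_exp_smul hv), fun φ hφ hc _ => ?_⟩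
  have hd : Continuous (deriv φ) := (contDiff_infty_iff_deriv.1 hφ).2.continuous
  have hd' : Continuous (fun x => deriv φ x * Real.exp (γ * x)) := by fun_prop
  obtain ⟨C, hC⟩ := (hc.deriv.mul_right (f' := fun x => Real.exp (γ * x))).exists_bound_of_continuous hd'
  -- The bounded factor is φ' e^{γx}, so the exponential weight cancels and the adjoint of order 1
  -- is the integral of φ' over (y, ∞), which is -φ(y).
  have h := integral_smul_rlIntegral one_pos hγ hv hd'.measurable (C := C) fun x _ => hC x
  have he : ∀ x, deriv φ x * Real.exp (γ * x) * Real.exp (-γ * x) = deriv φ x := fun x => by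
    rw [mul_assoc, ← Real.exp_add]; simp
  simp only [he, sub_self, Real.rpow_zero, one_mul, Real.Gamma_one, inv_one] at h
  rw [iteratedDeriv_one, h, pow_one, neg_one_mul, ← integral_neg]
  refine integral_congr_ae (ae_of_all _ fun y => ?_)
  have h2 : ∫ t in Ioi (0 : ℝ), deriv φ (t + y) = - φ y := by
    have h3 := HasCompactSupport.integral_Ioi_deriv_eq (f := fun t => φ (t + y))
      ((hφ.comp (by fun_prop : ContDiff ℝ ∞ fun t : ℝ => t + y)).of_le (by exact_mod_cast le_top))
      (hc.comp_homeomorph (Homeomorph.addRight y)) 0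
    simpa only [deriv_comp_add_const, zero_add] using h3
  simp only [h2, neg_smul]

/-- The `L¹` bound of a fractional integral near its base point. -/
lemma integral_norm_rlIntegral_le (hs : 0 < s) {ε : ℝ} (hε : 0 < ε) (hv : IntegrableOn v (Ioc 0 ε)) :
    ∫ x in Ioc 0 ε, ‖rlIntegral s v x‖ ≤
      (Real.Gamma s)⁻¹ * (ε ^ s / s) * ∫ x in Ioc 0 ε, ‖v x‖ := by
  have hΓ := Real.Gamma_pos_of_pos hs
  -- For x in (0, ε] both the function and the kernel only matter on (0, ε]. After truncation the
  -- bound is the L¹ identity for a convolution of nonnegative functions.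
  set f : ℝ → ℝ := (Ioc (0 : ℝ) ε).indicator fun y => ‖v y‖ with hf
  set k : ℝ → ℝ := (Ioc (0 : ℝ) ε).indicator fun t => t ^ (s - 1) with hk
  have hfi : Integrable f := IntegrableOn.integrable_indicator hv.norm measurableSet_Ioc
  have hki' : IntegrableOn (fun t : ℝ => t ^ (s - 1)) (Ioc 0 ε) := by
    rw [← intervalIntegrable_iff_integrableOn_Ioc_of_le hε.le]
    exact intervalIntegral.intervalIntegrable_rpow' (by linarith)
  have hki : Integrable k := hki'.integrable_indicator measurableSet_Ioc
  have hkv : ∫ t, k t = ε ^ s / s := by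
    rw [hk, integral_indicator measurableSet_Ioc, ← intervalIntegral.integral_of_le hε.le,
      integral_rpow (Or.inl (by linarith))]
    simp [Real.zero_rpow hs.ne']
  have hf0 : ∀ y, 0 ≤ f y := fun y => indicator_nonneg (fun _ _ => norm_nonneg _) y
  have hk0 : ∀ t, 0 ≤ k t := fun t => indicator_nonneg (fun t ht => Real.rpow_nonneg ht.1.le _) t
  have hcv := integral_convolution (ContinuousLinearMap.mul ℝ ℝ) (μ := volume) (ν := volume) hfi hki
  have hci := hfi.integrable_convolution (ContinuousLinearMap.mul ℝ ℝ) hki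
  rw [ContinuousLinearMap.mul_apply', hkv, hf, integral_indicator measurableSet_Ioc] at hcv
  have hpt : ∀ x ∈ Ioc 0 ε, ‖rlIntegral s v x‖ ≤
      (Real.Gamma s)⁻¹ * MeasureTheory.convolution f k (ContinuousLinearMap.mul ℝ ℝ) volume x := by
    intro x hx
    rw [rlIntegral, norm_smul, Real.norm_of_nonneg (inv_pos.2 hΓ).le]
    gcongr
    refine (norm_integral_le_integral_norm _).trans (le_of_eq ?_)
    rw [convolution_def, ← integral_indicator measurableSet_Ioo]
    refine integral_congr_ae (ae_of_all _ fun y => ?_)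
    simp only [ContinuousLinearMap.mul_apply']
    by_cases hy : y ∈ Ioo 0 x
    · rw [indicator_of_mem hy, hf, indicator_of_mem (show y ∈ Ioc 0 ε from ⟨hy.1, hy.2.le.trans hx.2⟩), hk,
        indicator_of_mem (show x - y ∈ Ioc 0 ε from ⟨sub_pos.2 hy.2, by linarith [hy.1, hx.2]⟩),
        norm_smul, Real.norm_of_nonneg (Real.rpow_nonneg (sub_pos.2 hy.2).le _), mul_comm]
    · rw [indicator_of_notMem hy]
      by_cases hy0 : 0 < y
      · have : x - y ∉ Ioc 0 ε := fun h => hy ⟨hy0, sub_pos.1 h.1⟩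
        rw [hk, indicator_of_notMem this, mul_zero]
      · have : y ∉ Ioc 0 ε := fun h => hy0 h.1
        rw [hf, indicator_of_notMem this, zero_mul]
  have hcn : ∀ x, 0 ≤ MeasureTheory.convolution f k (ContinuousLinearMap.mul ℝ ℝ) volume x := fun x =>
    integral_nonneg fun y => mul_nonneg (hf0 y) (hk0 _)
  calc ∫ x in Ioc 0 ε, ‖rlIntegral s v x‖
      ≤ ∫ x in Ioc 0 ε, (Real.Gamma s)⁻¹ *
          MeasureTheory.convolution f k (ContinuousLinearMap.mul ℝ ℝ) volume x := by
        refine integral_mono_of_nonneg (ae_of_all _ fun x => norm_nonneg _)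
          (hci.integrableOn.const_mul _) ?_
        filter_upwards [ae_restrict_mem measurableSet_Ioc] with x hx
        exact hpt x hx
    _ ≤ (Real.Gamma s)⁻¹ * ∫ x, MeasureTheory.convolution f k (ContinuousLinearMap.mul ℝ ℝ) volume x := by
        rw [integral_const_mul]
        exact mul_le_mul_of_nonneg_left (setIntegral_le_integral hci (ae_of_all _ hcn))
          (inv_nonneg.2 hΓ.le)
    _ = _ := by rw [hcv]; ring

end RLIntegral

end TemperedLaguerre

/-! ### Passage to unweighted L², and the coefficient relation for one further derivative. -/

namespace TemperedLaguerre

section Weights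

/-- Multiplication by `x ^ (a / 2)`, which turns the weighted norm into the unweighted one. -/
noncomputable def unweight (a : ℝ) (u : ℝ → ℂ) (x : ℝ) : ℂ := (x ^ (a / 2) : ℝ) • u x

variable {a : ℝ} {u : ℝ → ℂ}

lemma eLpNorm_weightMeasure (a : ℝ) (u : ℝ → ℂ) :
    eLpNorm u 2 (weightMeasure a) = eLpNorm (unweight a u) 2 (volume.restrict (Ioi 0)) := by
  rw [eLpNorm_eq_lintegral_rpow_enorm_toReal two_ne_zero ENNReal.ofNat_ne_top,
    eLpNorm_eq_lintegral_rpow_enorm_toReal two_ne_zero ENNReal.ofNat_ne_top, weightMeasure,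
    lintegral_withDensity_eq_lintegral_mul_non_measurable _ (by fun_prop)
      (ae_of_all _ fun _ => ENNReal.ofReal_lt_top)]
  congr 1
  refine setLIntegral_congr_fun measurableSet_Ioi fun x hx => ?_
  have hx : 0 < x := hx
  simp only [Pi.mul_apply, unweight, ENNReal.toReal_ofNat, ENNReal.rpow_ofNat]
  rw [enorm_smul, mul_pow]
  congr 1
  rw [Real.enorm_of_nonneg (by positivity), ← ENNReal.ofReal_pow (by positivity),
    ← Real.rpow_natCast, ← Real.rpow_mul hx.le]
  norm_num

lemma aestronglyMeasurable_unweight_iff : AEStronglyMeasurable u (weightMeasure a) ↔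
    AEStronglyMeasurable (unweight a u) (volume.restrict (Ioi 0)) := by
  have hm : ∀ c : ℝ, AEStronglyMeasurable (fun x : ℝ => x ^ c) (volume.restrict (Ioi (0 : ℝ))) :=
    fun c => by
      have : Measurable (fun x : ℝ => x ^ c) := by fun_prop
      exact this.aestronglyMeasurable
  constructor
  · intro h
    have h1 : AEStronglyMeasurable u (volume.restrict (Ioi (0 : ℝ))) := by
      refine h.mono_ac (withDensity_absolutelyContinuous' (by fun_prop) ?_)
      filter_upwards [ae_restrict_mem measurableSet_Ioi] with x hx
      have hx : 0 < x := hx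
      exact (ENNReal.ofReal_pos.2 (by positivity)).ne'
    exact (hm (a / 2)).smul h1
  · intro h
    have h1 : AEStronglyMeasurable u (volume.restrict (Ioi (0 : ℝ))) := by
      refine ((hm (-(a / 2))).smul h).congr ?_
      filter_upwards [ae_restrict_mem measurableSet_Ioi] with x hx
      have hx : 0 < x := hx
      simp only [Pi.smul_apply', unweight]
      rw [smul_smul, ← Real.rpow_add hx]
      simp
    exact h1.mono_ac (withDensity_absolutelyContinuous _ _)

lemma memWeightedL2_iff : MemWeightedL2 a u ↔ MemLp (unweight a u) 2 (volume.restrict (Ioi 0)) := by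
  rw [MemWeightedL2, MemLp, MemLp, eLpNorm_weightMeasure, aestronglyMeasurable_unweight_iff]

lemma weightedNorm_eq : weightedNorm a u =
    (eLpNorm (unweight a u) 2 (volume.restrict (Ioi 0))).toReal := by
  rw [weightedNorm, eLpNorm_weightMeasure]

end Weights

open Polynomial

/-- The powers x^{ν/2} and x^{-ν/2} cancel, so the coefficients of u are integrals of u against
e^{-lam x} p with no power weight. For the weights x^k of the derivatives the half powers instead
combine to x^k. -/
lemma expPoly_smul_unweight_neg {lam ν x : ℝ} (hx : 0 < x) (p : ℝ[X]) (u : ℝ → ℂ) :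
    expPoly lam ν p x • unweight (-ν) u x = (Real.exp (-lam * x) * p.eval x) • u x := by
  have h : x ^ (ν / 2) * x ^ (-ν / 2) = 1 := by
    rw [← Real.rpow_add hx]; ring_nf; simp
  rw [expPoly, unweight, smul_smul]
  congr 1
  linear_combination (Real.exp (-lam * x) * p.eval x) * h

lemma expPoly_smul_unweight_natCast {lam x : ℝ} (k : ℕ) (hx : 0 < x) (p : ℝ[X]) (u : ℝ → ℂ) :
    expPoly lam k p x • unweight k u x = (x ^ k * Real.exp (-lam * x) * p.eval x) • u x := by
  have h : x ^ ((k : ℝ) / 2) * x ^ ((k : ℝ) / 2) = x ^ k := by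
    rw [← Real.rpow_add hx, add_halves, Real.rpow_natCast]
  rw [expPoly, unweight, smul_smul]
  congr 1
  linear_combination (Real.exp (-lam * x) * p.eval x) * h

section Recursion

lemma tendsto_setIntegral_Ioc_zero {f : ℝ → ℝ} (hf : IntegrableOn f (Ioi 0)) :
    Tendsto (fun ε => ∫ x in Ioc 0 ε, f x) (𝓝[>] 0) (𝓝 0) := by
  have h1 : Tendsto (fun ε : ℝ => (volume.restrict (Ioi (0 : ℝ))) (Ioc 0 ε)) (𝓝[>] 0) (𝓝 0) := by
    have h2 : Tendsto (fun ε : ℝ => ENNReal.ofReal (ε - 0)) (𝓝[>] 0) (𝓝 0) := by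
      have : Continuous (fun ε : ℝ => ENNReal.ofReal (ε - 0)) :=
        ENNReal.continuous_ofReal.comp (by fun_prop)
      have := this.tendsto 0
      simp only [sub_self, ENNReal.ofReal_zero] at this
      exact this.mono_left nhdsWithin_le_nhds
    refine h2.congr fun ε => ?_
    rw [Measure.restrict_apply measurableSet_Ioc, inter_eq_left.2 Ioc_subset_Ioi_self,
      Real.volume_Ioc]
  refine (Integrable.tendsto_setIntegral_nhds_zero hf h1).congr fun ε => ?_
  rw [Measure.restrict_restrict measurableSet_Ioc, inter_eq_left.2 Ioc_subset_Ioi_self]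

/-- The Laguerre coefficients of two successive tempered derivatives. -/
theorem polyCoeff_lag_succ {lam : ℝ} (hlam : 0 < lam) {k : ℕ} {g g' : ℝ → ℂ}
    (h : HasWeakDeriv 1 (fun x => Real.exp (lam * x) • g x) (fun x => Real.exp (lam * x) • g' x))
    (hg : MemWeightedL2 k g) (hg' : MemWeightedL2 (k + 1 : ℕ) g') (j : ℕ) :
    polyCoeff lam (k + 1 : ℕ) (unweight (k + 1 : ℕ) g') (lag (2 * lam) j (k + 1 : ℕ)) =
      -(j + 1) * polyCoeff lam k (unweight k g) (lag (2 * lam) (j + 1) k) := by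
  set b := 2 * lam with hb
  have hα : ∀ k : ℕ, (-1 : ℝ) < k := fun k => by have : (0 : ℝ) ≤ k := k.cast_nonneg; linarith
  have hU := memWeightedL2_iff.1 hg
  have hU' := memWeightedL2_iff.1 hg'
  set p := lag b j (k + 1 : ℕ) with hp
  set E : ℝ → ℝ := fun x => Real.exp (-b * x) * (X ^ (k + 1) * p).eval x with hE
  have hexp : ∀ x, Real.exp (-b * x) * Real.exp (lam * x) = Real.exp (-lam * x) := fun x => by
    rw [← Real.exp_add, hb]; ring_nf
  have hE' : deriv E = fun x => Real.exp (-b * x) *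
      (X ^ k * (C ((j : ℝ) + 1) * lag b (j + 1) k)).eval x := by
    rw [hE, deriv_exp_mul_eval, lag_succ, ← Nat.cast_succ, ← hp]
    ext x
    congr 2
    rw [derivative_mul, derivative_X_pow]
    simp only [Nat.add_sub_cancel, Nat.succ_eq_add_one]
    ring
  have e1 : ∀ x > 0, E x • (Real.exp (lam * x) • g x) =
      x • (expPoly lam k p x • unweight k g x) := by
    intro x hx
    rw [expPoly_smul_unweight_natCast k hx, smul_smul, smul_smul]
    simp only [hE, eval_mul, eval_pow, eval_X]
    congr 1
    rw [← hexp]; ring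
  have e2 : ∀ x > 0, deriv E x • (Real.exp (lam * x) • g x) =
      ((j : ℂ) + 1) * (expPoly lam k (lag b (j + 1) k) x • unweight k g x) := by
    intro x hx
    have hcast : ((j : ℂ) + 1) = (((j : ℝ) + 1 : ℝ) : ℂ) := by push_cast; rfl
    rw [expPoly_smul_unweight_natCast k hx, hcast, ← Complex.real_smul, smul_smul, smul_smul]
    simp only [hE', eval_mul, eval_pow, eval_X, eval_C]
    congr 1
    rw [← hexp]; ring
  have e3 : ∀ x > 0, E x • (Real.exp (lam * x) • g' x) =
      expPoly lam (k + 1 : ℕ) p x • unweight (k + 1 : ℕ) g' x := by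
    intro x hx
    rw [expPoly_smul_unweight_natCast (k + 1) hx, smul_smul]
    simp only [hE, eval_mul, eval_pow, eval_X]
    congr 1
    rw [← hexp]; ring
  have i0 := integrable_expPoly_smul hlam (hα k) p hU
  have i1 : IntegrableOn (fun x => E x • (Real.exp (lam * x) • g x)) (Ioi 0) := by
    refine IntegrableOn.congr_fun (integrable_expPoly_smul hlam (hα k) (X * p) hU)
      (fun x hx => ?_) measurableSet_Ioi
    rw [e1 x hx, smul_smul]
    congr 1
    simp only [expPoly, eval_mul, eval_X]
    ring
  have i2 : IntegrableOn (fun x => deriv E x • (Real.exp (lam * x) • g x)) (Ioi 0) :=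
    IntegrableOn.congr_fun ((integrable_expPoly_smul hlam (hα k) (lag b (j + 1) k) hU).const_mul
      ((j : ℂ) + 1)) (fun x hx => (e2 x hx).symm) measurableSet_Ioi
  have i3 : IntegrableOn (fun x => E x • (Real.exp (lam * x) • g' x)) (Ioi 0) :=
    IntegrableOn.congr_fun (integrable_expPoly_smul hlam (hα (k + 1)) p hU')
      (fun x hx => (e3 x hx).symm) measurableSet_Ioi
  -- The boundary function is x times an integrable one. On (0, ε] this x absorbs the 1/ε of the
  -- average, leaving an integral over a shrinking interval.
  have hlim : Tendsto (fun ε => ε⁻¹ * ∫ x in Ioc 0 ε, ‖E x • (Real.exp (lam * x) • g x)‖)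
      (𝓝[>] 0) (𝓝 0) := by
    have ht := tendsto_setIntegral_Ioc_zero i0.norm
    refine squeeze_zero_norm' ?_ ht
    filter_upwards [self_mem_nhdsWithin] with ε hε
    have hε : 0 < ε := hε
    rw [norm_mul, Real.norm_of_nonneg (inv_pos.2 hε).le, inv_mul_le_iff₀ hε, ← integral_const_mul]
    refine norm_integral_le_of_norm_le ((i0.mono_set Ioc_subset_Ioi_self).norm.const_mul ε) ?_
    filter_upwards [ae_restrict_mem measurableSet_Ioc] with x hx
    rw [e1 x hx.1, norm_norm, norm_smul, Real.norm_of_nonneg hx.1.le]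
    gcongr
    exact hx.2
  have key := h.integral_deriv_smul (contDiff_exp_mul_eval b (X ^ (k + 1) * p)) i1 i2 i3 hlim
  rw [setIntegral_congr_fun measurableSet_Ioi fun x hx => e2 x hx,
    setIntegral_congr_fun measurableSet_Ioi fun x hx => e3 x hx, integral_const_mul] at key
  rw [neg_mul]
  exact (neg_eq_iff_eq_neg.2 key).symm.trans (by rw [polyCoeff])

end Recursion

end TemperedLaguerre

/-! ### Boundary behaviour at 0 and the coefficient relation for order ν. -/

namespace TemperedLaguerre

open Polynomial

section Averages

/-- The rate 3/2 lam leaves a decay e^{-lam x / 2} for u and remains below the rate 2 lam of the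
Laguerre test functions. -/
lemma integrableOn_exp_smul_of_memWeightedL2 {ν lam : ℝ} (hν : 0 < ν) (hlam : 0 < lam) {u : ℝ → ℂ}
    (hu : MemWeightedL2 (-ν) u) :
    IntegrableOn (fun x => Real.exp (-(3 / 2 * lam) * x) • (Real.exp (lam * x) • u x)) (Ioi 0) := by
  refine IntegrableOn.congr_fun (integrable_expPoly_smul (lam := lam / 2) (α := ν) (by positivity)
    (by linarith) 1 (memWeightedL2_iff.1 hu)) (fun x hx => ?_) measurableSet_Ioi
  rw [expPoly_smul_unweight_neg hx, eval_one, mul_one, smul_smul, ← Real.exp_add]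
  ring_nf

lemma eventually_lt_one_nhdsGT_zero : ∀ᶠ ε in 𝓝[>] (0 : ℝ), ε < 1 :=
  mem_nhdsWithin_of_mem_nhds (Iio_mem_nhds one_pos)

lemma integral_norm_le_sqrt_mul {U : ℝ → ℂ} (hU : MemLp U 2 (volume.restrict (Ioi 0))) {ε : ℝ}
    (hε : 0 < ε) : ∫ x in Ioc 0 ε, ‖U x‖ ≤ ε ^ (1 / 2 : ℝ) * (∫ x in Ioc 0 ε, ‖U x‖ ^ 2) ^ (1 / 2 : ℝ) := by
  have hU' : MemLp U 2 (volume.restrict (Ioc 0 ε)) :=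
    hU.mono_measure (Measure.restrict_mono Ioc_subset_Ioi_self le_rfl)
  have h := integral_mul_le_Lp_mul_Lq_of_nonneg (μ := volume.restrict (Ioc 0 ε)) (f := fun _ => (1 : ℝ))
    (g := fun x => ‖U x‖) Real.HolderConjugate.two_two (ae_of_all _ fun _ => zero_le_one)
    (ae_of_all _ fun _ => norm_nonneg _) (memLp_const _) (by simpa using hU'.norm)
  simpa [hε.le] using h

/-- Write |u| = x^{ν/2} · x^{-ν/2} |u|. The first factor contributes ε^{ν/2}, Cauchy-Schwarz
contributes ε^{1/2}, and the remaining local L² norm tends to 0. -/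
lemma tendsto_tempered_average {ν lam : ℝ} (hν : 0 < ν) (hlam : 0 < lam) {u : ℝ → ℂ}
    (hu : MemWeightedL2 (-ν) u) :
    Tendsto (fun ε => ε ^ (-((ν + 1) / 2)) * ∫ x in Ioc 0 ε, ‖Real.exp (lam * x) • u x‖)
      (𝓝[>] 0) (𝓝 0) := by
  have hU := memWeightedL2_iff.1 hu
  have hU2 : IntegrableOn (fun x => ‖unweight (-ν) u x‖ ^ 2) (Ioi 0) :=
    (memLp_two_iff_integrable_sq_norm hU.1).1 hU
  have ht : Tendsto (fun ε => Real.exp lam * (∫ x in Ioc 0 ε, ‖unweight (-ν) u x‖ ^ 2) ^ (1 / 2 : ℝ))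
      (𝓝[>] 0) (𝓝 0) := by
    have h1 := (tendsto_setIntegral_Ioc_zero hU2).rpow_const (p := 1 / 2) (Or.inr (by norm_num))
    simpa using h1.const_mul (Real.exp lam)
  refine squeeze_zero_norm' ?_ ht
  filter_upwards [eventually_lt_one_nhdsGT_zero, self_mem_nhdsWithin] with ε h1 hε
  have hε : 0 < ε := hε
  have hUi : IntegrableOn (fun x => ‖unweight (-ν) u x‖) (Ioc 0 ε) :=
    (hU.mono_measure (Measure.restrict_mono Ioc_subset_Ioi_self le_rfl)).integrable
      (by norm_num) |>.norm
  have hb : ‖∫ x in Ioc 0 ε, ‖Real.exp (lam * x) • u x‖‖ ≤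
      Real.exp lam * ε ^ (ν / 2) * ∫ x in Ioc 0 ε, ‖unweight (-ν) u x‖ := by
    rw [← integral_const_mul]
    refine norm_integral_le_of_norm_le (hUi.const_mul _) ?_
    filter_upwards [ae_restrict_mem measurableSet_Ioc] with x hx
    have hx0 : 0 < x := hx.1
    have h2 : x ^ (ν / 2) * x ^ (-ν / 2) = 1 := by
      rw [← Real.rpow_add hx0]; ring_nf; simp
    rw [norm_norm, unweight, norm_smul, norm_smul, Real.norm_of_nonneg (Real.exp_pos _).le,
      Real.norm_of_nonneg (by positivity)]
    calc Real.exp (lam * x) * ‖u x‖ = Real.exp (lam * x) * x ^ (ν / 2) * (x ^ (-ν / 2) * ‖u x‖) := by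
          linear_combination (-Real.exp (lam * x) * ‖u x‖) * h2
      _ ≤ Real.exp lam * ε ^ (ν / 2) * (x ^ (-ν / 2) * ‖u x‖) := by
          gcongr
          · nlinarith [hx.2]
          · exact hx.2
  rw [norm_mul, Real.norm_of_nonneg (by positivity)]
  have h3 : ε ^ (-((ν + 1) / 2)) * (ε ^ (ν / 2) * ε ^ (1 / 2 : ℝ)) = 1 := by
    rw [← Real.rpow_add hε, ← Real.rpow_add hε]; ring_nf; simp
  calc _ ≤ ε ^ (-((ν + 1) / 2)) * (Real.exp lam * ε ^ (ν / 2) *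
        (ε ^ (1 / 2 : ℝ) * (∫ x in Ioc 0 ε, ‖unweight (-ν) u x‖ ^ 2) ^ (1 / 2 : ℝ))) := by
        gcongr
        refine hb.trans ?_
        gcongr
        exact integral_norm_le_sqrt_mul hU hε
    _ = _ := by linear_combination (Real.exp lam *
          (∫ x in Ioc 0 ε, ‖unweight (-ν) u x‖ ^ 2) ^ (1 / 2 : ℝ)) * h3

/-- The integral of e^{lam x} |u| over (0, ε] is o(ε^{(ν+1)/2}), so a gain ε^θ beats the averaging
factor 1/ε once θ + (ν+1)/2 ≥ 1. -/
lemma tendsto_average_of_le_rpow {q : ℝ → ℂ} {ν lam C θ : ℝ} {u : ℝ → ℂ} (hν : 0 < ν) (hlam : 0 < lam)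
    (hu : MemWeightedL2 (-ν) u) (hθ : 0 ≤ θ - 1 + (ν + 1) / 2) (hC : 0 ≤ C)
    (hq : ∀ ε > 0, ∫ x in Ioc 0 ε, ‖q x‖ ≤ C * ε ^ θ * ∫ x in Ioc 0 ε, ‖Real.exp (lam * x) • u x‖) :
    Tendsto (fun ε => ε⁻¹ * ∫ x in Ioc 0 ε, ‖q x‖) (𝓝[>] 0) (𝓝 0) := by
  have ht := (tendsto_tempered_average hν hlam hu).const_mul C
  rw [mul_zero] at ht
  refine squeeze_zero_norm' ?_ ht
  filter_upwards [eventually_lt_one_nhdsGT_zero, self_mem_nhdsWithin] with ε h1 hε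
  have hε : 0 < ε := hε
  set I := ∫ x in Ioc 0 ε, ‖Real.exp (lam * x) • u x‖
  have hI : 0 ≤ I := integral_nonneg fun _ => norm_nonneg _
  rw [norm_mul, Real.norm_of_nonneg (inv_pos.2 hε).le,
    Real.norm_of_nonneg (integral_nonneg fun _ => norm_nonneg _)]
  have h2 : ε⁻¹ * ε ^ θ = ε ^ (-((ν + 1) / 2)) * ε ^ (θ - 1 + (ν + 1) / 2) := by
    rw [← Real.rpow_add hε, ← Real.rpow_neg_one, ← Real.rpow_add hε]
    ring_nf
  calc _ ≤ ε⁻¹ * (C * ε ^ θ * I) := by gcongr; exact hq ε hε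
    _ = C * (ε ^ (-((ν + 1) / 2)) * ε ^ (θ - 1 + (ν + 1) / 2) * I) := by rw [← h2]; ring
    _ ≤ C * (ε ^ (-((ν + 1) / 2)) * 1 * I) := by
        gcongr
        exact Real.rpow_le_one hε.le h1.le hθ
    _ = _ := by rw [mul_one]

/-- The limit at 0 bounds q near the origin; away from it local integrability suffices. -/
lemma integrableOn_Ioc_of_tendsto_zero {q : ℝ → ℂ} (hq : LocallyIntegrableOn q (Ioi 0))
    (ht : Tendsto q (𝓝[>] 0) (𝓝 0)) (R : ℝ) : IntegrableOn q (Ioc 0 R) := by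
  have h1 : ∀ᶠ x in 𝓝[>] (0 : ℝ), ‖q x‖ < 1 := by
    have := ht.norm
    rw [norm_zero] at this
    exact this.eventually (Iio_mem_nhds one_pos)
  obtain ⟨δ, hδ, h2⟩ := mem_nhdsGT_iff_exists_Ioc_subset.1 h1
  have hδ : 0 < δ := hδ
  have i1 : IntegrableOn q (Ioc 0 δ) := by
    have hm := hq.aestronglyMeasurable.mono_measure
      (Measure.restrict_mono (Ioc_subset_Ioi_self (a := δ) (b := 0)) le_rfl)
    refine Integrable.of_bound hm 1 ?_
    filter_upwards [ae_restrict_mem measurableSet_Ioc] with x hx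
    exact le_of_lt (h2 hx)
  have i2 : IntegrableOn q (Icc δ R) :=
    hq.integrableOn_compact_subset (fun x hx => hδ.trans_le hx.1) isCompact_Icc
  refine (i1.union i2).mono_set fun x hx => ?_
  rcases le_or_gt x δ with h | h
  · exact Or.inl ⟨hx.1, h⟩
  · exact Or.inr ⟨h.le, hx.2⟩

lemma tendsto_average_of_tendsto_zero {q : ℝ → ℂ} (ht : Tendsto q (𝓝[>] 0) (𝓝 0)) :
    Tendsto (fun ε => ε⁻¹ * ∫ x in Ioc 0 ε, ‖q x‖) (𝓝[>] 0) (𝓝 0) := by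
  rw [Metric.tendsto_nhds]
  intro η hη
  have h1 : ∀ᶠ x in 𝓝[>] (0 : ℝ), ‖q x‖ < η / 2 := by
    have := ht.norm
    rw [norm_zero] at this
    exact this.eventually (Iio_mem_nhds (by positivity))
  obtain ⟨δ, hδ, h2⟩ := mem_nhdsGT_iff_exists_Ioc_subset.1 h1
  have h3 : ∀ᶠ ε in 𝓝[>] (0 : ℝ), ε < δ := mem_nhdsWithin_of_mem_nhds (Iio_mem_nhds hδ)
  filter_upwards [h3, self_mem_nhdsWithin] with ε h3 hε
  have hε : 0 < ε := hε
  rw [dist_zero_right, norm_mul, Real.norm_of_nonneg (inv_pos.2 hε).le]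
  have h4 : ‖∫ x in Ioc 0 ε, ‖q x‖‖ ≤ ∫ x in Ioc 0 ε, η / 2 := by
    refine norm_integral_le_of_norm_le (by simp) ?_
    filter_upwards [ae_restrict_mem measurableSet_Ioc] with x hx
    rw [norm_norm]
    exact le_of_lt (h2 ⟨hx.1, hx.2.trans h3.le⟩)
  rw [setIntegral_const, smul_eq_mul, measureReal_def, Real.volume_Ioc, sub_zero,
    ENNReal.toReal_ofReal hε.le] at h4
  rw [inv_mul_lt_iff₀ hε]
  refine h4.trans_lt ?_
  gcongr
  linarith

end Averages

section ChainOfDerivatives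

variable {ν lam : ℝ} {u : ℝ → ℂ}

/-- The fractional integral of order `⌊ν⌋₊ + 1 - ν` of `e^{lam x} u`, whose derivatives give all the
tempered derivatives of `u` of the orders `ν + k`. -/
noncomputable def temperedIntegral (ν lam : ℝ) (u : ℝ → ℂ) : ℝ → ℂ :=
  rlIntegral (((⌊ν⌋₊ + 1 : ℕ) : ℝ) - ν) fun y => Real.exp (lam * y) • u y

lemma temperedOrder_pos (ν : ℝ) : 0 < ((⌊ν⌋₊ + 1 : ℕ) : ℝ) - ν := by
  push_cast
  linarith [Nat.lt_floor_add_one ν]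

/-- Adding an integer shifts ν and its floor alike, so the order of the fractional integral does not
change and all these tempered derivatives are weak derivatives of one function. -/
lemma hasTemperedDeriv_add_natCast_iff (hν : 0 < ν) (k : ℕ) (g : ℝ → ℂ) :
    HasTemperedDeriv (ν + k) lam u g ↔ (∀ R : ℝ, IntegrableOn u (Ioc 0 R)) ∧
      HasWeakDeriv (⌊ν⌋₊ + 1 + k) (temperedIntegral ν lam u) (fun x => Real.exp (lam * x) • g x) := by
  rw [HasTemperedDeriv, Nat.floor_add_natCast hν.le, temperedIntegral,
    show ⌊ν⌋₊ + k + 1 = ⌊ν⌋₊ + 1 + k by ring,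
    show ((⌊ν⌋₊ + 1 + k : ℕ) : ℝ) - (ν + k) = ((⌊ν⌋₊ + 1 : ℕ) : ℝ) - ν by push_cast; ring]

lemma hasTemperedDeriv_sub_natCast_iff {i : ℕ} (hi : (i : ℝ) < ν) (g : ℝ → ℂ) :
    HasTemperedDeriv (ν - i) lam u g ↔ (∀ R : ℝ, IntegrableOn u (Ioc 0 R)) ∧
      HasWeakDeriv (⌊ν⌋₊ + 1 - i) (temperedIntegral ν lam u) (fun x => Real.exp (lam * x) • g x) := by
  have h1 : i ≤ ⌊ν⌋₊ := Nat.le_floor hi.le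
  rw [HasTemperedDeriv, Nat.floor_sub_natCast, temperedIntegral,
    show ⌊ν⌋₊ - i + 1 = ⌊ν⌋₊ + 1 - i by omega,
    show ((⌊ν⌋₊ + 1 - i : ℕ) : ℝ) - (ν - i) = ((⌊ν⌋₊ + 1 : ℕ) : ℝ) - ν by
      rw [Nat.cast_sub (by omega)]; ring]

/-- Under the homogeneous initial conditions all the lower derivatives of the fractional integral
exist and vanish at `0` in the mean. -/
lemma exists_weakDeriv_chain (hν : 0 < ν) (hlam : 0 < lam) (hu : MemWeightedL2 (-ν) u)
    (hIC : HomogeneousInitial ν lam u) {f : ℝ → ℂ}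
    (hf : HasWeakDeriv (⌊ν⌋₊ + 1) (temperedIntegral ν lam u) f)
    (hfi : ∀ R : ℝ, IntegrableOn f (Ioc 0 R)) (j : ℕ) :
    ∃ G : ℝ → ℂ, (j ≤ ⌊ν⌋₊ + 1 → HasWeakDeriv j (temperedIntegral ν lam u) G ∧
      (∀ R : ℝ, IntegrableOn G (Ioc 0 R)) ∧
      (j < ⌊ν⌋₊ + 1 → Tendsto (fun ε => ε⁻¹ * ∫ x in Ioc 0 ε, ‖G x‖) (𝓝[>] 0) (𝓝 0))) ∧
      (j = 0 → G = temperedIntegral ν lam u) ∧ (j = ⌊ν⌋₊ + 1 → G = f) := by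
  have hs := temperedOrder_pos ν
  have hγ : 0 < 3 / 2 * lam := by positivity
  have hv := integrableOn_exp_smul_of_memWeightedL2 hν hlam hu
  have hvi := integrableOn_Ioc_of_exp_smul hv
  have hFi : ∀ R : ℝ, IntegrableOn (temperedIntegral ν lam u) (Ioc 0 R) :=
    integrableOn_Ioc_of_exp_smul (integrableOn_exp_smul_rlIntegral hs hγ hv)
  rcases lt_trichotomy j (⌊ν⌋₊ + 1) with hj | hj | hj
  · rcases Nat.eq_zero_or_pos j with h0 | h0
    · subst h0
      refine ⟨temperedIntegral ν lam u, fun _ => ⟨⟨locallyIntegrableOn_Ioi_of_Ioc hFi,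
        locallyIntegrableOn_Ioi_of_Ioc hFi, fun φ _ _ _ => by simp⟩, hFi, fun _ => ?_⟩, fun _ => rfl,
        fun h => absurd h (by omega)⟩
      refine tendsto_average_of_le_rpow (C := (Real.Gamma (((⌊ν⌋₊ + 1 : ℕ) : ℝ) - ν))⁻¹ *
        (1 / (((⌊ν⌋₊ + 1 : ℕ) : ℝ) - ν))) (θ := ((⌊ν⌋₊ + 1 : ℕ) : ℝ) - ν) hν hlam hu ?_ ?_ ?_
      -- Here θ = ⌊ν⌋ + 1 - ν. For ν < 1 the required exponent is (1 - ν)/2; for ν ≥ 1 the term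
      -- (ν+1)/2 - 1 is already nonnegative.
      · rcases lt_or_ge ν 1 with h | h
        · rw [Nat.floor_eq_zero.2 h]
          push_cast
          linarith
        · linarith
      · have := Real.Gamma_pos_of_pos hs
        positivity
      · intro ε hε
        refine (integral_norm_rlIntegral_le hs hε (hvi ε)).trans (le_of_eq ?_)
        ring
    -- The j-th weak derivative is the tempered derivative of order ν - i with i = ⌊ν⌋ + 1 - j. The
    -- initial conditions supply it unless i = ν.
    · by_cases hi : ((⌊ν⌋₊ + 1 - j : ℕ) : ℝ) < ν
      · obtain ⟨h, h1, h2⟩ := hIC (⌊ν⌋₊ + 1 - j) (by omega) hi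
        rw [hasTemperedDeriv_sub_natCast_iff hi, show ⌊ν⌋₊ + 1 - (⌊ν⌋₊ + 1 - j) = j by omega] at h1
        have h3 : Tendsto (fun x => Real.exp (lam * x) • h x) (𝓝[>] 0) (𝓝 0) := by
          have hc : Continuous (fun x => Real.exp (lam * x)) := by fun_prop
          have := (hc.tendsto 0).mono_left (nhdsWithin_le_nhds (s := Ioi 0))
          simpa using this.smul h2
        exact ⟨_, fun _ => ⟨h1.2, integrableOn_Ioc_of_tendsto_zero h1.2.2.1 h3,
          fun _ => tendsto_average_of_tendsto_zero h3⟩, fun h => absurd h h0.ne',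
          fun h => absurd h hj.ne⟩
      -- The exceptional case is an integer ν with j = 1: the fractional integral has order 1 and
      -- its derivative is e^{lam x} u itself, which vanishes in the mean because ν ≥ 1.
      · have h1 : (⌊ν⌋₊ : ℝ) ≤ ν := Nat.floor_le hν.le
        have h2 : ((⌊ν⌋₊ + 1 - j : ℕ) : ℝ) ≤ (⌊ν⌋₊ : ℝ) := by exact_mod_cast (by omega)
        have h3 : ν = ⌊ν⌋₊ := le_antisymm ((not_lt.1 hi).trans h2) h1
        have h4 : ⌊ν⌋₊ ≤ ⌊ν⌋₊ + 1 - j := by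
          have : (⌊ν⌋₊ : ℝ) ≤ ((⌊ν⌋₊ + 1 - j : ℕ) : ℝ) := by rw [← h3]; exact not_lt.1 hi
          exact_mod_cast this
        have h5 : j = 1 := by omega
        have h6 : ((⌊ν⌋₊ + 1 : ℕ) : ℝ) - ν = 1 := by
          push_cast
          linarith
        have h7 : 1 ≤ ν := by
          rw [h3]
          exact_mod_cast (show 1 ≤ ⌊ν⌋₊ by omega)
        subst h5
        refine ⟨fun y => Real.exp (lam * y) • u y, fun _ => ⟨?_, hvi, fun _ => ?_⟩,
          fun h => absurd h h0.ne', fun h => absurd h hj.ne⟩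
        · rw [temperedIntegral, h6]
          exact hasWeakDeriv_rlIntegral_one hγ hv
        · refine tendsto_average_of_le_rpow (C := 1) (θ := 0) hν hlam hu (by linarith) zero_le_one ?_
          intro ε _
          simp
  · subst hj
    exact ⟨f, fun _ => ⟨hf, hfi, fun h => absurd h (lt_irrefl _)⟩, fun h => absurd h (by omega),
      fun _ => rfl⟩
  · exact ⟨0, fun h => absurd h (by omega), fun h => absurd h (by omega), fun h => absurd h (by omega)⟩

/-- The Laguerre coefficients of a function and of its tempered derivative of order `ν`. -/
theorem polyCoeff_lag_tempered (hν : 0 < ν) (hlam : 0 < lam) (hu : MemWeightedL2 (-ν) u)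
    (hIC : HomogeneousInitial ν lam u) {g : ℝ → ℂ} (hg : HasTemperedDeriv (ν + (0 : ℕ)) lam u g)
    (hg2 : MemWeightedL2 (0 : ℕ) g) (n : ℕ) :
    polyCoeff lam (0 : ℕ) (unweight (0 : ℕ) g) (lag (2 * lam) n (0 : ℕ)) =
      ((2 * lam) ^ ν : ℝ) * polyCoeff lam ν (unweight (-ν) u) (lag (2 * lam) n ν) := by
  set b := 2 * lam with hb
  have hb0 : 0 < b := by positivity
  have hs := temperedOrder_pos ν
  have hγ : 0 < 3 / 2 * lam := by positivity
  have hγb : 3 / 2 * lam < b := by rw [hb]; linarith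
  have hv := integrableOn_exp_smul_of_memWeightedL2 hν hlam hu
  have hFe := integrableOn_exp_smul_rlIntegral hs hγ hv
  have hU := memWeightedL2_iff.1 hg2
  have hw := ((hasTemperedDeriv_add_natCast_iff hν 0 g).1 hg).2
  rw [add_zero] at hw
  have hpt : ∀ (p : ℝ[X]), ∀ x > 0, (Real.exp (-b * x) * p.eval x) • (Real.exp (lam * x) • g x) =
      expPoly lam (0 : ℕ) p x • unweight (0 : ℕ) g x := by
    intro p x hx
    rw [expPoly_smul_unweight_natCast 0 hx, smul_smul]
    congr 1
    rw [pow_zero, one_mul, mul_right_comm, ← Real.exp_add, hb]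
    ring_nf
  have hα : (-1 : ℝ) < (0 : ℕ) := by simp
  have hfe : ∀ p : ℝ[X], IntegrableOn
      (fun x => (Real.exp (-b * x) * p.eval x) • (Real.exp (lam * x) • g x)) (Ioi 0) := fun p =>
    IntegrableOn.congr_fun (integrable_expPoly_smul hlam hα p hU) (fun x hx => (hpt p x hx).symm)
      measurableSet_Ioi
  have hfi : ∀ R : ℝ, IntegrableOn (fun x => Real.exp (lam * x) • g x) (Ioc 0 R) := by
    refine integrableOn_Ioc_of_exp_smul (γ := b) ?_
    simpa using hfe 1
  choose G hG hG0 hGM using exists_weakDeriv_chain hν hlam hu hIC hw hfi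
  have hG00 := hG0 0 rfl
  have hGMM := hGM _ rfl
  have h1 := fun (Ψ : ℝ → ℝ) (hΨ : ContDiff ℝ ∞ Ψ) (hc : HasCompactSupport Ψ) =>
    integral_iteratedDeriv_smul_of_hasCompactSupport (G := G) (M := ⌊ν⌋₊ + 1)
      (fun j hj => by rw [hG00]; exact (hG j hj).1) (fun j hj => (hG j hj).2.1)
      (fun j hj => (hG j hj.le).2.2 hj) le_rfl hΨ hc
  rw [hG00, hGMM] at h1
  have hFm : AEStronglyMeasurable (temperedIntegral ν lam u) (volume.restrict (Ioi 0)) :=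
    hw.1.aestronglyMeasurable
  -- With E = e^{-bx} L_n^(0)(bx) all ⌊ν⌋ + 1 derivatives fall on E, and the parameter becomes ⌊ν⌋ +
  -- 1.
  have h2 := integral_iteratedDeriv_smul_of_integrable h1 hFm
    (contDiff_exp_mul_eval b (lag b n (0 : ℕ))) (fun i _ => by
      rw [iteratedDeriv_exp_mul_lag]
      simp only [mul_smul]
      have := integrableOn_exp_mul_eval_smul hγb (lag b n ((0 : ℕ) + i)) hFe
      simp only [mul_smul] at this
      exact this.smul ((-b) ^ i)) (hfe _)
  rw [iteratedDeriv_exp_mul_lag, setIntegral_congr_fun measurableSet_Ioi (hpt _)] at h2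
  obtain ⟨K, hK⟩ := exists_bound_exp_mul_eval (sub_pos.2 hγb) (lag b n ((0 : ℕ) + (⌊ν⌋₊ + 1 : ℕ)))
  have h3 := integral_smul_rlIntegral hs hγ hv
    (contDiff_exp_mul_eval (b - 3 / 2 * lam) (lag b n ((0 : ℕ) + (⌊ν⌋₊ + 1 : ℕ)))).continuous.measurable hK
  have he : ∀ x, Real.exp (-(b - 3 / 2 * lam) * x) * Real.exp (-(3 / 2 * lam) * x) = Real.exp (-b * x) :=
    fun x => by rw [← Real.exp_add]; ring_nf
  -- The Weyl integral of order ⌊ν⌋ + 1 - ν takes the parameter from ⌊ν⌋ + 1 down to exactly ν.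
  have h4 : ∀ y, (Real.Gamma (((⌊ν⌋₊ + 1 : ℕ) : ℝ) - ν))⁻¹ * (∫ t in Ioi (0 : ℝ),
      t ^ (((⌊ν⌋₊ + 1 : ℕ) : ℝ) - ν - 1) * (Real.exp (-(b - 3 / 2 * lam) * (t + y)) *
        (lag b n ((0 : ℕ) + (⌊ν⌋₊ + 1 : ℕ))).eval (t + y) * Real.exp (-(3 / 2 * lam) * (t + y)))) =
      b ^ (-(((⌊ν⌋₊ + 1 : ℕ) : ℝ) - ν)) * (Real.exp (-b * y) * (lag b n ν).eval y) := by
    intro y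
    have h5 : ∫ t in Ioi (0 : ℝ),
      t ^ (((⌊ν⌋₊ + 1 : ℕ) : ℝ) - ν - 1) * (Real.exp (-(b - 3 / 2 * lam) * (t + y)) *
        (lag b n ((0 : ℕ) + (⌊ν⌋₊ + 1 : ℕ))).eval (t + y) * Real.exp (-(3 / 2 * lam) * (t + y))) =
        Real.exp (-b * y) * gammaInt b (((⌊ν⌋₊ + 1 : ℕ) : ℝ) - ν - 1)
          ((lag b n ((0 : ℕ) + (⌊ν⌋₊ + 1 : ℕ))).comp (X + C y)) := by
      rw [gammaInt, ← integral_const_mul]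
      refine integral_congr_ae (ae_of_all _ fun t => ?_)
      simp only [eval_comp, eval_add, eval_X, eval_C]
      rw [mul_right_comm (Real.exp (-(b - 3 / 2 * lam) * (t + y))), he,
        show -b * (t + y) = -b * y + -b * t by ring, Real.exp_add]
      ring
    rw [h5, gammaInt_lag_comp hb0 hs]
    rw [show ((0 : ℕ) : ℝ) + ((⌊ν⌋₊ + 1 : ℕ) : ℝ) - (((⌊ν⌋₊ + 1 : ℕ) : ℝ) - ν) = ν by simp]
    have := (Real.Gamma_pos_of_pos hs).ne'
    field_simp
  simp only [h4] at h3
  simp only [mul_right_comm (Real.exp (-(b - 3 / 2 * lam) * _)), he] at h3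
  simp only [mul_smul ((-b) ^ (⌊ν⌋₊ + 1))] at h2
  rw [integral_smul, temperedIntegral, h3] at h2
  have h6 : ∀ x > 0, (b ^ (-(((⌊ν⌋₊ + 1 : ℕ) : ℝ) - ν)) * (Real.exp (-b * x) * (lag b n ν).eval x)) •
      (Real.exp (lam * x) • u x) =
      b ^ (-(((⌊ν⌋₊ + 1 : ℕ) : ℝ) - ν)) • (expPoly lam ν (lag b n ν) x • unweight (-ν) u x) := by
    intro x hx
    rw [expPoly_smul_unweight_neg hx, smul_smul, smul_smul]
    congr 1
    rw [mul_assoc, mul_right_comm, ← Real.exp_add, hb]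
    ring_nf
  rw [setIntegral_congr_fun measurableSet_Ioi h6, integral_smul, smul_smul] at h2
  have h7 : ((-1 : ℂ) ^ (⌊ν⌋₊ + 1)) * ((-1 : ℂ) ^ (⌊ν⌋₊ + 1)) = 1 := by
    rw [← mul_pow]; simp
  have h8 : (-b) ^ (⌊ν⌋₊ + 1) * b ^ (-(((⌊ν⌋₊ + 1 : ℕ) : ℝ) - ν)) = (-1) ^ (⌊ν⌋₊ + 1) * b ^ ν := by
    rw [neg_pow, mul_assoc, ← Real.rpow_natCast b, ← Real.rpow_add hb0]
    congr 2
    ring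
  rw [h8, Complex.real_smul] at h2
  push_cast at h2 ⊢
  rw [mul_assoc] at h2
  simpa [polyCoeff] using (mul_left_cancel₀ (by simp) h2).symm

end ChainOfDerivatives

end TemperedLaguerre

/-! ### Linearity, and regularity of the functions x^ν e^{-lam x} p(x). -/

namespace TemperedLaguerre

open Polynomial

variable {ν lam : ℝ}

section Linear

lemma integrableOn_Ioc_of_memWeightedL2 (hν : 0 < ν) {u : ℝ → ℂ} (hu : MemWeightedL2 (-ν) u) (R : ℝ) :
    IntegrableOn u (Ioc 0 R) := by
  refine integrableOn_Ioc_of_exp_smul (γ := 1) (IntegrableOn.congr_fun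
    (integrable_expPoly_smul (lam := 1) (α := ν) one_pos (by linarith) 1 (memWeightedL2_iff.1 hu))
    (fun x hx => ?_) measurableSet_Ioi) R
  rw [expPoly_smul_unweight_neg hx, eval_one, mul_one]

/-- Equality is claimed only almost everywhere: at a point where an integrand fails to be integrable
its integral is 0 by convention, and additivity can break. -/
lemma temperedIntegral_sub_ae (hν : 0 < ν) (hlam : 0 < lam) {u₁ u₂ : ℝ → ℂ}
    (h₁ : MemWeightedL2 (-ν) u₁) (h₂ : MemWeightedL2 (-ν) u₂) :
    ∀ᵐ x ∂(volume.restrict (Ioi (0 : ℝ))), temperedIntegral ν lam u₁ x - temperedIntegral ν lam u₂ x =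
      temperedIntegral ν lam (fun x => u₁ x - u₂ x) x := by
  have hs := temperedOrder_pos ν
  have hγ : 0 < 3 / 2 * lam := by positivity
  refine ae_restrict_of_ae ?_
  filter_upwards [ae_integrableOn_rlIntegrand hs hγ (integrableOn_exp_smul_of_memWeightedL2 hν hlam h₁),
    ae_integrableOn_rlIntegrand hs hγ (integrableOn_exp_smul_of_memWeightedL2 hν hlam h₂)] with x i₁ i₂
  simp only [temperedIntegral, rlIntegral, ← smul_sub]
  rw [← integral_sub i₁ i₂]
  simp only [smul_sub]

lemma hasWeakDeriv_temperedIntegral_sub (hν : 0 < ν) (hlam : 0 < lam) {u₁ u₂ g₁ g₂ : ℝ → ℂ} {j : ℕ}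
    (h₁ : MemWeightedL2 (-ν) u₁) (h₂ : MemWeightedL2 (-ν) u₂)
    (hg₁ : HasWeakDeriv j (temperedIntegral ν lam u₁) (fun x => Real.exp (lam * x) • g₁ x))
    (hg₂ : HasWeakDeriv j (temperedIntegral ν lam u₂) (fun x => Real.exp (lam * x) • g₂ x)) :
    HasWeakDeriv j (temperedIntegral ν lam (fun x => u₁ x - u₂ x))
      (fun x => Real.exp (lam * x) • (g₁ x - g₂ x)) :=
  (hg₁.sub hg₂).congr (temperedIntegral_sub_ae hν hlam h₁ h₂)
    (ae_of_all _ fun x => by rw [smul_sub])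

lemma HasTemperedDeriv.sub (hν : 0 < ν) (hlam : 0 < lam) {u₁ u₂ g₁ g₂ : ℝ → ℂ} {k : ℕ}
    (h₁ : MemWeightedL2 (-ν) u₁) (h₂ : MemWeightedL2 (-ν) u₂)
    (hg₁ : HasTemperedDeriv (ν + k) lam u₁ g₁) (hg₂ : HasTemperedDeriv (ν + k) lam u₂ g₂) :
    HasTemperedDeriv (ν + k) lam (fun x => u₁ x - u₂ x) (fun x => g₁ x - g₂ x) := by
  rw [hasTemperedDeriv_add_natCast_iff hν] at *
  exact ⟨fun R => (hg₁.1 R).sub (hg₂.1 R), hasWeakDeriv_temperedIntegral_sub hν hlam h₁ h₂ hg₁.2 hg₂.2⟩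

lemma MemA.sub (hν : 0 < ν) (hlam : 0 < lam) {m : ℕ} {u₁ u₂ : ℝ → ℂ} (h₁ : MemA ν lam m u₁)
    (h₂ : MemA ν lam m u₂) : MemA ν lam m (fun x => u₁ x - u₂ x) := by
  refine ⟨MemLp.sub h₁.1 h₂.1, fun k hk => ?_⟩
  obtain ⟨g₁, a₁, b₁⟩ := h₁.2 k hk
  obtain ⟨g₂, a₂, b₂⟩ := h₂.2 k hk
  exact ⟨_, a₁.sub hν hlam h₁.1 h₂.1 a₂, MemLp.sub b₁ b₂⟩

lemma HomogeneousInitial.sub (hν : 0 < ν) (hlam : 0 < lam) {u₁ u₂ : ℝ → ℂ}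
    (h₁ : MemWeightedL2 (-ν) u₁) (h₂ : MemWeightedL2 (-ν) u₂) (hi₁ : HomogeneousInitial ν lam u₁)
    (hi₂ : HomogeneousInitial ν lam u₂) : HomogeneousInitial ν lam (fun x => u₁ x - u₂ x) := by
  intro i h1 hi
  obtain ⟨g₁, a₁, b₁⟩ := hi₁ i h1 hi
  obtain ⟨g₂, a₂, b₂⟩ := hi₂ i h1 hi
  rw [hasTemperedDeriv_sub_natCast_iff hi] at a₁ a₂
  refine ⟨fun x => g₁ x - g₂ x, ?_, by simpa using b₁.sub b₂⟩
  rw [hasTemperedDeriv_sub_natCast_iff hi]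
  exact ⟨fun R => (a₁.1 R).sub (a₂.1 R), hasWeakDeriv_temperedIntegral_sub hν hlam h₁ h₂ a₁.2 a₂.2⟩

end Linear

section Smooth

lemma hasDerivAt_eval_ofReal (Q : ℂ[X]) (x : ℝ) :
    HasDerivAt (fun x : ℝ => Q.eval (x : ℂ)) ((derivative Q).eval (x : ℂ)) x :=
  (Q.hasDerivAt (x : ℂ)).comp_ofReal

lemma continuous_eval_ofReal (Q : ℂ[X]) : Continuous (fun x : ℝ => Q.eval (x : ℂ)) :=
  Q.continuous.comp Complex.continuous_ofReal

lemma setIntegral_Ioi_eq_integral_of_test {φ : ℝ → ℝ} (hs : tsupport φ ⊆ Ioi 0) (f : ℝ → ℂ) :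
    ∫ x in Ioi (0 : ℝ), φ x • f x = ∫ x, φ x • f x := by
  refine setIntegral_eq_integral_of_forall_compl_eq_zero fun x hx => ?_
  have : φ x = 0 := by
    by_contra h
    exact hx (hs (subset_tsupport φ h))
  rw [this, zero_smul]

lemma integral_deriv_smul_eval {φ : ℝ → ℝ} (hφ : ContDiff ℝ ∞ φ) (hc : HasCompactSupport φ)
    (hs : tsupport φ ⊆ Ioi 0) (Q : ℂ[X]) :
    ∫ x in Ioi (0 : ℝ), deriv φ x • Q.eval (x : ℂ) =
      - ∫ x in Ioi (0 : ℝ), φ x • (derivative Q).eval (x : ℂ) := by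
  have hs' : tsupport (deriv φ) ⊆ Ioi 0 :=
    (closure_minimal support_deriv_subset (isClosed_tsupport _)).trans hs
  have hd : Continuous (deriv φ) := (contDiff_infty_iff_deriv.1 hφ).2.continuous
  rw [setIntegral_Ioi_eq_integral_of_test hs', setIntegral_Ioi_eq_integral_of_test hs,
    eq_neg_iff_add_eq_zero]
  have i1 : Integrable (fun x => deriv φ x • Q.eval (x : ℂ)) :=
    (hd.smul (continuous_eval_ofReal Q)).integrable_of_hasCompactSupport hc.deriv.smul_right
  have i2 : Integrable (fun x => φ x • (derivative Q).eval (x : ℂ)) :=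
    (hφ.continuous.smul (continuous_eval_ofReal _)).integrable_of_hasCompactSupport hc.smul_right
  have i3 : Integrable (fun x => φ x • Q.eval (x : ℂ)) :=
    (hφ.continuous.smul (continuous_eval_ofReal _)).integrable_of_hasCompactSupport hc.smul_right
  rw [← integral_add i1 i2]
  refine integral_eq_zero_of_hasDerivAt_of_integrable (f := fun x => φ x • Q.eval (x : ℂ))
    (fun x => ?_) (i1.add i2) i3
  have := ((hφ.differentiable (by simp)).differentiableAt (x := x)).hasDerivAt.fun_smul
    (hasDerivAt_eval_ofReal Q x)
  rwa [add_comm] at this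

lemma hasWeakDeriv_of_eq_eval {F : ℝ → ℂ} {Q : ℂ[X]} (hF : ∀ x > 0, F x = Q.eval (x : ℂ)) (k : ℕ) :
    HasWeakDeriv k F (fun x => (derivative^[k] Q).eval (x : ℂ)) := by
  have hbase : HasWeakDeriv k (fun x : ℝ => Q.eval (x : ℂ)) (fun x => (derivative^[k] Q).eval (x : ℂ)) := by
    refine ⟨(continuous_eval_ofReal Q).locallyIntegrable.locallyIntegrableOn _,
      (continuous_eval_ofReal _).locallyIntegrable.locallyIntegrableOn _, ?_⟩
    induction k with
    | zero => intro φ _ _ _; simp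
    | succ k ih =>
      intro φ hφ hc hs
      have hs' : tsupport (deriv φ) ⊆ Ioi 0 :=
        (closure_minimal support_deriv_subset (isClosed_tsupport _)).trans hs
      rw [iteratedDeriv_succ', ih _ (contDiff_infty_iff_deriv.1 hφ).2 hc.deriv hs',
        integral_deriv_smul_eval hφ hc hs, Function.iterate_succ_apply']
      ring
  refine hbase.congr ?_ (ae_of_all _ fun _ => rfl)
  filter_upwards [ae_restrict_mem measurableSet_Ioi] with x hx
  exact (hF x hx).symm

end Smooth

section GLF

lemma intervalIntegrable_sub_rpow_mul {s c x : ℝ} (hs : 0 < s) (hc : 0 ≤ c) (hx : 0 < x) :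
    IntegrableOn (fun y : ℝ => (x - y) ^ (s - 1) * y ^ c) (Ioo 0 x) := by
  have h1 : IntegrableOn (fun y : ℝ => (x - y) ^ (s - 1)) (Ioo 0 x) := by
    have h2 : IntervalIntegrable (fun y : ℝ => y ^ (s - 1)) volume x 0 :=
      intervalIntegral.intervalIntegrable_rpow' (by linarith)
    have h3 := h2.comp_sub_left x
    rw [sub_self, sub_zero] at h3
    exact ((intervalIntegrable_iff_integrableOn_Ioc_of_le hx.le).1 h3).mono_set Ioo_subset_Ioc_self
  refine Integrable.mul_bdd (c := x ^ c) h1 (by fun_prop) ?_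
  filter_upwards [ae_restrict_mem measurableSet_Ioo] with y hy
  rw [Real.norm_of_nonneg (Real.rpow_nonneg hy.1.le _)]
  exact Real.rpow_le_rpow hy.1.le hy.2.le hc

/-- Scaling y = xt turns the integral into a power of x times a Beta-type integral, whose value is
never needed. -/
lemma integral_sub_rpow_mul_rpow (s c : ℝ) : ∃ B : ℝ, ∀ x > 0,
    ∫ y in Ioo 0 x, (x - y) ^ (s - 1) * y ^ c = B * x ^ (s + c) := by
  refine ⟨∫ t in Ioo (0 : ℝ) 1, (1 - t) ^ (s - 1) * t ^ c, fun x hx => ?_⟩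
  have h := intervalIntegral.integral_comp_mul_left (a := 0) (b := 1)
    (fun y : ℝ => (x - y) ^ (s - 1) * y ^ c) hx.ne'
  rw [mul_zero, mul_one, intervalIntegral.integral_of_le zero_le_one,
    intervalIntegral.integral_of_le hx.le, integral_Ioc_eq_integral_Ioo,
    integral_Ioc_eq_integral_Ioo, smul_eq_mul] at h
  have h2 : ∫ t in Ioo (0 : ℝ) 1, (x - x * t) ^ (s - 1) * (x * t) ^ c =
      x ^ (s - 1 + c) * ∫ t in Ioo (0 : ℝ) 1, (1 - t) ^ (s - 1) * t ^ c := by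
    rw [← integral_const_mul]
    refine setIntegral_congr_fun measurableSet_Ioo fun t ht => ?_
    rw [show x - x * t = x * (1 - t) by ring, Real.mul_rpow hx.le (sub_nonneg.2 ht.2.le),
      Real.mul_rpow hx.le ht.1.le, Real.rpow_add hx]
    ring
  rw [h2, eq_comm, inv_mul_eq_iff_eq_mul₀ hx.ne'] at h
  rw [h, show s + c = s - 1 + c + 1 by ring, Real.rpow_add_one hx.ne']
  ring

/-- The fractional integral of `x ^ ν p(x)` of order `M - ν` is `x ^ M` times a polynomial. -/
lemma exists_rlIntegral_rpow_mul_eval {M : ℕ} (hν : 0 < ν) (hM : ν < M) (p : ℂ[X]) :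
    ∃ P : ℂ[X], ∀ x > 0, rlIntegral (M - ν) (fun y => ((y ^ ν : ℝ) : ℂ) * p.eval (y : ℂ)) x =
      (X ^ M * P).eval (x : ℂ) := by
  have hs : 0 < (M : ℝ) - ν := sub_pos.2 hM
  have hi : ∀ q : ℂ[X], ∀ x > 0, IntegrableOn (fun y : ℝ => ((x - y) ^ ((M : ℝ) - ν - 1)) •
      (((y ^ ν : ℝ) : ℂ) * q.eval (y : ℂ))) (Ioo 0 x) := by
    intro q x hx
    obtain ⟨K, hK⟩ := (isCompact_Icc (a := (0 : ℝ)) (b := x)).exists_bound_of_continuousOn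
      (continuous_eval_ofReal q).continuousOn
    have h1 := (intervalIntegrable_sub_rpow_mul hs hν.le hx).ofReal (𝕜 := ℂ)
    have h2 := Integrable.mul_bdd (c := K) h1 (continuous_eval_ofReal q).aestronglyMeasurable
      (by filter_upwards [ae_restrict_mem measurableSet_Ioo] with y hy; exact hK y ⟨hy.1.le, hy.2.le⟩)
    refine h2.congr (ae_of_all _ fun y => ?_)
    simp only [Complex.real_smul, Complex.coe_algebraMap]
    push_cast
    ring
  induction p using Polynomial.induction_on' with
  | add p q hp hq =>
    obtain ⟨P, hP⟩ := hp
    obtain ⟨Q, hQ⟩ := hq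
    refine ⟨P + Q, fun x hx => ?_⟩
    rw [mul_add, eval_add, ← hP x hx, ← hQ x hx, rlIntegral, rlIntegral, rlIntegral, ← smul_add,
      ← integral_add (hi p x hx) (hi q x hx)]
    simp only [eval_add, mul_add, smul_add]
  | monomial n c =>
    obtain ⟨B, hB⟩ := integral_sub_rpow_mul_rpow ((M : ℝ) - ν) (ν + n)
    refine ⟨C (((Real.Gamma (M - ν))⁻¹ * B : ℝ) * c) * X ^ n, fun x hx => ?_⟩
    have h1 : ∫ y in Ioo 0 x, ((x - y) ^ ((M : ℝ) - ν - 1)) •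
        (((y ^ ν : ℝ) : ℂ) * (monomial n c).eval (y : ℂ)) =
        ((∫ y in Ioo 0 x, (x - y) ^ ((M : ℝ) - ν - 1) * y ^ (ν + n) : ℝ) : ℂ) * c := by
      rw [← integral_complex_ofReal, ← integral_mul_const]
      refine setIntegral_congr_fun measurableSet_Ioo fun y hy => ?_
      simp only [eval_monomial, Complex.real_smul]
      rw [Real.rpow_add_natCast hy.1.ne']
      push_cast
      ring
    rw [rlIntegral, h1, hB x hx, show (M : ℝ) - ν + (ν + n) = ((M + n : ℕ) : ℝ) by push_cast; ring,
      Real.rpow_natCast, Complex.real_smul]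
    simp only [eval_mul, eval_pow, eval_X, eval_C]
    push_cast
    ring

lemma memLp_rpow_mul_exp_mul_eval {α : ℝ} (hlam : 0 < lam) (hα : -1 < α) (p : ℂ[X]) :
    MemLp (fun x : ℝ => ((x ^ (α / 2) * Real.exp (-lam * x) : ℝ) : ℂ) * p.eval (x : ℂ)) 2
      (volume.restrict (Ioi 0)) := by
  induction p using Polynomial.induction_on' with
  | add p q hp hq => simp only [eval_add, mul_add]; exact hp.add hq
  | monomial n c =>
    refine (((memLp_expPoly hlam hα (X ^ n)).ofReal (K := ℂ)).mul_const c).ae_eq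
      (ae_of_all _ fun x => ?_)
    simp only [expPoly, eval_pow, eval_X, eval_monomial, Complex.coe_algebraMap]
    push_cast
    ring

/-- The function `x ^ ν e^{-lam x} p(x)`. -/
noncomputable def glf (ν lam : ℝ) (p : ℂ[X]) (x : ℝ) : ℂ :=
  ((x ^ ν * Real.exp (-lam * x) : ℝ) : ℂ) * p.eval (x : ℂ)

lemma unweight_neg_glf {x : ℝ} (hx : 0 < x) (p : ℂ[X]) : unweight (-ν) (glf ν lam p) x =
    ((x ^ (ν / 2) * Real.exp (-lam * x) : ℝ) : ℂ) * p.eval (x : ℂ) := by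
  have h : x ^ (-ν / 2) * x ^ ν = x ^ (ν / 2) := by rw [← Real.rpow_add hx]; ring_nf
  rw [unweight, glf, Complex.real_smul, ← mul_assoc, ← Complex.ofReal_mul, ← mul_assoc, h]

lemma memWeightedL2_glf (hν : 0 < ν) (hlam : 0 < lam) (p : ℂ[X]) :
    MemWeightedL2 (-ν) (glf ν lam p) := by
  rw [memWeightedL2_iff]
  refine (memLp_rpow_mul_exp_mul_eval hlam (show -1 < ν by linarith) p).ae_eq ?_
  filter_upwards [ae_restrict_mem measurableSet_Ioi] with x hx
  rw [unweight_neg_glf hx]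

lemma exp_smul_exp_neg_mul (lam x : ℝ) (z : ℂ) :
    Real.exp (lam * x) • ((Real.exp (-lam * x) : ℝ) * z) = z := by
  rw [Complex.real_smul, ← mul_assoc, ← Complex.ofReal_mul, ← Real.exp_add]
  simp

/-- The tempering cancels e^{-lam x}, leaving the fractional integral of x^ν p. The factor x^{⌊ν⌋+1}
is kept explicit since it encodes the vanishing of the lower derivatives at 0. -/
lemma exists_temperedIntegral_glf (hν : 0 < ν) (lam : ℝ) (p : ℂ[X]) : ∃ P : ℂ[X], ∀ x > 0,
    temperedIntegral ν lam (glf ν lam p) x = (X ^ (⌊ν⌋₊ + 1) * P).eval (x : ℂ) := by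
  obtain ⟨P, hP⟩ := exists_rlIntegral_rpow_mul_eval hν
    (show ν < (⌊ν⌋₊ + 1 : ℕ) by push_cast; exact Nat.lt_floor_add_one ν) p
  refine ⟨P, fun x hx => ?_⟩
  rw [← hP x hx, temperedIntegral]
  congr 1
  ext y
  have := exp_smul_exp_neg_mul lam y (((y ^ ν : ℝ) : ℂ) * p.eval (y : ℂ))
  rw [← this, glf]
  push_cast
  ring_nf

lemma memA_glf (hν : 0 < ν) (hlam : 0 < lam) (m : ℕ) (p : ℂ[X]) : MemA ν lam m (glf ν lam p) := by
  have hw := memWeightedL2_glf hν hlam p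
  refine ⟨hw, fun k _ => ?_⟩
  obtain ⟨P, hP⟩ := exists_temperedIntegral_glf hν lam p
  refine ⟨fun x => (Real.exp (-lam * x) : ℝ) *
    (derivative^[⌊ν⌋₊ + 1 + k] (X ^ (⌊ν⌋₊ + 1) * P)).eval (x : ℂ), ?_, ?_⟩
  · rw [hasTemperedDeriv_add_natCast_iff hν]
    refine ⟨integrableOn_Ioc_of_memWeightedL2 hν hw, ?_⟩
    simp only [exp_smul_exp_neg_mul]
    exact hasWeakDeriv_of_eq_eval hP _
  · rw [memWeightedL2_iff]
    refine (memLp_rpow_mul_exp_mul_eval hlam (show -1 < (k : ℝ) by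
      have : (0 : ℝ) ≤ k := k.cast_nonneg
      linarith) (derivative^[⌊ν⌋₊ + 1 + k] (X ^ (⌊ν⌋₊ + 1) * P))).ae_eq (ae_of_all _ fun x => ?_)
    simp only [unweight, Complex.real_smul]
    push_cast
    ring

lemma homogeneousInitial_glf (hν : 0 < ν) (hlam : 0 < lam) (p : ℂ[X]) :
    HomogeneousInitial ν lam (glf ν lam p) := by
  intro i h1 hi
  obtain ⟨P, hP⟩ := exists_temperedIntegral_glf hν lam p
  set Q := derivative^[⌊ν⌋₊ + 1 - i] (X ^ (⌊ν⌋₊ + 1) * P) with hQ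
  -- As i ≥ 1, fewer than ⌊ν⌋ + 1 derivatives are taken, so a factor x survives.
  have hQ0 : Q.eval 0 = 0 := by
    rw [← coeff_zero_eq_eval_zero, hQ, coeff_iterate_derivative, coeff_X_pow_mul',
      if_neg (by have : i ≤ ⌊ν⌋₊ := Nat.le_floor hi.le; omega), smul_zero]
  refine ⟨fun x => (Real.exp (-lam * x) : ℝ) * Q.eval (x : ℂ), ?_, ?_⟩
  · rw [hasTemperedDeriv_sub_natCast_iff hi]
    refine ⟨integrableOn_Ioc_of_memWeightedL2 hν (memWeightedL2_glf hν hlam p), ?_⟩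
    simp only [exp_smul_exp_neg_mul]
    exact hasWeakDeriv_of_eq_eval hP _
  · have hc : Continuous (fun x : ℝ => ((Real.exp (-lam * x) : ℝ) : ℂ) * Q.eval (x : ℂ)) :=
      (Complex.continuous_ofReal.comp (by fun_prop)).mul (continuous_eval_ofReal Q)
    have := (hc.tendsto 0).mono_left (nhdsWithin_le_nhds (s := Ioi 0))
    simpa [hQ0] using this

end GLF

end TemperedLaguerre

/-! ### Laguerre coefficients of all tempered derivatives and the resulting series for the norms. -/

namespace TemperedLaguerre

open Polynomial

section Coefficients

variable {ν lam : ℝ}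

lemma unweight_ae_eq {a : ℝ} {g₁ g₂ : ℝ → ℂ}
    (h : ∀ᵐ x ∂(volume.restrict (Ioi (0 : ℝ))), g₁ x = g₂ x) :
    unweight a g₁ =ᵐ[volume.restrict (Ioi 0)] unweight a g₂ := by
  filter_upwards [h] with x hx
  rw [unweight, unweight, hx]

lemma HasTemperedDeriv.ae_eq {μ : ℝ} {u g₁ g₂ : ℝ → ℂ} (h₁ : HasTemperedDeriv μ lam u g₁)
    (h₂ : HasTemperedDeriv μ lam u g₂) : ∀ᵐ x ∂(volume.restrict (Ioi (0 : ℝ))), g₁ x = g₂ x := by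
  filter_upwards [h₁.2.ae_eq h₂.2] with x hx
  exact smul_right_injective ℂ (Real.exp_pos (lam * x)).ne' hx

lemma hasTemperedDeriv_temperedDeriv {μ : ℝ} {u g : ℝ → ℂ} (h : HasTemperedDeriv μ lam u g) :
    HasTemperedDeriv μ lam u (temperedDeriv μ lam u) := by
  have hex : ∃ g, HasTemperedDeriv μ lam u g := ⟨g, h⟩
  rw [temperedDeriv, dif_pos hex]
  exact hex.choose_spec

/-- Weak derivatives are unique almost everywhere, so square integrability passes from any witness
to the chosen representative. -/
lemma MemA.temperedDeriv_spec {m : ℕ} {u : ℝ → ℂ} (hu : MemA ν lam m u) {k : ℕ} (hk : k ≤ m) :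
    HasTemperedDeriv (ν + k) lam u (temperedDeriv (ν + k) lam u) ∧
      MemWeightedL2 k (temperedDeriv (ν + k) lam u) := by
  obtain ⟨g, h1, h2⟩ := hu.2 k hk
  have h3 := hasTemperedDeriv_temperedDeriv h1
  refine ⟨h3, ?_⟩
  rw [memWeightedL2_iff] at h2 ⊢
  exact h2.ae_eq (unweight_ae_eq (h1.ae_eq h3))

/-- The Laguerre coefficients of the tempered derivatives. -/
theorem MemA.polyCoeff_temperedDeriv (hν : 0 < ν) (hlam : 0 < lam) {m : ℕ} {u : ℝ → ℂ}
    (hu : MemA ν lam m u) (hIC : HomogeneousInitial ν lam u) {k : ℕ} (hk : k ≤ m) (j : ℕ) :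
    polyCoeff lam k (unweight k (temperedDeriv (ν + k) lam u)) (lag (2 * lam) j k) =
      (((-1) ^ k * (((j + k).factorial : ℝ) / j.factorial) * (2 * lam) ^ ν : ℝ) : ℂ) *
        polyCoeff lam ν (unweight (-ν) u) (lag (2 * lam) (j + k) ν) := by
  induction k generalizing j with
  | zero =>
    have h := hu.temperedDeriv_spec hk
    rw [polyCoeff_lag_tempered hν hlam hu.1 hIC h.1 h.2]
    have : (j.factorial : ℝ) ≠ 0 := by positivity
    simp [this]
  | succ k ih =>
    have h1 := hu.temperedDeriv_spec (Nat.le_of_succ_le hk)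
    have h2 := hu.temperedDeriv_spec hk
    have h3 := ((hasTemperedDeriv_add_natCast_iff hν k _).1 h1.1).2
    have h4 := ((hasTemperedDeriv_add_natCast_iff hν (k + 1) _).1 h2.1).2
    rw [polyCoeff_lag_succ hlam (HasWeakDeriv.of_succ h3 h4) h1.2 h2.2, ih (Nat.le_of_succ_le hk),
      show j + 1 + k = j + (k + 1) by ring, ← mul_assoc]
    congr 1
    rw [Nat.factorial_succ j]
    have h5 : (j.factorial : ℝ) ≠ 0 := by positivity
    have h6 : (j : ℝ) + 1 ≠ 0 := by positivity
    rw [show (-((j : ℂ) + 1)) = ((-((j : ℝ) + 1) : ℝ) : ℂ) by push_cast; rfl, ← Complex.ofReal_mul]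
    congr 1
    push_cast
    field_simp
    ring

/-- The squared Laguerre coefficients of `u`, suitably normalized. -/
noncomputable def lagWeight (ν lam : ℝ) (u : ℝ → ℂ) (n : ℕ) : ℝ :=
  (2 * lam) ^ (2 * ν + 1) * n.factorial *
    ‖polyCoeff lam ν (unweight (-ν) u) (lag (2 * lam) n ν)‖ ^ 2

lemma lagWeight_nonneg (hlam : 0 < lam) (u : ℝ → ℂ) (n : ℕ) : 0 ≤ lagWeight ν lam u n := by
  unfold lagWeight
  positivity

lemma hasSum_lagWeight (hν : 0 < ν) (hlam : 0 < lam) {u : ℝ → ℂ} (hu : MemWeightedL2 (-ν) u) :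
    HasSum (fun n => (2 * lam) ^ (-ν) * (lagWeight ν lam u n / Real.Gamma (ν + n + 1)))
      (weightedNorm (-ν) u ^ 2) := by
  have h := hasSum_sq_polyCoeff_lag hlam (show -1 < ν by linarith) (memWeightedL2_iff.1 hu)
  rw [weightedNorm_eq]
  refine h.congr_fun fun n => ?_
  have hb : 0 < 2 * lam := by positivity
  have hn : (0 : ℝ) ≤ n := n.cast_nonneg
  have hΓ := Real.Gamma_pos_of_pos (show 0 < ν + n + 1 by linarith)
  have hf : (n.factorial : ℝ) ≠ 0 := by positivity
  have h1 : (2 * lam) ^ (-ν) * (2 * lam) ^ (2 * ν + 1) * (2 * lam) ^ (-(ν + 1)) = 1 := by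
    rw [← Real.rpow_add hb, ← Real.rpow_add hb]; ring_nf; simp
  have h2 := (Real.rpow_pos_of_pos hb (-(ν + 1))).ne'
  rw [lagWeight, lagNormSq]
  field_simp
  linear_combination (‖polyCoeff lam ν (unweight (-ν) u) (lag (2 * lam) n ν)‖ ^ 2) * h1

/-- The squared coefficient carries ((j+k)!/j!)² and the squared norm of L_j^(k) carries (j+k)!/j!.
The quotient leaves (j+k)!/j!, whose numerator is absorbed in `lagWeight`; the series for different
k then differ only by a shift, a factorial and a power of 2 lam. -/
lemma hasSum_lagWeight_temperedDeriv (hν : 0 < ν) (hlam : 0 < lam) {m : ℕ} {u : ℝ → ℂ}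
    (hu : MemA ν lam m u) (hIC : HomogeneousInitial ν lam u) {k : ℕ} (hk : k ≤ m) :
    HasSum (fun j : ℕ => (2 * lam) ^ (k : ℝ) * (lagWeight ν lam u (j + k) / j.factorial))
      (weightedNorm k (temperedDeriv (ν + k) lam u) ^ 2) := by
  have hk0 : (0 : ℝ) ≤ k := k.cast_nonneg
  have h := hasSum_sq_polyCoeff_lag hlam (show -1 < (k : ℝ) by linarith)
    (memWeightedL2_iff.1 (hu.temperedDeriv_spec hk).2)
  rw [weightedNorm_eq]
  refine h.congr_fun fun j => ?_
  have hb : 0 < 2 * lam := by positivity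
  rw [hu.polyCoeff_temperedDeriv hν hlam hIC hk, norm_mul, mul_pow, Complex.norm_real, Real.norm_eq_abs,
    sq_abs, lagWeight, lagNormSq]
  have hΓ : Real.Gamma ((k : ℝ) + j + 1) = (j + k).factorial := by
    rw [show (k : ℝ) + j + 1 = ((j + k : ℕ) : ℝ) + 1 by push_cast; ring, Real.Gamma_nat_eq_factorial]
  rw [hΓ]
  have hf : (j.factorial : ℝ) ≠ 0 := by positivity
  have hf' : ((j + k).factorial : ℝ) ≠ 0 := by positivity
  have h1 : (2 * lam) ^ (k : ℝ) * (2 * lam) ^ (2 * ν + 1) * (2 * lam) ^ (-((k : ℝ) + 1)) =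
      (2 * lam) ^ ν * (2 * lam) ^ ν := by
    rw [← Real.rpow_add hb, ← Real.rpow_add hb, ← Real.rpow_add hb]; ring_nf
  have h2 := (Real.rpow_pos_of_pos hb (-((k : ℝ) + 1))).ne'
  have h3 : ((-1 : ℝ) ^ k) ^ 2 = 1 := by rw [← pow_mul, mul_comm, pow_mul]; simp
  rw [mul_pow, mul_pow, h3, one_mul]
  field_simp
  linear_combination (‖polyCoeff lam ν (unweight (-ν) u) (lag (2 * lam) (j + k) ν)‖ ^ 2) * h1

end Coefficients

/-! ### Term by term comparison of series, and the limits of the constants. -/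

section Comparison

/-- The shifts d and d' differ because the same Laguerre coefficient sits at different positions in
the two series. -/
lemma le_mul_of_hasSum_tail {x y : ℕ → ℝ} {S T c : ℝ} {d d' : ℕ} (hx : HasSum x S) (hy : HasSum y T)
    (hy0 : ∀ n, 0 ≤ y n) (hx0 : ∀ n < d, x n = 0) (hc : 0 ≤ c)
    (h : ∀ i, x (i + d) ≤ c * y (i + d')) : S ≤ c * T := by
  have h1 := (hasSum_nat_add_iff' d).2 hx
  have h2 := (hasSum_nat_add_iff' d').2 hy
  rw [Finset.sum_eq_zero fun i hi => hx0 i (Finset.mem_range.1 hi), sub_zero] at h1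
  refine (hasSum_le h h1 (h2.mul_left c)).trans ?_
  gcongr
  exact sub_le_self _ (Finset.sum_nonneg fun i _ => hy0 i)

/-- Each step multiplies the quotient by (n+i+1)/(z+i) ≤ 1. Hence the worst ratio in a tail is at
its first index. -/
lemma factorial_div_Gamma_add_le {n : ℕ} {z : ℝ} (hz : (n : ℝ) + 1 ≤ z) (i : ℕ) :
    ((n + i).factorial : ℝ) / Real.Gamma (z + i) ≤ n.factorial / Real.Gamma z := by
  have hn : (0 : ℝ) ≤ n := n.cast_nonneg
  induction i with
  | zero => simp
  | succ i ih =>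
    refine le_trans ?_ ih
    have hi : (0 : ℝ) ≤ i := i.cast_nonneg
    have hzi : 0 < z + i := by linarith
    have hΓ := Real.Gamma_pos_of_pos hzi
    push_cast
    rw [← add_assoc, ← add_assoc, Real.Gamma_add_one hzi.ne', Nat.factorial_succ]
    push_cast
    rw [div_le_div_iff₀ (by positivity) hΓ]
    have h1 : (n : ℝ) + i + 1 ≤ z + i := by linarith
    calc ((n : ℝ) + i + 1) * (n + i).factorial * Real.Gamma (z + i)
        ≤ (z + i) * (n + i).factorial * Real.Gamma (z + i) := by gcongr
      _ = _ := by ring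

end Comparison

section Constants

/-- The constant of the error estimate for the function itself, squared. -/
noncomputable def projConstSq (ν : ℝ) (m N : ℕ) : ℝ :=
  (N : ℝ) ^ (ν + m) * ((N + 1 - m).factorial / Real.Gamma (ν + N + 2))

/-- The constant of the error estimate. -/
noncomputable def projConst (ν : ℝ) (m N : ℕ) : ℝ :=
  max (Real.sqrt (projConstSq ν m N)) (max 1 ((N : ℝ) / (N + 2 - m)) ^ m)

lemma tendsto_natCast_add_div_natCast_add (a b : ℝ) :
    Tendsto (fun N : ℕ => ((N : ℝ) + a) / (N + b)) atTop (𝓝 1) := by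
  have h1 : Tendsto (fun N : ℕ => (N : ℝ) + b) atTop atTop :=
    tendsto_atTop_add_const_right _ _ tendsto_natCast_atTop_atTop
  have h2 : Tendsto (fun N : ℕ => 1 + (a - b) / ((N : ℝ) + b)) atTop (𝓝 (1 + 0)) :=
    tendsto_const_nhds.add (h1.const_div_atTop _)
  rw [add_zero] at h2
  refine h2.congr' ?_
  filter_upwards [h1.eventually_gt_atTop 0] with N hN
  field_simp
  ring

/-- Euler's limit formula for Γ, with the product s(s+1)...(s+n) rewritten as Γ(s+n+1)/Γ(s). -/
lemma tendsto_rpow_mul_factorial_div_Gamma {s : ℝ} (hs : 0 < s) :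
    Tendsto (fun n : ℕ => (n : ℝ) ^ s * n.factorial / Real.Gamma (s + n + 1)) atTop (𝓝 1) := by
  have hΓ := (Real.Gamma_pos_of_pos hs).ne'
  have h := (Real.GammaSeq_tendsto_Gamma s).div_const (Real.Gamma s)
  rw [div_self hΓ] at h
  refine h.congr fun n => ?_
  have h1 : ∀ n : ℕ, Real.Gamma (s + n) = (∏ j ∈ Finset.range n, (s + j)) * Real.Gamma s := by
    intro n
    induction n with
    | zero => simp
    | succ n ih =>
      have : (0 : ℝ) ≤ n := n.cast_nonneg
      push_cast
      rw [← add_assoc, Real.Gamma_add_one (by linarith), ih, Finset.prod_range_succ]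
      ring
  have h2 := h1 (n + 1)
  push_cast at h2
  rw [← add_assoc] at h2
  rw [Real.GammaSeq, h2, div_div]

lemma tendsto_pow_mul_factorial_div_factorial (m : ℕ) :
    Tendsto (fun N : ℕ => (N : ℝ) ^ m * (N + 1 - m).factorial / (N + 1).factorial) atTop (𝓝 1) := by
  induction m with
  | zero =>
    refine tendsto_const_nhds.congr fun N => ?_
    have : ((N + 1).factorial : ℝ) ≠ 0 := by positivity
    simp [this]
  | succ m ih =>
    have h := ih.mul (tendsto_natCast_add_div_natCast_add 0 (1 - m))
    rw [one_mul] at h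
    refine h.congr' ?_
    filter_upwards [eventually_ge_atTop m] with N hN
    obtain ⟨d, rfl⟩ := Nat.exists_eq_add_of_le hN
    rw [show m + d + 1 - m = d + 1 by omega, show m + d + 1 - (m + 1) = d by omega,
      Nat.factorial_succ d]
    have h1 : ((m + d : ℕ) : ℝ) + (1 - m) = d + 1 := by push_cast; ring
    have h2 : (d : ℝ) + 1 ≠ 0 := by positivity
    rw [h1]
    push_cast
    field_simp
    ring

lemma tendsto_projConstSq {ν : ℝ} (hν : 0 < ν) (m : ℕ) :
    Tendsto (projConstSq ν m) atTop (𝓝 1) := by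
  have h := ((tendsto_rpow_mul_factorial_div_Gamma hν).mul (tendsto_pow_mul_factorial_div_factorial m)).mul
    (tendsto_natCast_add_div_natCast_add 1 (ν + 1))
  rw [mul_one, mul_one] at h
  refine h.congr' ?_
  filter_upwards [eventually_gt_atTop 0] with N hN
  have hN : (0 : ℝ) < N := by exact_mod_cast hN
  have hΓ := Real.Gamma_pos_of_pos (show 0 < ν + N + 1 by linarith)
  rw [projConstSq, show ν + (N : ℝ) + 2 = ν + N + 1 + 1 by ring,
    Real.Gamma_add_one (show ν + (N : ℝ) + 1 ≠ 0 by positivity),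
    Real.rpow_add hN, Real.rpow_natCast, Nat.factorial_succ, show (N : ℝ) + (ν + 1) = ν + N + 1 by ring]
  push_cast
  have h1 : (N : ℝ) + 1 ≠ 0 := by positivity
  have h2 : (N.factorial : ℝ) ≠ 0 := by positivity
  have h3 : ν + (N : ℝ) + 1 ≠ 0 := by positivity
  field_simp

lemma tendsto_projConst {ν : ℝ} (hν : 0 < ν) (m : ℕ) : Tendsto (projConst ν m) atTop (𝓝 1) := by
  have h1 := (tendsto_projConstSq hν m).sqrt
  have h2 := ((tendsto_const_nhds (x := (1 : ℝ))).max
    (tendsto_natCast_add_div_natCast_add 0 (2 - m))).pow m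
  have h3 := h1.max h2
  simp only [Real.sqrt_one, max_self, one_pow] at h3
  refine h3.congr fun N => ?_
  rw [projConst, add_zero, add_sub_assoc]

lemma projConst_pos (ν : ℝ) (m N : ℕ) : 0 < projConst ν m N :=
  lt_max_of_lt_right (pow_pos (lt_max_of_lt_left one_pos) m)

lemma projConstSq_le_sq {ν : ℝ} (m N : ℕ) : projConstSq ν m N ≤ projConst ν m N ^ 2 := by
  rcases le_or_gt 0 (projConstSq ν m N) with h | h
  · rw [← Real.sq_sqrt h]
    exact pow_le_pow_left₀ (Real.sqrt_nonneg _) (le_max_left _ _) 2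
  · exact h.le.trans (sq_nonneg _)

/-- The quotient (N+1-k)!/(N+1-m)! has m - k factors, each at least N + 2 - m, so the left side is
at most (N/(N+2-m))^{m-k}. The maximum with 1 in `projConst` allows the exponent m, uniformly in k.
-/
lemma pow_mul_factorial_div_le_projConst_sq (ν : ℝ) {m N k : ℕ} (hm : m ≤ N + 1) (hk : k ≤ m) :
    (N : ℝ) ^ (m - k) * ((N + 1 - m).factorial / (N + 1 - k).factorial) ≤ projConst ν m N ^ 2 := by
  obtain ⟨d, hd⟩ := Nat.exists_eq_add_of_le hm
  obtain ⟨e, rfl⟩ := Nat.exists_eq_add_of_le hk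
  set r : ℝ := max 1 ((N : ℝ) / (N + 2 - (k + e : ℕ))) with hr
  have hr1 : 1 ≤ r := le_max_left _ _
  have hd' : (N : ℝ) + 2 - (k + e : ℕ) = d + 1 := by
    have : (N : ℝ) + 1 = ((k + e : ℕ) : ℝ) + d := by exact_mod_cast hd
    linarith
  have h1 : (N : ℝ) ≤ r * (d + 1) := by
    rw [← div_le_iff₀ (by positivity), ← hd']
    exact le_max_right _ _
  rw [show N + 1 - (k + e) = d by omega, show N + 1 - k = d + e by omega, Nat.add_sub_cancel_left]
  have h2 : (d.factorial : ℝ) * (d + 1) ^ e ≤ (d + e).factorial := by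
    exact_mod_cast Nat.factorial_mul_pow_le_factorial
  have h3 : (N : ℝ) ^ e * (d.factorial / (d + e).factorial) ≤ r ^ e := by
    rw [← mul_div_assoc, div_le_iff₀ (by positivity)]
    calc (N : ℝ) ^ e * d.factorial ≤ (r * (d + 1)) ^ e * d.factorial := by gcongr
      _ = r ^ e * (d.factorial * (d + 1) ^ e) := by rw [mul_pow]; ring
      _ ≤ _ := by gcongr
  calc _ ≤ r ^ e := h3
    _ ≤ r ^ (k + e) := pow_le_pow_right₀ hr1 (by omega)
    _ ≤ projConst ν (k + e) N := le_max_right _ _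
    _ ≤ projConst ν (k + e) N ^ 2 := by
        refine le_self_pow₀ ?_ two_ne_zero
        exact (one_le_pow₀ hr1).trans (le_max_right _ _)

end Constants

end TemperedLaguerre

/-! ### The orthogonal projection and the error estimates. -/

namespace TemperedLaguerre

open Polynomial

variable {ν lam : ℝ}

section Projection

lemma unweight_sub (a : ℝ) (f g : ℝ → ℂ) :
    unweight a (fun x => f x - g x) = fun x => unweight a f x - unweight a g x := by
  ext x
  simp only [unweight, smul_sub]

lemma polyCoeff_sub {α : ℝ} (hlam : 0 < lam) (hα : -1 < α) {U V : ℝ → ℂ}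
    (hU : MemLp U 2 (volume.restrict (Ioi 0))) (hV : MemLp V 2 (volume.restrict (Ioi 0))) (p : ℝ[X]) :
    polyCoeff lam α (fun x => U x - V x) p = polyCoeff lam α U p - polyCoeff lam α V p := by
  simp only [polyCoeff, smul_sub]
  exact integral_sub (integrable_expPoly_smul hlam hα p hU) (integrable_expPoly_smul hlam hα p hV)

lemma sub_mem_glf (p q : ℂ[X]) : (fun x => glf ν lam p x - glf ν lam q x) = glf ν lam (p - q) := by
  ext x
  simp only [glf, eval_sub, mul_sub]

lemma conj_eval_ofReal {q : ℂ[X]} {N : ℕ} (hq : q.natDegree ≤ N) (x : ℝ) :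
    (starRingEnd ℂ) (q.eval (x : ℂ)) =
      ∑ j ∈ Finset.range (N + 1), (starRingEnd ℂ) (q.coeff j) * (x : ℂ) ^ j := by
  rw [eval_eq_sum_range' (Nat.lt_succ_of_le hq), map_sum]
  simp

/-- The weighted inner product with `x ^ ν e^{-lam x} q(x)`. -/
lemma weightedInner_glf (hν : 0 < ν) (hlam : 0 < lam) {f : ℝ → ℂ} (hf : MemWeightedL2 (-ν) f)
    {q : ℂ[X]} {N : ℕ} (hq : q.natDegree ≤ N) :
    weightedInner (-ν) f (glf ν lam q) = ∑ j ∈ Finset.range (N + 1),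
      (starRingEnd ℂ) (q.coeff j) * polyCoeff lam ν (unweight (-ν) f) (X ^ j) := by
  have hU := memWeightedL2_iff.1 hf
  rw [weightedInner, weightMeasure, integral_withDensity_eq_integral_toReal_smul (by fun_prop)
    (ae_of_all _ fun _ => ENNReal.ofReal_lt_top)]
  simp only [polyCoeff, ← integral_const_mul]
  rw [← integral_finsetSum _ fun j _ =>
    (integrable_expPoly_smul hlam (show -1 < ν by linarith) (X ^ j) hU).const_mul _]
  refine setIntegral_congr_fun measurableSet_Ioi fun x hx => ?_
  have hx : 0 < x := hx
  simp only [expPoly_smul_unweight_neg hx, eval_pow, eval_X, glf, map_mul, Complex.conj_ofReal,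
    conj_eval_ofReal hq]
  rw [ENNReal.toReal_ofReal (by positivity), Finset.mul_sum, Finset.mul_sum, Finset.smul_sum]
  refine Finset.sum_congr rfl fun j _ => ?_
  have h : ((x ^ (-ν) : ℝ) : ℂ) * ((x ^ ν : ℝ) : ℂ) = 1 := by
    rw [← Complex.ofReal_mul, ← Real.rpow_add hx]; simp
  simp only [Complex.real_smul]
  push_cast
  linear_combination (Complex.exp (-lam * x) * (starRingEnd ℂ) (q.coeff j) * x ^ j * f x) * h

/-- A polynomial vanishing almost everywhere on the half line has infinitely many roots. -/
lemma eq_zero_of_weightedInner_self_eq_zero (hν : 0 < ν) (hlam : 0 < lam) {q : ℂ[X]}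
    (h : weightedInner (-ν) (glf ν lam q) (glf ν lam q) = 0) : q = 0 := by
  have hU := memWeightedL2_iff.1 (memWeightedL2_glf hν hlam q)
  have h1 : weightedInner (-ν) (glf ν lam q) (glf ν lam q) =
      ((∫ x in Ioi (0 : ℝ), ‖unweight (-ν) (glf ν lam q) x‖ ^ 2 : ℝ) : ℂ) := by
    rw [weightedInner, weightMeasure, integral_withDensity_eq_integral_toReal_smul (by fun_prop)
      (ae_of_all _ fun _ => ENNReal.ofReal_lt_top), ← integral_complex_ofReal]
    refine setIntegral_congr_fun measurableSet_Ioi fun x hx => ?_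
    have hx : 0 < x := hx
    have h2 : (x ^ (-ν / 2)) ^ 2 = x ^ (-ν) := by
      rw [← Real.rpow_natCast, ← Real.rpow_mul hx.le]; norm_num
    rw [ENNReal.toReal_ofReal (by positivity), Complex.mul_conj, Complex.normSq_eq_norm_sq, unweight,
      norm_smul, mul_pow, Real.norm_of_nonneg (by positivity), h2, Complex.real_smul]
    push_cast
    ring
  rw [h1, Complex.ofReal_eq_zero,
    integral_eq_zero_iff_of_nonneg (fun _ => by positivity)
      ((memLp_two_iff_integrable_sq_norm hU.1).1 hU)] at h
  have h3 : ∀ᵐ x : ℝ ∂(volume.restrict (Ioi (0 : ℝ))), q.eval (x : ℂ) = 0 := by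
    filter_upwards [h, ae_restrict_mem measurableSet_Ioi] with x hx hx0
    have hx0 : 0 < x := hx0
    have h4 : unweight (-ν) (glf ν lam q) x = 0 := by simpa using hx
    rw [unweight_neg_glf hx0, mul_eq_zero] at h4
    refine h4.resolve_left ?_
    exact_mod_cast (by positivity : x ^ (ν / 2) * Real.exp (-lam * x) ≠ 0)
  by_contra hq
  have hfin : {x : ℝ | q.eval (x : ℂ) = 0}.Finite := by
    have := (q.rootSet_finite ℂ).preimage (f := fun x : ℝ => (x : ℂ)) Complex.ofReal_injective.injOn
    refine this.subset fun x hx => ?_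
    simpa [mem_rootSet, hq] using hx
  have h5 : (volume.restrict (Ioi (0 : ℝ))) {x : ℝ | q.eval (x : ℂ) = 0} = 0 :=
    Measure.absolutelyContinuous_of_le Measure.restrict_le_self (hfin.measure_zero _)
  have h6 : (volume.restrict (Ioi (0 : ℝ))) univ = 0 := by
    rw [← union_compl_self {x : ℝ | q.eval (x : ℂ) = 0}]
    exact measure_union_null h5 h3
  simp at h6

/-- Monomials and Laguerre polynomials are related by an invertible triangular change of basis, so
orthogonality to the whole space means that the first N + 1 Laguerre coefficients of the error
vanish. -/
lemma isProjection_glf_iff (hν : 0 < ν) (hlam : 0 < lam) {N : ℕ} {u : ℝ → ℂ}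
    (hu : MemWeightedL2 (-ν) u) {p : ℂ[X]} (hp : p.natDegree ≤ N) :
    IsProjection ν lam N u (glf ν lam p) ↔ ∀ n ≤ N,
      polyCoeff lam ν (unweight (-ν) (fun x => glf ν lam p x - u x)) (lag (2 * lam) n ν) = 0 := by
  have hα : -1 < ν := by linarith
  have he : MemWeightedL2 (-ν) (fun x => glf ν lam p x - u x) :=
    MemLp.sub (memWeightedL2_glf hν hlam p) hu
  constructor
  · intro h n hn
    have hX : ∀ j ≤ N, polyCoeff lam ν (unweight (-ν) (fun x => glf ν lam p x - u x)) (X ^ j) = 0 := by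
      intro j hj
      have h1 := h.2 (glf ν lam (X ^ j)) ⟨X ^ j, by simpa using hj, rfl⟩
      rw [weightedInner_glf hν hlam he (N := N) (by simpa using hj)] at h1
      simpa [coeff_X_pow, Finset.sum_ite_eq, Nat.lt_succ_of_le hj] using h1
    rw [polyCoeff_eq_sum hlam hα (memWeightedL2_iff.1 he) (natDegree_lag_le _ n ν)]
    refine Finset.sum_eq_zero fun j hj => ?_
    rw [hX j ((Nat.lt_succ_iff.1 (Finset.mem_range.1 hj)).trans hn), mul_zero]
  · intro h
    refine ⟨⟨p, hp, rfl⟩, ?_⟩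
    rintro _ ⟨q, hq, rfl⟩
    refine (weightedInner_glf hν hlam he hq).trans (Finset.sum_eq_zero fun j hj => ?_)
    rw [polyCoeff_X_pow_eq_zero hlam hα (memWeightedL2_iff.1 he) h j
      (Nat.lt_succ_iff.1 (Finset.mem_range.1 hj)), mul_zero]

lemma IsProjection.exists_eq_glf {N : ℕ} {u w : ℝ → ℂ} (h : IsProjection ν lam N u w) :
    ∃ p : ℂ[X], p.natDegree ≤ N ∧ w = glf ν lam p := h.1

/-- Stated for arbitrary real polynomials r_i, since Laguerre polynomials are needed to build the
projection and monomials to see that its coefficients above N vanish. -/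
lemma polyCoeff_glf_lag (hν : 0 < ν) (hlam : 0 < lam) {ι : Type*} (s : Finset ι) (a : ι → ℂ)
    (r : ι → ℝ[X]) (q : ℝ[X]) :
    polyCoeff lam ν (unweight (-ν) (glf ν lam (∑ i ∈ s, C (a i) * (r i).map Complex.ofRealHom))) q =
      ∑ i ∈ s, a i * gammaInt (2 * lam) ν (q * r i) := by
  have h : ∀ i, ((gammaInt (2 * lam) ν (q * r i) : ℝ) : ℂ) = ∫ x in Ioi (0 : ℝ),
      ((expPoly lam ν q x * expPoly lam ν (r i) x : ℝ) : ℂ) := fun i => by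
    rw [integral_complex_ofReal, integral_expPoly_mul_expPoly]
  simp only [h, polyCoeff, ← integral_const_mul]
  have hi : ∀ i, IntegrableOn (fun x => ((expPoly lam ν q x * expPoly lam ν (r i) x : ℝ) : ℂ)) (Ioi 0) :=
    fun i => ((memLp_expPoly hlam (by linarith) q).integrable_mul
      (memLp_expPoly hlam (by linarith) (r i))).ofReal
  rw [← integral_finsetSum _ fun i _ => (hi i).const_mul (a i)]
  refine setIntegral_congr_fun measurableSet_Ioi fun x hx => ?_
  simp only [unweight_neg_glf hx, eval_finsetSum, eval_mul, eval_C, expPoly, Finset.mul_sum,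
    Complex.real_smul]
  refine Finset.sum_congr rfl fun i _ => ?_
  have : ((r i).map Complex.ofRealHom).eval (x : ℂ) = (((r i).eval x : ℝ) : ℂ) := by
    rw [eval_map]
    exact eval₂_at_apply Complex.ofRealHom x
  rw [this]
  push_cast
  ring

/-- The orthogonal projection exists. -/
lemma exists_isProjection (hν : 0 < ν) (hlam : 0 < lam) (N : ℕ) {u : ℝ → ℂ}
    (hu : MemWeightedL2 (-ν) u) : ∃ w, IsProjection ν lam N u w := by
  have hα : -1 < ν := by linarith
  have hb : 0 < 2 * lam := by positivity
  set a : ℕ → ℂ := fun n => polyCoeff lam ν (unweight (-ν) u) (lag (2 * lam) n ν) /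
    (lagNormSq (2 * lam) n ν : ℝ) with ha
  set p : ℂ[X] := ∑ n ∈ Finset.range (N + 1), C (a n) * (lag (2 * lam) n ν).map Complex.ofRealHom with hp
  refine ⟨glf ν lam p, (isProjection_glf_iff hν hlam hu ?_).2 ?_⟩
  · refine natDegree_sum_le_of_forall_le _ _ fun n hn => ?_
    refine (natDegree_C_mul_le _ _).trans (natDegree_map_le.trans ((natDegree_lag_le _ n ν).trans ?_))
    exact Nat.lt_succ_iff.1 (Finset.mem_range.1 hn)
  · intro n hn
    rw [unweight_sub, polyCoeff_sub hlam hα (memWeightedL2_iff.1 (memWeightedL2_glf hν hlam p))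
      (memWeightedL2_iff.1 hu), hp, polyCoeff_glf_lag hν hlam,
      Finset.sum_eq_single_of_mem n (Finset.mem_range.2 (Nat.lt_succ_of_le hn)),
      gammaInt_lag_mul_self hb n hα, sub_eq_zero, ha]
    · have : ((lagNormSq (2 * lam) n ν : ℝ) : ℂ) ≠ 0 := by exact_mod_cast (lagNormSq_pos hb hα n).ne'
      exact div_mul_cancel₀ _ this
    · intro j _ hj
      rw [gammaInt_lag_mul_lag_of_ne hb hα hj.symm]
      simp

/-- The orthogonal projection is unique. -/
lemma IsProjection.unique (hν : 0 < ν) (hlam : 0 < lam) {N : ℕ} {u w₁ w₂ : ℝ → ℂ}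
    (hu : MemWeightedL2 (-ν) u) (h₁ : IsProjection ν lam N u w₁) (h₂ : IsProjection ν lam N u w₂) :
    w₁ = w₂ := by
  obtain ⟨p, hp, rfl⟩ := h₁.exists_eq_glf
  obtain ⟨q, hq, rfl⟩ := h₂.exists_eq_glf
  have hα : -1 < ν := by linarith
  have mem : ∀ r, MemLp (unweight (-ν) (glf ν lam r)) 2 (volume.restrict (Ioi 0)) := fun r =>
    memWeightedL2_iff.1 (memWeightedL2_glf hν hlam r)
  have hU := memWeightedL2_iff.1 hu
  have e₁ := (isProjection_glf_iff hν hlam hu hp).1 h₁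
  have e₂ := (isProjection_glf_iff hν hlam hu hq).1 h₂
  have e₃ : ∀ n ≤ N, polyCoeff lam ν (unweight (-ν) (glf ν lam (p - q))) (lag (2 * lam) n ν) = 0 := by
    intro n hn
    have a₁ := e₁ n hn
    have a₂ := e₂ n hn
    rw [unweight_sub, polyCoeff_sub hlam hα (mem _) hU] at a₁ a₂
    rw [← sub_mem_glf, unweight_sub, polyCoeff_sub hlam hα (mem _) (mem _)]
    linear_combination a₁ - a₂
  have hpq : (p - q).natDegree ≤ N := (natDegree_sub_le_of_le hp hq).trans (max_self N).le
  -- The difference lies in the space and is orthogonal to it, so p - q is the zero polynomial. The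
  -- two projections therefore agree at every point, not only almost everywhere.
  have h0 : weightedInner (-ν) (glf ν lam (p - q)) (glf ν lam (p - q)) = 0 := by
    rw [weightedInner_glf hν hlam (memWeightedL2_glf hν hlam _) hpq]
    refine Finset.sum_eq_zero fun j hj => ?_
    rw [polyCoeff_X_pow_eq_zero hlam hα (mem _) e₃ j (Nat.lt_succ_iff.1 (Finset.mem_range.1 hj)), mul_zero]
  rw [sub_eq_zero.1 (eq_zero_of_weightedInner_self_eq_zero hν hlam h0)]

end Projection

section Estimates

/-- Here κ is the worst ratio of series weights; the factor N^{-θ} is inserted by hand and N^θ κ is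
what the constant controls. -/
lemma le_mul_rpow_mul_of_sq_le {A D c κ b θ : ℝ} {N : ℕ} (hD : 0 ≤ D) (hc : 0 < c)
    (hb : 0 < b) (hN : 1 ≤ N) (h : A ^ 2 ≤ b ^ (-θ) * κ * D ^ 2) (hκ : (N : ℝ) ^ θ * κ ≤ c ^ 2) :
    A ≤ c * (b * N) ^ (-θ / 2) * D := by
  have hN : (0 : ℝ) < N := by exact_mod_cast hN
  refine le_of_abs_le (abs_le_of_sq_le_sq ?_ (by positivity))
  have h1 : ((b * N) ^ (-θ / 2)) ^ 2 = b ^ (-θ) * (N : ℝ) ^ (-θ) := by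
    rw [← Real.rpow_natCast, ← Real.rpow_mul (by positivity), Real.mul_rpow hb.le hN.le]
    norm_num
  have h2 : (N : ℝ) ^ (-θ) * (N : ℝ) ^ θ = 1 := by rw [← Real.rpow_add hN]; simp
  calc A ^ 2 ≤ b ^ (-θ) * κ * D ^ 2 := h
    _ = b ^ (-θ) * (N : ℝ) ^ (-θ) * ((N : ℝ) ^ θ * κ) * D ^ 2 := by
        linear_combination (-b ^ (-θ) * κ * D ^ 2) * h2
    _ ≤ b ^ (-θ) * (N : ℝ) ^ (-θ) * c ^ 2 * D ^ 2 := by gcongr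
    _ = _ := by rw [mul_pow, mul_pow, h1]; ring

variable {m N : ℕ} {u w : ℝ → ℂ}

lemma IsProjection.lagWeight_eq_zero (hν : 0 < ν) (hlam : 0 < lam) (hu : MemWeightedL2 (-ν) u)
    (hw : IsProjection ν lam N u w) {n : ℕ} (hn : n ≤ N) :
    lagWeight ν lam (fun x => w x - u x) n = 0 := by
  obtain ⟨p, hp, rfl⟩ := hw.exists_eq_glf
  rw [lagWeight, (isProjection_glf_iff hν hlam hu hp).1 hw n hn]
  simp

lemma polyCoeff_glf_lag_eq_zero (hν : 0 < ν) (hlam : 0 < lam) {p : ℂ[X]} (hp : p.natDegree ≤ N)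
    {n : ℕ} (hn : N < n) : polyCoeff lam ν (unweight (-ν) (glf ν lam p)) (lag (2 * lam) n ν) = 0 := by
  have h : p = ∑ j ∈ Finset.range (N + 1), C (p.coeff j) * ((X ^ j : ℝ[X]).map Complex.ofRealHom) := by
    conv_lhs => rw [p.as_sum_range_C_mul_X_pow' (Nat.lt_succ_of_le hp)]
    simp
  rw [h, polyCoeff_glf_lag hν hlam]
  refine Finset.sum_eq_zero fun j hj => ?_
  rw [gammaInt_lag_mul_eq_zero (by positivity) n (by linarith) _ (iterate_derivative_eq_zero ?_)]
  · simp
  · rw [natDegree_X_pow]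
    have := Finset.mem_range.1 hj
    omega

lemma IsProjection.lagWeight_eq (hν : 0 < ν) (hlam : 0 < lam) (hu : MemWeightedL2 (-ν) u)
    (hw : IsProjection ν lam N u w) {n : ℕ} (hn : N < n) :
    lagWeight ν lam (fun x => w x - u x) n = lagWeight ν lam u n := by
  obtain ⟨p, hp, rfl⟩ := hw.exists_eq_glf
  rw [lagWeight, unweight_sub, polyCoeff_sub hlam (by linarith)
    (memWeightedL2_iff.1 (memWeightedL2_glf hν hlam p)) (memWeightedL2_iff.1 hu),
    polyCoeff_glf_lag_eq_zero hν hlam hp hn, zero_sub, norm_neg, lagWeight]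

lemma weightedNorm_nonneg (a : ℝ) (u : ℝ → ℂ) : 0 ≤ weightedNorm a u := ENNReal.toReal_nonneg

/-- The projection error in the weighted norm of the function. -/
theorem IsProjection.weightedNorm_le (hν : 0 < ν) (hlam : 0 < lam) (hN : 1 ≤ N) (hm : m ≤ N + 1)
    (hu : MemA ν lam m u) (hIC : HomogeneousInitial ν lam u) (hw : IsProjection ν lam N u w) :
    weightedNorm (-ν) (fun x => w x - u x) ≤
      projConst ν m N * (2 * lam * N) ^ (-(ν + m) / 2) *
        weightedNorm m (temperedDeriv (ν + m) lam u) := by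
  have hb : 0 < 2 * lam := by positivity
  have he : MemWeightedL2 (-ν) (fun x => w x - u x) := by
    obtain ⟨p, -, rfl⟩ := hw.exists_eq_glf
    exact MemLp.sub (memWeightedL2_glf hν hlam p) hu.1
  have hN0 : (0 : ℝ) ≤ N := N.cast_nonneg
  have hΓ := Real.Gamma_pos_of_pos (show 0 < ν + N + 2 by linarith)
  refine le_mul_rpow_mul_of_sq_le (weightedNorm_nonneg _ _) (projConst_pos ν m N) hb hN ?_
    (projConstSq_le_sq m N)
  -- The error starts at coefficient N + 1. In the series of the derivative of order ν + m this
  -- coefficient has index N + 1 - m, which is not truncated because m ≤ N + 1.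
  refine le_mul_of_hasSum_tail (d := N + 1) (d' := N + 1 - m) (hasSum_lagWeight hν hlam he)
    (hasSum_lagWeight_temperedDeriv hν hlam hu hIC le_rfl) (fun n => ?_) (fun n hn => ?_)
    (by positivity) (fun i => ?_)
  · have := lagWeight_nonneg (ν := ν) hlam u (n + m)
    positivity
  · rw [hw.lagWeight_eq_zero hν hlam hu.1 (Nat.lt_succ_iff.1 hn)]
    simp
  · rw [hw.lagWeight_eq hν hlam hu.1 (by omega), show i + (N + 1 - m) + m = i + (N + 1) by omega]
    set W := lagWeight ν lam u (i + (N + 1))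
    have hW : 0 ≤ W := lagWeight_nonneg hlam u _
    have hz : ((N + 1 - m : ℕ) : ℝ) + 1 ≤ ν + N + 2 := by
      have : ((N + 1 - m : ℕ) : ℝ) ≤ ((N + 1 : ℕ) : ℝ) := by exact_mod_cast Nat.sub_le _ _
      push_cast at this
      linarith
    have h1 := factorial_div_Gamma_add_le hz i
    have h2 : ν + ((i + (N + 1) : ℕ) : ℝ) + 1 = ν + N + 2 + i := by push_cast; ring
    have h3 : (2 * lam) ^ (-(ν + m)) * (2 * lam) ^ (m : ℝ) = (2 * lam) ^ (-ν) := by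
      rw [← Real.rpow_add hb]; ring_nf
    rw [h2, add_comm i (N + 1 - m), ← h3]
    have hf : ((N + 1 - m + i).factorial : ℝ) ≠ 0 := by positivity
    calc (2 * lam) ^ (-(ν + m)) * (2 * lam) ^ (m : ℝ) * (W / Real.Gamma (ν + N + 2 + i))
        = (2 * lam) ^ (-(ν + m)) * (2 * lam) ^ (m : ℝ) * (W / (N + 1 - m + i).factorial) *
          ((N + 1 - m + i).factorial / Real.Gamma (ν + N + 2 + i)) := by field_simp
      _ ≤ (2 * lam) ^ (-(ν + m)) * (2 * lam) ^ (m : ℝ) * (W / (N + 1 - m + i).factorial) *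
          ((N + 1 - m).factorial / Real.Gamma (ν + N + 2)) := by gcongr
      _ = _ := by ring

/-- The projection error in the weighted norms of the tempered derivatives. -/
theorem IsProjection.weightedNorm_temperedDeriv_le (hν : 0 < ν) (hlam : 0 < lam) (hN : 1 ≤ N)
    (hm : m ≤ N + 1) (hu : MemA ν lam m u) (hIC : HomogeneousInitial ν lam u)
    (hw : IsProjection ν lam N u w) {k : ℕ} (hk : k ≤ m) :
    weightedNorm k (temperedDeriv (ν + k) lam (fun x => w x - u x)) ≤
      projConst ν m N * (2 * lam * N) ^ (((k : ℝ) - m) / 2) *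
        weightedNorm m (temperedDeriv (ν + m) lam u) := by
  have hb : 0 < 2 * lam := by positivity
  -- The coefficient formula is used for the error itself, so the error must inherit both the
  -- regularity and the initial conditions.
  obtain ⟨he, hie⟩ : MemA ν lam m (fun x => w x - u x) ∧
      HomogeneousInitial ν lam (fun x => w x - u x) := by
    obtain ⟨p, -, rfl⟩ := hw.exists_eq_glf
    exact ⟨(memA_glf hν hlam m p).sub hν hlam hu, (homogeneousInitial_glf hν hlam p).sub hν hlam
      (memWeightedL2_glf hν hlam p) hu.1 hIC⟩
  rw [show ((k : ℝ) - m) / 2 = -((m - k : ℕ) : ℝ) / 2 by rw [Nat.cast_sub hk]; ring]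
  refine le_mul_rpow_mul_of_sq_le (weightedNorm_nonneg _ _) (projConst_pos ν m N) hb hN
    (κ := (N + 1 - m).factorial / (N + 1 - k).factorial) ?_
    (by rw [Real.rpow_natCast]; exact pow_mul_factorial_div_le_projConst_sq ν hm hk)
  refine le_mul_of_hasSum_tail (d := N + 1 - k) (d' := N + 1 - m)
    (hasSum_lagWeight_temperedDeriv hν hlam he hie hk)
    (hasSum_lagWeight_temperedDeriv hν hlam hu hIC le_rfl) (fun n => ?_) (fun n hn => ?_)
    (by positivity) (fun i => ?_)
  · have := lagWeight_nonneg (ν := ν) hlam u (n + m)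
    positivity
  · rw [hw.lagWeight_eq_zero hν hlam hu.1 (by omega)]
    simp
  · rw [hw.lagWeight_eq hν hlam hu.1 (by omega), show i + (N + 1 - m) + m = i + (N + 1) by omega,
      show i + (N + 1 - k) + k = i + (N + 1) by omega]
    set W := lagWeight ν lam u (i + (N + 1))
    have hW : 0 ≤ W := lagWeight_nonneg hlam u _
    have hz : ((N + 1 - m : ℕ) : ℝ) + 1 ≤ ((N + 1 - k : ℕ) : ℝ) + 1 := by
      have : ((N + 1 - m : ℕ) : ℝ) ≤ ((N + 1 - k : ℕ) : ℝ) := by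
        exact_mod_cast Nat.sub_le_sub_left hk _
      linarith
    have h1 := factorial_div_Gamma_add_le hz i
    rw [show ((N + 1 - k : ℕ) : ℝ) + 1 + i = ((N + 1 - k + i : ℕ) : ℝ) + 1 by push_cast; ring,
      Real.Gamma_nat_eq_factorial, Real.Gamma_nat_eq_factorial] at h1
    have h3 : (2 * lam) ^ (-((m - k : ℕ) : ℝ)) * (2 * lam) ^ (m : ℝ) = (2 * lam) ^ (k : ℝ) := by
      rw [← Real.rpow_add hb, Nat.cast_sub hk]; ring_nf
    rw [add_comm i (N + 1 - m), add_comm i (N + 1 - k), ← h3]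
    have hf : ((N + 1 - m + i).factorial : ℝ) ≠ 0 := by positivity
    calc (2 * lam) ^ (-((m - k : ℕ) : ℝ)) * (2 * lam) ^ (m : ℝ) * (W / (N + 1 - k + i).factorial)
        = (2 * lam) ^ (-((m - k : ℕ) : ℝ)) * (2 * lam) ^ (m : ℝ) * (W / (N + 1 - m + i).factorial) *
          ((N + 1 - m + i).factorial / (N + 1 - k + i).factorial) := by field_simp
      _ ≤ (2 * lam) ^ (-((m - k : ℕ) : ℝ)) * (2 * lam) ^ (m : ℝ) * (W / (N + 1 - m + i).factorial) *
          ((N + 1 - m).factorial / (N + 1 - k).factorial) := by gcongr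
      _ = _ := by ring

end Estimates

end TemperedLaguerre

theorem mainTheorem3 (ν : ℝ) (hν : 0 < ν) (m : ℕ) :
    ∃ c : ℕ → ℝ, Tendsto c atTop (𝓝 1) ∧
      ∀ (lam : ℝ), 0 < lam → ∀ (N : ℕ), 1 ≤ N → m ≤ N + 1 →
        ∀ (u : ℝ → ℂ), TemperedLaguerre.MemA ν lam m u →
          TemperedLaguerre.HomogeneousInitial ν lam u →
            (∃! w : ℝ → ℂ, TemperedLaguerre.IsProjection ν lam N u w) ∧
            ∀ w : ℝ → ℂ, TemperedLaguerre.IsProjection ν lam N u w →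
              TemperedLaguerre.MemA ν lam m (fun x => w x - u x) ∧
              TemperedLaguerre.weightedNorm (-ν) (fun x => w x - u x) ≤
                c N * (2 * lam * N) ^ (-(ν + m) / 2) *
                  TemperedLaguerre.weightedNorm m
                    (TemperedLaguerre.temperedDeriv (ν + m) lam u) ∧
              ∀ k : ℕ, k ≤ m →
                TemperedLaguerre.weightedNorm k
                    (TemperedLaguerre.temperedDeriv (ν + k) lam (fun x => w x - u x)) ≤
                  c N * (2 * lam * N) ^ (((k : ℝ) - m) / 2) *
                    TemperedLaguerre.weightedNorm m
                      (TemperedLaguerre.temperedDeriv (ν + m) lam u) := by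
  refine ⟨TemperedLaguerre.projConst ν m, TemperedLaguerre.tendsto_projConst hν m, ?_⟩
  intro lam hlam N hN hm u hu hIC
  refine ⟨?_, fun w hw => ⟨?_, hw.weightedNorm_le hν hlam hN hm hu hIC,
    fun k hk => hw.weightedNorm_temperedDeriv_le hν hlam hN hm hu hIC hk⟩⟩
  · obtain ⟨w, hw⟩ := TemperedLaguerre.exists_isProjection hν hlam N hu.1
    exact ⟨w, hw, fun w' hw' => hw'.unique hν hlam hu.1 hw⟩
  · obtain ⟨p, -, rfl⟩ := hw.exists_eq_glf
    exact (TemperedLaguerre.memA_glf hν hlam m p).sub hν hlam hu
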